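/- Let $\mathbb O=\mathbb H\oplus\mathbb H\cdot e$ be the octonions, with product $(a+b\,e)(c+d\,e)=(ac-\bar d b)+(da+b\bar c)\,e$, and let $G_2$ be the automorphism group of the algebra $\mathbb O$. It acts on $\operatorname{Im}\mathbb O\cong\mathbb R^7$ and complex-linearly on $\operatorname{Im}\mathbb O\otimes\mathbb C\cong\mathbb C^7$. Let $v\times w=\operatorname{Im}(v\cdot w)$ be the vector product and $(v,w)$ the standard inner product on $\operatorname{Im}\mathbb O$, both extended complex-bilinearly to $\mathbb C^7$; orthogonality ($\perp$, $\ominus$) in $\mathbb C^7$ refers to the Hermitian product $(v,\bar w)$. A complex subspace is isotropic if $(\cdot,\cdot)$ vanishes on it. For a line $\ell$ put $\ell^a=\{v:v\times\ell=0\}$. Spaces. All spaces of subspaces (and of tuples of subspaces) carry the smooth structure inherited by identifying a subspace with its orthogonal projection; $G_2$ carries the one inherited from $\operatorname{End}(\mathbb R^7)$. * $G_2/SO(4)$ is the space of associative $3$-dimensional subspaces $\xi\subset\operatorname{Im}\mathbb O$, i.e. imaginary parts of subalgebras isomorphic to $\mathbb H$. * $G_2/U(2)_+$ is the space of $2$-dimensional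 isotropic $W\subset\mathbb C^7$ with $v\times w=0$ for all $v,w\in W$, with projection $\pi_1(W)=(W\oplus\overline W)^\perp$. * $Q^5$ is the quadric of isotropic lines $\ell\subset\mathbb C^7$, with projection $\pi_2(\ell)=\ell\oplus\bar\ell\oplus(\ell\times\bar\ell)$. * $G_2/(U(1)\times U(1))$ is the space of pairs $(\ell,D)$ of complex subspaces of dimensions $1$ and $2$ with $\ell\subset D\subset\ell^a$, with projection $\pi_3(\ell,D)=q\oplus\bar q\oplus(q\times\bar q)$, $q=D\ominus\ell$. (The values of the projections are conjugation-invariant complex subspaces, identified with the real subspaces of which they are the complexifications.) For $s=1,2,3$ let $\mathcal T_s$ be the space of $G_2$-flags $\psi=(\psi_{-s},\dots,\psi_s)$: mutually orthogonal complex subspaces with sum $\mathbb C^7$ and $\psi_{-i}=\overline{\psi_i}$, of dimensions $(2,3,2)$, $(1,2,1,2,1)$, $(1,1,1,1,1,1,1)$ respectively, such that $\psi_i\times\psi_j\subset\psi_{i+j}$ for all $i,j\in\mathbb Z$, where $\psi_i=0$ for $|i|>s$. Let $\pi_0(\psi)=\bigoplus_{i\text{ even}}\psi_i$. Proposition. (0)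 The first, second and fourth of the above spaces are the homogeneous spaces their names indicate: there are $\xi_0$, $W_0$ and $p_0=(\ell_0,D_0)$ in them, with $\pi_1(W_0)=\xi_0=\pi_3(p_0)$, such that $G_2$ acts transitively on each space, the orbit map of the base point is smooth and has smooth local sections, and the stabilizer of the base point is the group of all $g\in G_2$ of the form $g(a+b\,e)=q_1a\bar q_1+(q_2b\bar q_1)e$ where $q_1,q_2$ are unit quaternions, arbitrary for $\xi_0$ (this group is $SO(4)$), with $q_2\in U(1)=\{x+yi\}$ for $W_0$ (this is $U(2)_+$), and with $q_1,q_2\in U(1)$ for $p_0$ (this is $U(1)\times U(1)$). (1)–(3) With these projections, $\mathcal T_1,\mathcal T_2,\mathcal T_3$, $G_2/U(2)_+$, $Q^5$ and $G_2/(U(1)\times U(1))$ are smooth, locally trivial, $G_2$-equivariant fibre bundles over $G_2/SO(4)$, and the following maps are $G_2$-equivariant isomorphisms of fibre bundles over $G_2/SO(4)$ (that is, equivariant diffeomorphisms commuting with the projections): 1. $\mathcal T_1\cong G_2/U(2)_+$ via $\psi\mapsto\psi_1$; 2. $\mathcal T_2\cong Q^5$ via $\psi\mapsto\psi_2$; 3.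 $\mathcal T_3\cong G_2/(U(1)\times U(1))$ via $\psi\mapsto(\ell,D)=(\psi_3,\ \psi_2\oplus\psi_3)$. -/

import Mathlib

open scoped Quaternion ContDiff Pointwise

noncomputable section

/-! ### Octonions and the group G₂ -/

/-- Octonions with coefficients in `R`: pairs `(a, b)` standing for `a + b · e` with `a`, `b`
quaternions.  `Oct ℝ` is the algebra of octonions, `Oct ℂ` its complexification. -/
abbrev Oct (R : Type) [CommRing R] : Type := ℍ[R] × ℍ[R]

/-- Octonion multiplication
`(a + b · e) (c + d · e) = (a c - d̄ b) + (d a + b c̄) · e`.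
Here `star` is the `R`-linear quaternionic conjugation. -/
def octMul {R : Type} [CommRing R] (x y : Oct R) : Oct R :=
  (x.1 * y.1 - star y.2 * x.2, y.2 * x.1 + x.2 * star y.1)

/-- The imaginary octonion with the given seven coordinates. -/
def imOct {R : Type} [CommRing R] (x : Fin 7 → R) : Oct R :=
  (⟨0, x 0, x 1, x 2⟩, ⟨x 3, x 4, x 5, x 6⟩)

/-- The seven coordinates of the imaginary part of an octonion. -/
def imCoord {R : Type} [CommRing R] (p : Oct R) : Fin 7 → R :=
  ![p.1.imI, p.1.imJ, p.1.imK, p.2.re, p.2.imI, p.2.imJ, p.2.imK]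

section
variable {R : Type} [CommRing R] (x : Fin 7 → R)

@[simp] theorem imOct_fst_re : (imOct x).1.re = 0 := rfl
@[simp] theorem imOct_fst_imI : (imOct x).1.imI = x 0 := rfl
@[simp] theorem imOct_fst_imJ : (imOct x).1.imJ = x 1 := rfl
@[simp] theorem imOct_fst_imK : (imOct x).1.imK = x 2 := rfl
@[simp] theorem imOct_snd_re : (imOct x).2.re = x 3 := rfl
@[simp] theorem imOct_snd_imI : (imOct x).2.imI = x 4 := rfl
@[simp] theorem imOct_snd_imJ : (imOct x).2.imJ = x 5 := rfl
@[simp] theorem imOct_snd_imK : (imOct x).2.imK = x 6 := rfl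

end

/-- The imaginary octonions, as a Euclidean space. -/
abbrev R7 : Type := EuclideanSpace ℝ (Fin 7)

/-- The complexified imaginary octonions, with the Hermitian inner product. -/
abbrev C7 : Type := EuclideanSpace ℂ (Fin 7)

/-- The group `G₂` of automorphisms of the algebra of octonions. -/
def G2 : Subgroup (Oct ℝ ≃ₗ[ℝ] Oct ℝ) where
  carrier := {g | ∀ x y, g (octMul x y) = octMul (g x) (g y)}
  mul_mem' := by
    intro g h hg hh x y
    simp only [Set.mem_ofPred_eq] at hg hh
    simp [LinearEquiv.mul_apply, hg, hh]
  one_mem' := by intro x y; rfl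
  inv_mem' := by
    intro g hg x y
    simp only [Set.mem_ofPred_eq] at hg
    apply g.injective
    rw [hg]
    simp only [← LinearEquiv.mul_apply, mul_inv_cancel, LinearEquiv.coe_one, id]

theorem octMul_one (x : Oct ℝ) : octMul x (1, 0) = x := by
  simp [octMul]

theorem one_octMul (x : Oct ℝ) : octMul (1, 0) x = x := by
  simp [octMul]

theorem G2.map_one (g : G2) : g.1 (1, 0) = (1, 0) := by
  have h : octMul (g.1 (1, 0)) (g.1 (g.1.symm (1, 0))) = g.1 (g.1.symm (1, 0)) := by
    rw [← g.2, one_octMul]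
  rwa [LinearEquiv.apply_symm_apply, octMul_one] at h

theorem octMul_self (x : Oct ℝ) :
    octMul x x = (2 * x.1.re) • x
      - ((x.1.re ^ 2 + x.1.imI ^ 2 + x.1.imJ ^ 2 + x.1.imK ^ 2 + x.2.re ^ 2 + x.2.imI ^ 2
        + x.2.imJ ^ 2 + x.2.imK ^ 2 : ℝ)) • ((1, 0) : Oct ℝ) := by
  ext <;> simp [octMul] <;> ring

/-- Automorphisms of the octonions preserve the imaginary octonions. -/
theorem G2.re_eq_zero (g : G2) {x : Oct ℝ} (hx : x.1.re = 0) : (g.1 x).1.re = 0 := by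
  by_contra hr
  have h1 := g.2 x x
  rw [octMul_self x, octMul_self (g.1 x), hx] at h1
  simp only [mul_zero, zero_smul, zero_sub, map_neg, map_smul] at h1
  have hm1 : g.1.toFun (1, 0) = (1, 0) := G2.map_one g
  change -(_ • g.1.toFun (1, 0)) = _ at h1
  rw [hm1, eq_sub_iff_add_eq, ← neg_smul, ← add_smul] at h1
  set r := (g.1 x).1.re with hrdef
  have h2 : ∃ c : ℝ, g.1 x = c • ((1, 0) : Oct ℝ) := by
    obtain ⟨a, ha⟩ : ∃ a : ℝ, a • ((1, 0) : Oct ℝ) = (2 * r) • g.1 x := ⟨_, h1⟩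
    refine ⟨(2 * r)⁻¹ * a, ?_⟩
    rw [mul_smul, ha, smul_smul, inv_mul_cancel₀ (by simpa using hr), one_smul]
  obtain ⟨c, hc⟩ := h2
  have h3 : x = c • ((1, 0) : Oct ℝ) := by
    apply g.1.injective
    rw [map_smul, hc]
    congr 1
    exact (G2.map_one g).symm
  have hc0 : c = 0 := by
    have := congrArg (fun y : Oct ℝ => y.1.re) h3
    simpa [hx] using this.symm
  apply hr
  rw [hrdef, hc, hc0]
  simp

theorem imCoord_imOct {R : Type} [CommRing R] (x : Fin 7 → R) : imCoord (imOct x) = x := by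
  funext i
  fin_cases i <;> rfl

theorem imOct_imCoord {R : Type} [CommRing R] {p : Oct R} (hp : p.1.re = 0) :
    imOct (imCoord p) = p := by
  ext <;> simp [imCoord, hp]

/-- An element of `G₂` as a linear map on the imaginary octonions. -/
def G2.toEnd (g : G2) : R7 →ₗ[ℝ] R7 where
  toFun x := WithLp.toLp 2 (imCoord (g.1 (imOct x)))
  map_add' x y := by
    have : imOct (x + y : R7) = imOct x + imOct y := by ext <;> simp
    rw [this, map_add]
    ext i
    fin_cases i <;> simp [imCoord]
  map_smul' c x := by
    have : imOct (c • x : R7) = c • imOct x := by ext <;> simp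
    rw [this, map_smul]
    ext i
    fin_cases i <;> simp [imCoord]

theorem G2.imOct_toEnd (g : G2) (x : R7) : imOct ((G2.toEnd g) x) = g.1 (imOct x) :=
  imOct_imCoord (G2.re_eq_zero g rfl)

theorem G2.toEnd_one : G2.toEnd 1 = LinearMap.id := by
  ext x i
  change imCoord (imOct _) i = _
  rw [imCoord_imOct]
  rfl

theorem G2.toEnd_mul (g h : G2) (x : R7) : G2.toEnd (g * h) x = G2.toEnd g (G2.toEnd h x) := by
  change WithLp.toLp 2 (imCoord (g.1 (h.1 (imOct x)))) = _
  rw [← G2.imOct_toEnd h]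
  rfl

theorem G2.toEnd_injective : Function.Injective G2.toEnd := by
  intro g h hgh
  ext1
  apply LinearEquiv.ext
  intro p
  have hp : p = p.1.re • ((1, 0) : Oct ℝ) + imOct (WithLp.toLp 2 (imCoord p) : R7) := by
    ext <;> simp [imCoord]
  rw [hp, map_add, map_add, map_smul, map_smul, G2.map_one, G2.map_one, ← G2.imOct_toEnd,
    ← G2.imOct_toEnd, hgh]

/-- The action of `G₂` on the imaginary octonions. -/
instance : DistribMulAction G2 R7 where
  smul g x := (G2.toEnd g) x
  one_smul x := by change G2.toEnd 1 x = x; rw [G2.toEnd_one]; rfl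
  mul_smul g h x := G2.toEnd_mul g h x
  smul_zero g := map_zero (G2.toEnd g)
  smul_add g x y := map_add (G2.toEnd g) x y

instance : SMulCommClass G2 ℝ R7 where
  smul_comm g c x := map_smul (G2.toEnd g) c x

/-- The real part of a complex vector. -/
def C7.rePart (v : C7) : R7 := WithLp.toLp 2 fun i => (v i).re

/-- The imaginary part of a complex vector. -/
def C7.imPart (v : C7) : R7 := WithLp.toLp 2 fun i => (v i).im

/-- The complex vector `x + y √-1`. -/
def C7.mk (x y : R7) : C7 := WithLp.toLp 2 fun i => ⟨x i, y i⟩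

/-- The action of `G₂` on the complexified imaginary octonions, the complex-linear extension of
the real one. -/
instance : DistribMulAction G2 C7 where
  smul g v := C7.mk (g • C7.rePart v) (g • C7.imPart v)
  one_smul v := by
    change C7.mk ((1 : G2) • C7.rePart v) ((1 : G2) • C7.imPart v) = v
    rw [one_smul, one_smul]
    rfl
  mul_smul g h v := by
    change C7.mk ((g * h) • C7.rePart v) ((g * h) • C7.imPart v) = _
    rw [mul_smul, mul_smul]
    rfl
  smul_zero g := by
    change C7.mk (g • (0 : R7)) (g • (0 : R7)) = 0
    rw [smul_zero]
    rfl
  smul_add g v w := by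
    change C7.mk (g • (C7.rePart v + C7.rePart w)) (g • (C7.imPart v + C7.imPart w)) = _
    rw [smul_add, smul_add]
    rfl

instance : SMulCommClass G2 ℂ C7 where
  smul_comm g c v := by
    have h1 : C7.rePart (c • v) = c.re • C7.rePart v - c.im • C7.imPart v := by
      ext i; simp [C7.rePart, C7.imPart]
    have h2 : C7.imPart (c • v) = c.re • C7.imPart v + c.im • C7.rePart v := by
      ext i; simp [C7.rePart, C7.imPart]
    change C7.mk (g • C7.rePart (c • v)) (g • C7.imPart (c • v))
      = c • C7.mk (g • C7.rePart v) (g • C7.imPart v)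
    rw [h1, h2, smul_sub, smul_add, smul_comm g, smul_comm g, smul_comm g, smul_comm g]
    ext i
    apply Complex.ext <;> simp [C7.mk]

/-! ### Algebra on the complexified imaginary octonions -/

/-- The vector product, the imaginary part of the octonion product, extended complex-bilinearly. -/
def cross (v w : C7) : C7 := WithLp.toLp 2 (imCoord (octMul (imOct v) (imOct w)))

/-- The complex-bilinear inner product. -/
def bilin (v w : C7) : ℂ := ∑ i, v i * w i

/-- A complex subspace is isotropic if the bilinear inner product vanishes on it. -/
def IsIsotropic (W : Submodule ℂ C7) : Prop := ∀ v ∈ W, ∀ w ∈ W, bilin v w = 0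

/-- Complex conjugation of vectors. -/
def conjVec (v : C7) : C7 := WithLp.toLp 2 fun i => starRingEnd ℂ (v i)

/-- The complex conjugate of a complex subspace. -/
def conjSub (W : Submodule ℂ C7) : Submodule ℂ C7 where
  carrier := {v | conjVec v ∈ W}
  add_mem' {v w} hv hw := by
    have : conjVec (v + w) = conjVec v + conjVec w := by ext i; simp [conjVec]
    simpa [this] using W.add_mem hv hw
  zero_mem' := by
    have : conjVec 0 = 0 := by ext i; simp [conjVec]
    simp [this]
  smul_mem' c v hv := by
    have : conjVec (c • v) = (starRingEnd ℂ c) • conjVec v := by ext i; simp [conjVec]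
    simpa [this] using W.smul_mem (starRingEnd ℂ c) hv

theorem cross_add_left (u v w : C7) : cross (u + v) w = cross u w + cross v w := by
  ext i; fin_cases i <;> simp [cross, octMul, imCoord] <;> ring

theorem cross_smul_left (c : ℂ) (v w : C7) : cross (c • v) w = c • cross v w := by
  ext i; fin_cases i <;> simp [cross, octMul, imCoord] <;> ring

/-- The annihilator `W^a` of a complex subspace with respect to the vector product. -/
def annih (W : Submodule ℂ C7) : Submodule ℂ C7 where
  carrier := {v | ∀ w ∈ W, cross v w = 0}
  add_mem' {u v} hu hv w hw := by rw [cross_add_left, hu w hw, hv w hw, add_zero]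
  zero_mem' w _ := by simpa using cross_smul_left 0 0 w
  smul_mem' c v hv w hw := by rw [cross_smul_left, hv w hw, smul_zero]

/-- The complex span of the vector products of elements of two subspaces. -/
def crossSub (V W : Submodule ℂ C7) : Submodule ℂ C7 :=
  Submodule.span ℂ {u | ∃ v ∈ V, ∃ w ∈ W, u = cross v w}

/-- The real vectors in a complex subspace.  If `V` is closed under conjugation, then `realPts V`
is the real subspace of which `V` is the complexification. -/
def realPts (V : Submodule ℂ C7) : Submodule ℝ R7 where
  carrier := {x | C7.mk x 0 ∈ V}
  add_mem' {x y} hx hy := by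
    have : C7.mk (x + y) 0 = C7.mk x 0 + C7.mk y 0 := by
      ext i; apply Complex.ext <;> simp [C7.mk]
    simpa [this] using V.add_mem hx hy
  zero_mem' := V.zero_mem
  smul_mem' c x hx := by
    have : C7.mk (c • x) 0 = (c : ℂ) • C7.mk x 0 := by
      ext i; apply Complex.ext <;> simp [C7.mk]
    simpa [this] using V.smul_mem (c : ℂ) hx

/-! ### `G₂/SO(4)` and its three twistor spaces -/

/-- A real subspace is associative if it is the imaginary part of a subalgebra of the octonions
isomorphic to the quaternions. -/
def IsAssociative (ξ : Submodule ℝ R7) : Prop :=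
  ∃ f : ℍ[ℝ] →ₗ[ℝ] Oct ℝ, Function.Injective f ∧ (∀ a b, f (a * b) = octMul (f a) (f b)) ∧
    ∀ x : R7, x ∈ ξ ↔ imOct x ∈ LinearMap.range f

/-- `G₂/SO(4)`: the associative `3`-dimensional subspaces of the imaginary octonions. -/
def AssocGr : Set (Submodule ℝ R7) := {ξ | Module.finrank ℝ ξ = 3 ∧ IsAssociative ξ}

/-- `T₁ = G₂/U(2)₊`: the complex-coassociative isotropic subspaces of dimension two. -/
def T1 : Set (Submodule ℂ C7) :=
  {W | Module.finrank ℂ W = 2 ∧ IsIsotropic W ∧ ∀ v ∈ W, ∀ w ∈ W, cross v w = 0}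

/-- `T₂ = Q⁵`: the isotropic lines. -/
def Q5 : Set (Submodule ℂ C7) := {l | Module.finrank ℂ l = 1 ∧ IsIsotropic l}

/-- `T₃ = G₂/(U(1) × U(1))`: the pairs `(ℓ, D)` of subspaces of dimensions `1` and `2` with
`ℓ ⊆ D ⊆ ℓ^a`. -/
def T3 : Set (Submodule ℂ C7 × Submodule ℂ C7) :=
  {p | Module.finrank ℂ p.1 = 1 ∧ Module.finrank ℂ p.2 = 2 ∧ p.1 ≤ p.2 ∧ p.2 ≤ annih p.1}

/-- `W ↦ (W ⊕ W̄)ᗮ`. -/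
def twistorProj1 (W : Submodule ℂ C7) : Submodule ℝ R7 := realPts (W ⊔ conjSub W)ᗮ

/-- `ℓ ↦ ℓ ⊕ ℓ̄ ⊕ (ℓ × ℓ̄)`. -/
def twistorProj2 (l : Submodule ℂ C7) : Submodule ℝ R7 :=
  realPts (l ⊔ conjSub l ⊔ crossSub l (conjSub l))

/-- `(ℓ, D) ↦ q ⊕ q̄ ⊕ (q × q̄)`, where `q` is the orthogonal complement of `ℓ` in `D`. -/
def twistorProj3 (p : Submodule ℂ C7 × Submodule ℂ C7) : Submodule ℝ R7 :=
  twistorProj2 (p.2 ⊓ p.1ᗮ)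

/-! ### `G₂`-flags -/

/-- Tuples `(ψ₋ₛ, …, ψₛ)` of complex subspaces. -/
abbrev Legs (s : ℕ) : Type := Set.Icc (-(s : ℤ)) (s : ℤ) → Submodule ℂ C7

/-- The leg `ψᵢ`, where `ψᵢ = 0` for `|i| > s`. -/
def leg {s : ℕ} (ψ : Legs s) (i : ℤ) : Submodule ℂ C7 :=
  if h : i ∈ Set.Icc (-(s : ℤ)) (s : ℤ) then ψ ⟨i, h⟩ else ⊥

/-- The real flag manifold: decompositions of the complexified imaginary octonions into mutually
orthogonal legs `ψ₋ₛ, …, ψₛ` with `dim ψᵢ = d |i|` and `ψ₋ᵢ` conjugate to `ψᵢ`. -/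
def RealFlags (s : ℕ) (d : ℕ → ℕ) : Set (Legs s) :=
  {ψ | (∀ i, Module.finrank ℂ (ψ i) = d i.1.natAbs) ∧ (∀ i j, i ≠ j → ψ i ⟂ ψ j) ∧
    (⨆ i, ψ i) = ⊤ ∧ ∀ i, leg ψ (-i) = conjSub (leg ψ i)}

/-- The `G₂`-flags of a given type: `ψᵢ × ψⱼ ⊆ ψᵢ₊ⱼ` for all integers `i`, `j`. -/
def G2Flags (s : ℕ) (d : ℕ → ℕ) : Set (Legs s) :=
  {ψ | ψ ∈ RealFlags s d ∧ ∀ i j : ℤ, ∀ v ∈ leg ψ i, ∀ w ∈ leg ψ j, cross v w ∈ leg ψ (i + j)}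

/-- `𝒯₁`: leg dimensions `2, 3, 2`. -/
def Flags1 : Set (Legs 1) := G2Flags 1 fun i => if i = 0 then 3 else 2

/-- `𝒯₂`: leg dimensions `1, 2, 1, 2, 1`. -/
def Flags2 : Set (Legs 2) := G2Flags 2 fun i => if i = 1 then 2 else 1

/-- `𝒯₃`: seven legs of dimension `1`. -/
def Flags3 : Set (Legs 3) := G2Flags 3 fun _ => 1

/-- The projection that combines the even-numbered legs. -/
def evenProj {s : ℕ} (ψ : Legs s) : Submodule ℝ R7 := realPts (⨆ i : ℤ, leg ψ (2 * i))

/-! ### Smooth structures -/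

/-- A type realized inside a finite-dimensional normed space.  Subsets of such types inherit the
notion of smooth map from the ambient normed spaces. -/
class SmoothModel (A : Type) where
  Space : Type
  [normed : NormedAddCommGroup Space]
  [normedSpace : NormedSpace ℝ Space]
  emb : A → Space
  emb_injective : Function.Injective emb

attribute [reducible, instance] SmoothModel.normed SmoothModel.normedSpace

theorem starProjection_injective_real :
    Function.Injective (fun V : Submodule ℝ R7 => V.starProjection) := by
  intro V W h
  rw [← Submodule.range_starProjection V, ← Submodule.range_starProjection W]
  exact congrArg (fun f : R7 →L[ℝ] R7 => f.range) h

theorem starProjection_injective_complex :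
    Function.Injective (fun V : Submodule ℂ C7 => V.starProjection) := by
  intro V W h
  rw [← Submodule.range_starProjection V, ← Submodule.range_starProjection W]
  exact congrArg (fun f : C7 →L[ℂ] C7 => f.range) h

/-- Real subspaces are realized by their orthogonal projections. -/
instance : SmoothModel (Submodule ℝ R7) where
  Space := R7 →L[ℝ] R7
  emb V := V.starProjection
  emb_injective := starProjection_injective_real

/-- Complex subspaces are realized by their orthogonal projections. -/
instance : SmoothModel (Submodule ℂ C7) where
  Space := C7 →L[ℂ] C7
  emb V := V.starProjection
  emb_injective := starProjection_injective_complex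

/-- Elements of `G₂` are realized as endomorphisms of the imaginary octonions. -/
instance : SmoothModel G2 where
  Space := R7 →L[ℝ] R7
  emb g := LinearMap.toContinuousLinearMap (G2.toEnd g)
  emb_injective := fun _ _ h => G2.toEnd_injective (LinearMap.toContinuousLinearMap.injective h)

instance {A B : Type} [SmoothModel A] [SmoothModel B] : SmoothModel (A × B) where
  Space := SmoothModel.Space A × SmoothModel.Space B
  emb p := (SmoothModel.emb p.1, SmoothModel.emb p.2)
  emb_injective := SmoothModel.emb_injective.prodMap SmoothModel.emb_injective

instance {ι A : Type} [Fintype ι] [SmoothModel A] : SmoothModel (ι → A) where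
  Space := ι → SmoothModel.Space A
  emb f i := SmoothModel.emb (f i)
  emb_injective := fun _ _ h => funext fun i => SmoothModel.emb_injective (congrFun h i)

/-- The part of `X` lying in a set `O` of the ambient normed space. -/
def restrictTo {A : Type} [SmoothModel A] (X : Set A) (O : Set (SmoothModel.Space A)) : Set A :=
  {x | x ∈ X ∧ SmoothModel.emb x ∈ O}

/-- `f` is smooth on `X`: near every point of `X` it is the restriction of a `C^∞` map between
open subsets of the ambient normed spaces. -/
def SmoothOn {A B : Type} [SmoothModel A] [SmoothModel B] (X : Set A) (f : A → B) : Prop :=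
  ∀ x ∈ X, ∃ O : Set (SmoothModel.Space A), IsOpen O ∧ SmoothModel.emb x ∈ O ∧
    ∃ F : SmoothModel.Space A → SmoothModel.Space B, ContDiffOn ℝ ∞ F O ∧
      ∀ y ∈ restrictTo X O, F (SmoothModel.emb y) = SmoothModel.emb (f y)

/-- `f` restricts to a diffeomorphism of `X` onto `Y`. -/
def IsDiffeo {A B : Type} [SmoothModel A] [SmoothModel B] (X : Set A) (Y : Set B) (f : A → B) :
    Prop :=
  Set.BijOn f X Y ∧ SmoothOn X f ∧ ∃ h : B → A, Set.LeftInvOn h f X ∧ SmoothOn Y h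

/-! ### Homogeneous spaces and fibre bundles -/

/-- `g ↦ g • x₀` induces a `G₂`-equivariant diffeomorphism from the homogeneous space `G₂/H` onto
`X`: `X` is the orbit of `x₀`, `H` is its stabilizer, and the orbit map is smooth and admits
smooth local sections. -/
structure IsHomogeneousSpace {A : Type} [SmoothModel A] [MulAction G2 A] (X : Set A)
    (H : Subgroup G2) (x₀ : A) : Prop where
  orbit_eq : MulAction.orbit G2 x₀ = X
  stabilizer_eq : MulAction.stabilizer G2 x₀ = H
  smooth : SmoothOn (Set.univ : Set G2) fun g => g • x₀
  sections : ∀ x ∈ X, ∃ O : Set (SmoothModel.Space A), IsOpen O ∧ SmoothModel.emb x ∈ O ∧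
    ∃ σ : A → G2, SmoothOn (restrictTo X O) σ ∧ ∀ y ∈ restrictTo X O, σ y • x₀ = y

/-- `π : X → B` is a smooth, locally trivial fibre bundle on which `G₂` acts smoothly, compatibly
with its action on `B`. -/
structure IsG2FibreBundle {A C : Type} [SmoothModel A] [MulAction G2 A] [SmoothModel C]
    [MulAction G2 C] (X : Set A) (B : Set C) (π : A → C) : Prop where
  mapsTo : Set.MapsTo π X B
  surjOn : Set.SurjOn π X B
  smooth : SmoothOn X π
  smul_mem : ∀ g : G2, ∀ x ∈ X, g • x ∈ X
  smooth_smul : SmoothOn ((Set.univ : Set G2) ×ˢ X) fun p => p.1 • p.2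
  equivariant : ∀ g : G2, ∀ x ∈ X, π (g • x) = g • π x
  locally_trivial : ∃ F : Set A, ∀ b ∈ B, ∃ O : Set (SmoothModel.Space C), IsOpen O ∧
    SmoothModel.emb b ∈ O ∧ ∃ t : A → C × A,
      IsDiffeo (X ∩ π ⁻¹' restrictTo B O) (restrictTo B O ×ˢ F) t ∧
        ∀ x ∈ X ∩ π ⁻¹' restrictTo B O, (t x).1 = π x

/-- `Φ` is an isomorphism of `G₂`-equivariant smooth fibre bundles over `B` from `π : X → B` to
`π' : X' → B`. -/
structure IsG2BundleIso {A A' C : Type} [SmoothModel A] [MulAction G2 A] [SmoothModel A']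
    [MulAction G2 A'] [SmoothModel C] [MulAction G2 C] (X : Set A) (X' : Set A') (B : Set C)
    (π : A → C) (π' : A' → C) (Φ : A → A') : Prop where
  source : IsG2FibreBundle X B π
  target : IsG2FibreBundle X' B π'
  diffeo : IsDiffeo X X' Φ
  proj_comm : ∀ x ∈ X, π' (Φ x) = π x
  equivariant : ∀ g : G2, ∀ x ∈ X, Φ (g • x) = g • Φ x

/-! ### Subgroups of `SO(4)` -/

/-- The circle group of unit quaternions `x + y i`. -/
def circleQ : Subgroup (unitary ℍ[ℝ]) where
  carrier := {q | q.1.imJ = 0 ∧ q.1.imK = 0}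
  mul_mem' {p q} hp hq := by
    simp only [Set.mem_ofPred_eq] at hp hq
    simp [hp, hq]
  one_mem' := by simp
  inv_mem' {q} hq := by
    simp only [Set.mem_ofPred_eq] at hq
    change (star q.1).imJ = 0 ∧ (star q.1).imK = 0
    simp [hq]

/-- The subgroup of `G₂` of the maps `(a, b) ↦ (q₁ a q̄₁, q₂ b q̄₁)` with `q₁ ∈ P`, `q₂ ∈ Q`. -/
def quatSubgroup (P Q : Subgroup (unitary ℍ[ℝ])) : Subgroup G2 where
  carrier := {g | ∃ q₁ ∈ P, ∃ q₂ ∈ Q, ∀ a b : ℍ[ℝ],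
    g.1 (a, b) = (q₁.1 * a * star q₁.1, q₂.1 * b * star q₁.1)}
  mul_mem' := by
    rintro g h ⟨p, hp, q, hq, hg⟩ ⟨p', hp', q', hq', hh⟩
    refine ⟨p * p', P.mul_mem hp hp', q * q', Q.mul_mem hq hq', fun a b => ?_⟩
    change g.1 (h.1 (a, b)) = _
    rw [hh, hg]
    simp [mul_assoc]
  one_mem' := ⟨1, P.one_mem, 1, Q.one_mem, fun a b => by simp⟩
  inv_mem' := by
    rintro g ⟨p, hp, q, hq, hg⟩
    refine ⟨p⁻¹, P.inv_mem hp, q⁻¹, Q.inv_mem hq, fun a b => ?_⟩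
    have h1 : p.1 * star p.1 = 1 := Unitary.coe_mul_star_self p
    have h2 : q.1 * star q.1 = 1 := Unitary.coe_mul_star_self q
    apply g.1.injective
    change g.1 (g.1⁻¹ (a, b)) = g.1 (star p.1 * a * star (star p.1), star q.1 * b * star (star p.1))
    rw [← LinearEquiv.mul_apply, mul_inv_cancel, hg, star_star]
    change (a, b) = _
    ext1
    · change a = p.1 * (star p.1 * a * p.1) * star p.1
      rw [mul_assoc, mul_assoc, mul_assoc, h1, mul_one, ← mul_assoc, h1, one_mul]
    · change b = q.1 * (star q.1 * b * p.1) * star p.1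
      rw [mul_assoc, mul_assoc, mul_assoc, h1, mul_one, ← mul_assoc, h2, one_mul]

/-- `SO(4) = Sp(1) ×_{ℤ/2} Sp(1)`. -/
def SO4 : Subgroup G2 := quatSubgroup ⊤ ⊤

/-- `U(2)₊`, with Lie algebra `su(2) ⊕ u(1)`. -/
def U2plus : Subgroup G2 := quatSubgroup ⊤ circleQ

/-- `U(1) × U(1)`, a maximal torus of `SO(4)`. -/
def torusU1U1 : Subgroup G2 := quatSubgroup circleQ circleQ

end

/-!
`G₂` acts simply transitively on the basic triples, the orthonormal vectors `a, b, c` in `Im 𝕆` with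
`c` orthogonal to `a × b`: the images `a, b, a × b, c, …` of the standard basis multiply in the
same way as the standard basis itself (`IsTriple.rcross_tripleLin`), by repeated use of the
linearized identity `x × (x × z) = (x, z) x - (x, x) z`.  The automorphism `tripleG2 a b c` depends
smoothly on the triple.  Only existence is needed here, not uniqueness.

A subspace in one of the spaces in question determines, locally and smoothly by projecting fixed
vectors and normalizing, a basic triple adapted to it.  For an associative subspace `ξ` take `a` and
`b` in `ξ` and `c` orthogonal to it.  For an isotropic line take `a`, `b` the real and imaginary
parts of a spanning vector and any admissible `c`.  A plane in `G₂/U(2)₊` and a pair `(ℓ, D)`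
contain a null frame `v, w`, and `v = a + b √-1`, `w = c + (a × (b × c)) √-1` for a basic triple `a, b, c`
(`IsNullFrame.isTriple`, `IsNullFrame.imPart_eq`).  So `G₂` acts transitively on each of the spaces,
with smooth local sections of the orbit maps: `hasLocalSections_AssocGr`, `hasLocalSections_T1`,
`hasLocalSections_Q5`, `hasLocalSections_T3`.

The rest is formal.  Equivariant maps out of such a space are smooth
(`HasLocalSections.smoothOn`), and local sections of the base trivialize every equivariant map onto
it (`HasLocalSections.isG2FibreBundle`).  A smooth equivariant map from flags to one of the twistor
spaces is therefore an isomorphism of bundles once it is injective and compatible with the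
projections at a single flag (`HasLocalSections.isG2BundleIso`).  Injectivity holds because a flag
is determined by its legs of positive index, and `ψ₁` is the rest of the annihilator of the top leg
(`injOn_leg_one`, `injOn_leg_two`, `injOn_legs_three`).  The base flags are the weight
decompositions of `ℂ⁷` under one-parameter subgroups of the maximal torus (`weightFlag`).

An automorphism that preserves `Im ℍ` restricts to an inner automorphism of `ℍ`, which gives the
stabilizer `SO(4)`; the other two stabilizers consist of the elements of `SO(4)` for which `q₂`,
respectively `q₁` and `q₂`, commute with `i`.
-/

noncomputable section

namespace OctCross

open SmoothModel Filter

/-! ### The vector product in coordinates -/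

section Coordinates

variable {R : Type} [CommRing R] (x y z : Fin 7 → R)

/-- The vector product of imaginary octonions in coordinates, over any commutative ring. -/
def crs : Fin 7 → R := imCoord (octMul (imOct x) (imOct y))

/-- The bilinear dot product in coordinates, over any commutative ring. -/
def dotp : R := ∑ i, x i * y i

theorem crs_eq : crs x y =
    ![x 1 * y 2 - x 2 * y 1 + x 3 * y 4 - x 4 * y 3 + x 6 * y 5 - x 5 * y 6,
      x 2 * y 0 - x 0 * y 2 + x 3 * y 5 - x 5 * y 3 + x 4 * y 6 - x 6 * y 4,
      x 0 * y 1 - x 1 * y 0 + x 3 * y 6 - x 6 * y 3 + x 5 * y 4 - x 4 * y 5,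
      x 4 * y 0 + x 5 * y 1 + x 6 * y 2 - x 0 * y 4 - x 1 * y 5 - x 2 * y 6,
      x 0 * y 3 - x 3 * y 0 + x 2 * y 5 - x 1 * y 6 + x 6 * y 1 - x 5 * y 2,
      x 1 * y 3 - x 3 * y 1 + x 0 * y 6 - x 2 * y 4 + x 4 * y 2 - x 6 * y 0,
      x 2 * y 3 - x 3 * y 2 + x 1 * y 4 - x 0 * y 5 + x 5 * y 0 - x 4 * y 1] := by
  funext i
  fin_cases i <;> simp [crs, octMul, imCoord] <;> ring

theorem dotp_eq : dotp x y = x 0 * y 0 + x 1 * y 1 + x 2 * y 2 + x 3 * y 3 + x 4 * y 4 + x 5 * y 5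
    + x 6 * y 6 := by
  simp [dotp, Fin.sum_univ_succ]; ring

theorem crs_anti : crs x y = -crs y x := by
  funext i
  simp only [crs_eq, Pi.neg_apply]
  fin_cases i <;> simp <;> ring

theorem dotp_crs : dotp (crs x y) z = dotp x (crs y z) := by
  simp only [crs_eq, dotp_eq]
  simp
  ring

/-- The linearization of `x × (x × z) = (x, z) x - (x, x) z`. -/
theorem crs_crs : crs x (crs y z) =
    -crs y (crs x z) - (2 * dotp x y) • z + dotp x z • y + dotp y z • x := by
  funext i
  simp only [dotp_eq, Pi.add_apply, Pi.sub_apply, Pi.neg_apply, Pi.smul_apply, smul_eq_mul]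
  fin_cases i <;> simp [crs_eq] <;> ring

theorem octMul_imOct : octMul (imOct x) (imOct y) = -(dotp x y) • (1, 0) + imOct (crs x y) := by
  rw [dotp_eq]
  ext <;> simp [octMul, crs_eq] <;> ring

end Coordinates

/-! ### The real vector product and basic triples -/

/-- The vector product of `ℝ⁷ = Im 𝕆`. -/
def rcross (x y : R7) : R7 := WithLp.toLp 2 (crs x y)

theorem inner_eq_dotp (x y : R7) : inner ℝ x y = dotp x y := by
  simp [PiLp.inner_apply, dotp, mul_comm]

theorem rcross_add_left (x y z : R7) : rcross (x + y) z = rcross x z + rcross y z := by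
  ext i; fin_cases i <;> simp [rcross, crs_eq] <;> ring

theorem rcross_anti (x y : R7) : rcross x y = -rcross y x := by
  ext i; exact congrFun (crs_anti x y) i

theorem rcross_add_right (x y z : R7) : rcross x (y + z) = rcross x y + rcross x z := by
  rw [rcross_anti, rcross_add_left, rcross_anti y, rcross_anti z]; abel

theorem rcross_smul_left (r : ℝ) (x y : R7) : rcross (r • x) y = r • rcross x y := by
  ext i; fin_cases i <;> simp [rcross, crs_eq] <;> ring

theorem rcross_smul_right (r : ℝ) (x y : R7) : rcross x (r • y) = r • rcross x y := by
  rw [rcross_anti, rcross_smul_left, rcross_anti y, smul_neg, neg_neg]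

theorem rcross_neg_right (x y : R7) : rcross x (-y) = -rcross x y := by
  rw [← neg_one_smul ℝ, rcross_smul_right, neg_one_smul]

theorem rcross_neg_left (x y : R7) : rcross (-x) y = -rcross x y := by
  rw [← neg_one_smul ℝ, rcross_smul_left, neg_one_smul]

theorem rcross_self (x : R7) : rcross x x = 0 := by
  ext i; fin_cases i <;> simp [rcross, crs_eq] <;> ring

theorem inner_rcross (x y z : R7) : inner ℝ (rcross x y) z = inner ℝ x (rcross y z) := by
  simp only [inner_eq_dotp]; exact dotp_crs x y z

theorem rcross_rcross (x y z : R7) : rcross x (rcross y z) =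
    -rcross y (rcross x z) - (2 * inner ℝ x y) • z + inner ℝ x z • y + inner ℝ y z • x := by
  simp only [inner_eq_dotp]
  ext i; exact congrFun (crs_crs x y z) i

theorem rcross_rcross_self (x z : R7) :
    rcross x (rcross x z) = inner ℝ x z • x - (inner ℝ x x : ℝ) • z := by
  have h := rcross_rcross x x z
  have h2 : (2 : ℝ) • rcross x (rcross x z)
      = (2 : ℝ) • (inner ℝ x z • x - (inner ℝ x x : ℝ) • z) := by
    rw [two_smul]; nth_rewrite 1 [h]; module
  exact smul_right_injective _ (two_ne_zero) h2

theorem inner_rcross_left (x y : R7) : inner ℝ x (rcross x y) = 0 := by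
  rw [← inner_rcross, rcross_self, inner_zero_left]

theorem inner_rcross_right (x y : R7) : inner ℝ y (rcross x y) = 0 := by
  rw [rcross_anti, inner_neg_right, inner_rcross_left, neg_zero]

/-- A basic triple: orthonormal `a`, `b`, `c` with `c` orthogonal to `a × b`.  These are the images
of `i, j, e` under the automorphisms of the octonions. -/
structure IsTriple (a b c : R7) : Prop where
  aa : inner ℝ a a = (1 : ℝ)
  bb : inner ℝ b b = (1 : ℝ)
  cc : inner ℝ c c = (1 : ℝ)
  ab : inner ℝ a b = (0 : ℝ)
  ac : inner ℝ a c = (0 : ℝ)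
  bc : inner ℝ b c = (0 : ℝ)
  abc : inner ℝ (rcross a b) c = (0 : ℝ)

/-- The linear map of `ℝ⁷` that extends `i, j, e ↦ a, b, c` multiplicatively. -/
def tripleLin (a b c : R7) : R7 →ₗ[ℝ] R7 where
  toFun x := x 0 • a + x 1 • b + x 2 • rcross a b + x 3 • c + x 4 • rcross a c + x 5 • rcross b c
    + x 6 • rcross (rcross a b) c
  map_add' x y := by simp only [PiLp.add_apply]; module
  map_smul' r x := by simp only [PiLp.smul_apply, smul_eq_mul, RingHom.id_apply]; module

theorem tripleLin_apply (a b c x : R7) : tripleLin a b c x =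
    x 0 • a + x 1 • b + x 2 • rcross a b + x 3 • c + x 4 • rcross a c + x 5 • rcross b c
    + x 6 • rcross (rcross a b) c := rfl

/-- For mutually orthogonal vectors the vector product is associative up to sign. -/
theorem rcross_assoc_of_orthogonal {a b c : R7} (hab : inner ℝ a b = (0 : ℝ))
    (hac : inner ℝ a c = (0 : ℝ)) (hbc : inner ℝ b c = (0 : ℝ)) :
    rcross a (rcross b c) = -rcross (rcross a b) c := by
  rw [rcross_anti b c, rcross_neg_right, rcross_rcross a c b, hab, hac, real_inner_comm, hbc,
    rcross_anti c]
  module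

namespace IsTriple

variable {a b c : R7} (h : IsTriple a b c)
include h

theorem rcross_tripleLin (x y : R7) :
    rcross (tripleLin a b c x) (tripleLin a b c y) = tripleLin a b c (rcross x y) := by
  obtain ⟨aa, bb, cc, ab, ac, bc, abc⟩ := h
  have ba : inner ℝ b a = (0 : ℝ) := by rw [real_inner_comm, ab]
  have ca : inner ℝ c a = (0 : ℝ) := by rw [real_inner_comm, ac]
  have cb : inner ℝ c b = (0 : ℝ) := by rw [real_inner_comm, bc]
  set f2 := rcross a b with e2
  set f4 := rcross a c with e4
  set f5 := rcross b c with e5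
  set f6 := rcross f2 c with e6
  have e6' : f6 = -rcross a f5 := by rw [rcross_assoc_of_orthogonal ab ac bc, neg_neg]
  have e6'' : f6 = rcross b f4 := by
    rw [rcross_assoc_of_orthogonal ba bc ac, rcross_anti b a, rcross_neg_left, neg_neg]
  have t02 : rcross a f2 = -b := by rw [rcross_rcross_self, ab, aa]; module
  have t12 : rcross b f2 = a := by
    rw [e2, rcross_anti a b, rcross_neg_right, rcross_rcross_self, ba, bb]; module
  have t04 : rcross a f4 = -c := by rw [rcross_rcross_self, ac, aa]; module
  have t34 : rcross c f4 = a := by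
    rw [e4, rcross_anti a c, rcross_neg_right, rcross_rcross_self, ca, cc]; module
  have t15 : rcross b f5 = -c := by rw [rcross_rcross_self, bc, bb]; module
  have t35 : rcross c f5 = b := by
    rw [e5, rcross_anti b c, rcross_neg_right, rcross_rcross_self, cb, cc]; module
  have f22 : inner ℝ f2 f2 = (1 : ℝ) := by
    rw [e2, inner_rcross, ← e2, t12, aa]
  have cf2 : inner ℝ c f2 = (0 : ℝ) := by rw [real_inner_comm, abc]
  have t26 : rcross f2 f6 = -c := by rw [rcross_rcross_self, abc, f22]; module
  have t36 : rcross c f6 = f2 := by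
    rw [e6, rcross_anti f2 c, rcross_neg_right, rcross_rcross_self, cf2, cc]; module
  have t05 : rcross a f5 = -f6 := by rw [e6', neg_neg]
  have t14 : rcross b f4 = f6 := e6''.symm
  have t06 : rcross a f6 = f5 := by
    rw [e6', rcross_neg_right, rcross_rcross_self, aa, e5, ← inner_rcross, abc]; module
  have t16 : rcross b f6 = -f4 := by
    rw [e6'', rcross_rcross_self, bb, e4, ← inner_rcross, rcross_anti b a, inner_neg_left, ← e2,
      abc]
    module
  have f2a : inner ℝ f2 a = (0 : ℝ) := by rw [real_inner_comm, inner_rcross_left]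
  have f2b : inner ℝ f2 b = (0 : ℝ) := by rw [real_inner_comm, inner_rcross_right]
  have f4a : inner ℝ f4 a = (0 : ℝ) := by rw [real_inner_comm, inner_rcross_left]
  have f4b : inner ℝ f4 b = (0 : ℝ) := by
    rw [real_inner_comm, e4, ← inner_rcross, rcross_anti b a, inner_neg_left, ← e2, abc, neg_zero]
  have f4c : inner ℝ f4 c = (0 : ℝ) := by rw [real_inner_comm, inner_rcross_right]
  have f5b : inner ℝ f5 b = (0 : ℝ) := by rw [real_inner_comm, inner_rcross_left]
  have f5a : inner ℝ f5 a = (0 : ℝ) := by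
    rw [real_inner_comm, e5, ← inner_rcross, ← e2, abc]
  have t24 : rcross f2 f4 = -f5 := by
    rw [e4, rcross_rcross f2 a c, ← e6, t06, f2a, abc, ac]; module
  have t25 : rcross f2 f5 = f4 := by
    rw [e5, rcross_rcross f2 b c, ← e6, t16, f2b, abc, bc]; module
  have t45 : rcross f4 f5 = -f2 := by
    rw [e5, rcross_rcross f4 b c, rcross_anti f4 c, t34, f4b, f4c, bc, rcross_neg_right,
      rcross_anti b a, ← e2]
    module
  have af5 : inner ℝ a f5 = (0 : ℝ) := by rw [real_inner_comm, f5a]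
  have bf4 : inner ℝ b f4 = (0 : ℝ) := by rw [real_inner_comm, f4b]
  have f45 : inner ℝ f4 f5 = (0 : ℝ) := by
    rw [e4, inner_rcross, t35, ab]
  have f54 : inner ℝ f5 f4 = (0 : ℝ) := by rw [real_inner_comm, f45]
  have t46 : rcross f4 f6 = b := by
    rw [e6', rcross_neg_right, rcross_rcross f4 a f5, t45, rcross_neg_right, t02, f4a, f45, af5]
    module
  have t56 : rcross f5 f6 = -a := by
    rw [e6'', rcross_rcross f5 b f4, rcross_anti f5 f4, t45, neg_neg, t12, f5b, f54, bf4]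
    module
  simp only [tripleLin_apply, ← e2, ← e4, ← e5, ← e6]
  simp only [rcross_add_left, rcross_add_right, rcross_smul_left, rcross_smul_right, rcross_self,
    ← e2, ← e4, ← e5, ← e6, t02, t12, t04, t34, t15, t35, t26, t36, t05, t14, t06, t16, t24, t25,
    t45, t46, t56, rcross_anti b a, rcross_anti c a, rcross_anti c b, rcross_anti f2 a,
    rcross_anti f2 b, rcross_anti c f2, rcross_anti f4 a, rcross_anti f4 b, rcross_anti f4 f2,
    rcross_anti f4 c, rcross_anti f5 a, rcross_anti f5 b, rcross_anti f5 c, rcross_anti f5 f2,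
    rcross_anti f5 f4, rcross_anti f6 a, rcross_anti f6 b, rcross_anti f6 f2, rcross_anti f6 c,
    rcross_anti f6 f4, rcross_anti f6 f5]
  simp only [rcross, crs_eq]
  simp
  module

theorem inner_tripleLin (x y : R7) :
    inner ℝ (tripleLin a b c x) (tripleLin a b c y) = inner ℝ x y := by
  obtain ⟨aa, bb, cc, ab, ac, bc, abc⟩ := h
  have ba : inner ℝ b a = (0 : ℝ) := by rw [real_inner_comm, ab]
  have ca : inner ℝ c a = (0 : ℝ) := by rw [real_inner_comm, ac]
  have cb : inner ℝ c b = (0 : ℝ) := by rw [real_inner_comm, bc]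
  have key (u v w : R7) (huv : inner ℝ u v = (0 : ℝ)) (hv : inner ℝ v v = (1 : ℝ)) :
      inner ℝ (rcross u v) (rcross w v) = inner ℝ u w := by
    rw [inner_rcross, rcross_anti w v, rcross_neg_right, rcross_rcross_self, hv, one_smul,
      neg_sub, inner_sub_right, inner_smul_right, huv]; ring
  have e22 : inner ℝ (rcross a b) (rcross a b) = (1 : ℝ) := by rw [key _ _ _ ab bb, aa]
  have e23 := inner_rcross_left a b
  have e24 := inner_rcross_right a b
  have e25 := inner_rcross_left a c
  have e26 := inner_rcross_right a c
  have e27 := inner_rcross_left b c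
  have e28 := inner_rcross_right b c
  have e29 := inner_rcross_left (rcross a b) c
  have e30 := inner_rcross_right (rcross a b) c
  have e31 : inner ℝ b (rcross a c) = (0 : ℝ) := by
    rw [← inner_rcross, rcross_anti b a, inner_neg_left, abc, neg_zero]
  have e32 : inner ℝ a (rcross b c) = (0 : ℝ) := by rw [← inner_rcross, abc]
  have e33 : inner ℝ a (rcross (rcross a b) c) = (0 : ℝ) := by
    rw [← inner_rcross, rcross_rcross_self, ab, inner_sub_left, inner_smul_left, inner_smul_left,
      bc]; simp
  have e34 : inner ℝ b (rcross (rcross a b) c) = (0 : ℝ) := by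
    rw [← inner_rcross, rcross_anti a b, rcross_neg_right, rcross_rcross_self, ba, inner_neg_left,
      inner_sub_left, inner_smul_left, inner_smul_left, ac]; simp
  have e35 : inner ℝ (rcross a b) (rcross a c) = (0 : ℝ) := by
    rw [rcross_anti a b, rcross_anti a c, inner_neg_left, inner_neg_right, neg_neg,
      key _ _ _ ba aa, bc]
  have e36 : inner ℝ (rcross a b) (rcross b c) = (0 : ℝ) := by
    rw [inner_rcross, rcross_rcross_self, bc, inner_sub_right, inner_smul_right, inner_smul_right,
      ac]; simp
  have e44 : inner ℝ (rcross a c) (rcross a c) = (1 : ℝ) := by rw [key _ _ _ ac cc, aa]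
  have e45 : inner ℝ (rcross a c) (rcross b c) = (0 : ℝ) := by rw [key _ _ _ ac cc, ab]
  have e46 : inner ℝ (rcross a c) (rcross (rcross a b) c) = (0 : ℝ) := by
    rw [key _ _ _ ac cc, e23]
  have e55 : inner ℝ (rcross b c) (rcross b c) = (1 : ℝ) := by rw [key _ _ _ bc cc, bb]
  have e56 : inner ℝ (rcross b c) (rcross (rcross a b) c) = (0 : ℝ) := by
    rw [key _ _ _ bc cc, e24]
  have e66 : inner ℝ (rcross (rcross a b) c) (rcross (rcross a b) c) = (1 : ℝ) := by
    rw [key _ _ _ abc cc, e22]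
  have hsymm (u v : R7) (huv : inner ℝ u v = (0 : ℝ)) : inner ℝ v u = (0 : ℝ) := by
    rw [real_inner_comm, huv]
  simp only [tripleLin_apply, inner_add_left, inner_add_right, real_inner_smul_left,
    real_inner_smul_right]
  rw [aa, bb, cc, ab, ac, bc, abc, ba, ca, cb, e22, e23, e24, e25, e26, e27, e28, e29, e30, e31,
    e32, e33, e34, e35, e36, e44, e45, e46, e55, e56, e66, hsymm _ _ abc, hsymm _ _ e23,
    hsymm _ _ e24, hsymm _ _ e25, hsymm _ _ e26, hsymm _ _ e27, hsymm _ _ e28, hsymm _ _ e29,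
    hsymm _ _ e30, hsymm _ _ e31, hsymm _ _ e32, hsymm _ _ e33, hsymm _ _ e34, hsymm _ _ e35,
    hsymm _ _ e36, hsymm _ _ e45, hsymm _ _ e46, hsymm _ _ e56, inner_eq_dotp, dotp_eq]
  ring

end IsTriple

theorem octMul_add_smul_one (r s : ℝ) (x y : R7) :
    octMul (r • (1, 0) + imOct x) (s • (1, 0) + imOct y)
      = (r * s - inner ℝ x y) • (1, 0) + imOct (r • y + s • x + rcross x y : R7) := by
  rw [inner_eq_dotp, dotp_eq]
  ext <;> simp [octMul, rcross, crs_eq, Matrix.vecHead, Matrix.vecTail] <;> ring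

/-- Every octonion is the sum of its real part and its imaginary part. -/
theorem eq_re_add_im (p : Oct ℝ) :
    p = p.1.re • ((1, 0) : Oct ℝ) + imOct (WithLp.toLp 2 (imCoord p) : R7) := by
  ext <;> simp [imCoord]

/-- The extension of a linear map of `Im 𝕆` to `𝕆` by the identity on the real part. -/
def octExtend (T : R7 →ₗ[ℝ] R7) : Oct ℝ →ₗ[ℝ] Oct ℝ where
  toFun p := p.1.re • (1, 0) + imOct (T (WithLp.toLp 2 (imCoord p)))
  map_add' p q := by
    have : (WithLp.toLp 2 (imCoord (p + q)) : R7)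
        = WithLp.toLp 2 (imCoord p) + WithLp.toLp 2 (imCoord q) := by
      ext i; fin_cases i <;> simp [imCoord]
    rw [this, map_add]
    ext <;> simp
  map_smul' r p := by
    have : (WithLp.toLp 2 (imCoord (r • p)) : R7) = r • WithLp.toLp 2 (imCoord p) := by
      ext i; fin_cases i <;> simp [imCoord]
    rw [this, map_smul]
    ext <;> simp

theorem octExtend_apply (T : R7 →ₗ[ℝ] R7) (p : Oct ℝ) :
    octExtend T p = p.1.re • (1, 0) + imOct (T (WithLp.toLp 2 (imCoord p))) := rfl

theorem octExtend_re_add_im (T : R7 →ₗ[ℝ] R7) (r : ℝ) (x : R7) :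
    octExtend T (r • (1, 0) + imOct x) = r • (1, 0) + imOct (T x) := by
  have h1 : (r • ((1, 0) : Oct ℝ) + imOct x).1.re = r := by simp
  have h2 : (WithLp.toLp 2 (imCoord (r • ((1, 0) : Oct ℝ) + imOct x)) : R7) = x := by
    ext i; fin_cases i <;> simp [imCoord]
  rw [octExtend_apply, h1, h2]

theorem octExtend_injective {T : R7 →ₗ[ℝ] R7}
    (hT : ∀ x y, inner ℝ (T x) (T y) = (inner ℝ x y : ℝ)) : Function.Injective (octExtend T) := by
  rw [injective_iff_map_eq_zero]
  intro p hp
  rw [eq_re_add_im p, octExtend_re_add_im] at hp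
  have h1 : p.1.re = 0 := by simpa using congrArg (fun q : Oct ℝ => q.1.re) hp
  rw [h1, zero_smul, zero_add] at hp
  have h2 : T (WithLp.toLp 2 (imCoord p)) = 0 := by
    ext i
    have := congrFun (congrArg imCoord hp) i
    rw [imCoord_imOct] at this
    rw [this]
    fin_cases i <;> rfl
  have h3 : (WithLp.toLp 2 (imCoord p) : R7) = 0 := by
    rw [← inner_self_eq_zero (𝕜 := ℝ), ← hT, h2, inner_zero_left]
  rw [eq_re_add_im p, h1, h3]
  ext <;> simp

/-- The automorphism of the octonions given by a linear map of `Im 𝕆` that preserves the inner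
product and the vector product. -/
def mkG2 (T : R7 →ₗ[ℝ] R7) (hT : ∀ x y, inner ℝ (T x) (T y) = (inner ℝ x y : ℝ))
    (hc : ∀ x y, rcross (T x) (T y) = T (rcross x y)) : G2 :=
  ⟨LinearEquiv.ofInjectiveEndo (octExtend T) (octExtend_injective hT), by
    intro p q
    change octExtend T _ = octMul (octExtend T p) (octExtend T q)
    rw [eq_re_add_im p, eq_re_add_im q, octMul_add_smul_one, octExtend_re_add_im,
      octExtend_re_add_im, octExtend_re_add_im, octMul_add_smul_one, hT, hc]
    simp only [map_add, map_smul]⟩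

theorem mkG2_smul (T : R7 →ₗ[ℝ] R7) (hT) (hc) (x : R7) : mkG2 T hT hc • x = T x := by
  change (WithLp.toLp 2 (imCoord (octExtend T (imOct x))) : R7) = T x
  have := octExtend_re_add_im T 0 x
  rw [zero_smul, zero_add, zero_add] at this
  rw [this, imCoord_imOct]

open Classical in
/-- The automorphism of the octonions that sends `i, j, e` to the basic triple `a, b, c`; the
identity if `a, b, c` is not a basic triple. -/
def tripleG2 (a b c : R7) : G2 :=
  if h : IsTriple a b c then mkG2 (tripleLin a b c) h.inner_tripleLin h.rcross_tripleLin else 1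

theorem IsTriple.tripleG2_smul {a b c : R7} (h : IsTriple a b c) (x : R7) :
    tripleG2 a b c • x = tripleLin a b c x := by
  rw [tripleG2, dif_pos h, mkG2_smul]

/-! ### The action of `G₂` preserves the inner product and the vector product -/

theorem imOct_smul (g : G2) (x : R7) : imOct (g • x) = g.1 (imOct x) := G2.imOct_toEnd g x

theorem imOct_injective {x y : R7} (h : imOct x = imOct y) : x = y := by
  ext i
  rw [← imCoord_imOct x, h, imCoord_imOct]

theorem smul_octMul (g : G2) (x y : R7) :
    (inner ℝ x y : ℝ) = inner ℝ (g • x) (g • y) ∧ g • rcross x y = rcross (g • x) (g • y) := by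
  have h := g.2 (imOct x) (imOct y)
  rw [octMul_imOct, ← imOct_smul, ← imOct_smul, octMul_imOct, map_add] at h
  change g.1 (-(dotp x y) • (1, 0)) + g.1 (imOct (rcross x y)) = _ at h
  rw [map_smul, G2.map_one, ← imOct_smul] at h
  have h1 : dotp x y = dotp (g • x).ofLp (g • y).ofLp := by
    simpa using congrArg (fun q : Oct ℝ => q.1.re) h
  rw [h1, add_right_inj] at h
  refine ⟨by simpa only [inner_eq_dotp] using h1, imOct_injective h⟩

theorem inner_smul_smul (g : G2) (x y : R7) : (inner ℝ (g • x) (g • y) : ℝ) = inner ℝ x y :=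
  (smul_octMul g x y).1.symm

theorem smul_rcross (g : G2) (x y : R7) : g • rcross x y = rcross (g • x) (g • y) :=
  (smul_octMul g x y).2

/-! ### Complex vectors -/

theorem mk_re_im (v : C7) : C7.mk v.rePart v.imPart = v := rfl

theorem mk_inj {x y x' y' : R7} : C7.mk x y = C7.mk x' y' ↔ x = x' ∧ y = y' :=
  ⟨fun h => ⟨congrArg C7.rePart h, congrArg C7.imPart h⟩, fun h => by rw [h.1, h.2]⟩

theorem mk_add (x y x' y' : R7) : C7.mk x y + C7.mk x' y' = C7.mk (x + x') (y + y') := by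
  ext i; apply Complex.ext <;> simp [C7.mk]

theorem smul_mk (c : ℂ) (x y : R7) :
    c • C7.mk x y = C7.mk (c.re • x - c.im • y) (c.re • y + c.im • x) := by
  ext i; apply Complex.ext <;> simp [C7.mk]

theorem mk_zero : C7.mk 0 0 = 0 := rfl

theorem conjVec_mk (x y : R7) : conjVec (C7.mk x y) = C7.mk x (-y) := by
  ext i; apply Complex.ext <;> simp [C7.mk, conjVec]

theorem smul_mk_G2 (g : G2) (x y : R7) : g • C7.mk x y = C7.mk (g • x) (g • y) := rfl

theorem cross_mk (x y x' y' : R7) : cross (C7.mk x y) (C7.mk x' y') =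
    C7.mk (rcross x x' - rcross y y') (rcross x y' + rcross y x') := by
  change WithLp.toLp 2 (crs (C7.mk x y).ofLp (C7.mk x' y').ofLp) = _
  ext i
  apply Complex.ext <;> fin_cases i <;> simp [crs_eq, C7.mk, rcross] <;> ring

theorem bilin_mk (x y x' y' : R7) : bilin (C7.mk x y) (C7.mk x' y') =
    ⟨inner ℝ x x' - inner ℝ y y', inner ℝ x y' + inner ℝ y x'⟩ := by
  simp only [inner_eq_dotp, dotp, bilin, C7.mk]
  apply Complex.ext <;> simp [Finset.sum_sub_distrib, Finset.sum_add_distrib]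

theorem inner_eq_bilin (v w : C7) : inner ℂ v w = bilin (conjVec v) w := by
  simp [PiLp.inner_apply, bilin, conjVec, mul_comm]

theorem conjVec_conjVec (v : C7) : conjVec (conjVec v) = v := by ext i; simp [conjVec]

theorem conjVec_smul (c : ℂ) (v : C7) : conjVec (c • v) = (starRingEnd ℂ c) • conjVec v := by
  ext i; simp [conjVec]

theorem cross_anti (v w : C7) : cross v w = -cross w v := by
  ext i; exact congrFun (crs_anti v w) i

theorem cross_add_right (u v w : C7) : cross u (v + w) = cross u v + cross u w := by
  rw [cross_anti, cross_add_left, cross_anti v, cross_anti w]; abel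

theorem cross_smul_right (c : ℂ) (v w : C7) : cross v (c • w) = c • cross v w := by
  rw [cross_anti, cross_smul_left, cross_anti w, smul_neg, neg_neg]

theorem cross_zero_right (v : C7) : cross v 0 = 0 := by simpa using cross_smul_right 0 v 0

theorem cross_self (v : C7) : cross v v = 0 := by
  rw [← mk_re_im v, cross_mk, rcross_self, rcross_self, rcross_anti v.imPart, sub_self,
    add_neg_cancel, mk_zero]

/-- The complex-bilinear extension of `x × (x × z) = (x, z) x - (x, x) z`. -/
theorem cross_cross_self (v w : C7) : cross v (cross v w) = bilin v w • v - bilin v v • w := by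
  have h : cross v (cross v w) =
      -cross v (cross v w) - (2 * bilin v v) • w + bilin v w • v + bilin v w • v := by
    ext i; exact congrFun (crs_crs v v w) i
  have h2 : (2 : ℂ) • cross v (cross v w) = (2 : ℂ) • (bilin v w • v - bilin v v • w) := by
    rw [two_smul]; nth_rewrite 1 [h]; module
  exact smul_right_injective _ (two_ne_zero) h2

theorem bilin_comm (v w : C7) : bilin v w = bilin w v := by simp [bilin, mul_comm]

theorem bilin_smul_left (c : ℂ) (v w : C7) : bilin (c • v) w = c * bilin v w := by
  simp [bilin, Finset.mul_sum, mul_assoc]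

theorem bilin_smul_right (c : ℂ) (v w : C7) : bilin v (c • w) = c * bilin v w := by
  rw [bilin_comm, bilin_smul_left, bilin_comm]

theorem bilin_add_left (u v w : C7) : bilin (u + v) w = bilin u w + bilin v w := by
  simp [bilin, add_mul, Finset.sum_add_distrib]

theorem bilin_add_right (u v w : C7) : bilin u (v + w) = bilin u v + bilin u w := by
  rw [bilin_comm, bilin_add_left, bilin_comm v, bilin_comm w]

/-! ### Equivariance -/

theorem smul_cross (g : G2) (v w : C7) : g • cross v w = cross (g • v) (g • w) := by
  rw [← mk_re_im v, ← mk_re_im w]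
  simp only [smul_mk_G2, cross_mk, smul_sub, smul_add, smul_rcross]

theorem bilin_smul_smul (g : G2) (v w : C7) : bilin (g • v) (g • w) = bilin v w := by
  rw [← mk_re_im v, ← mk_re_im w]
  simp only [smul_mk_G2, bilin_mk, inner_smul_smul]

theorem smul_conjVec (g : G2) (v : C7) : g • conjVec v = conjVec (g • v) := by
  rw [← mk_re_im v]
  simp only [smul_mk_G2, conjVec_mk, smul_neg]

theorem inner_smul_smul_complex (g : G2) (v w : C7) :
    (inner ℂ (g • v) (g • w) : ℂ) = inner ℂ v w := by
  simp only [inner_eq_bilin, ← smul_conjVec, bilin_smul_smul]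

section Pointwise

variable {k M : Type} [CommRing k] [AddCommGroup M] [Module k M] [DistribMulAction G2 M]
  [SMulCommClass G2 k M]

theorem mem_smul_submodule {g : G2} {V : Submodule k M} {x : M} : x ∈ g • V ↔ g⁻¹ • x ∈ V := by
  rw [← SetLike.mem_coe, Submodule.coe_pointwise_smul, Set.mem_smul_set_iff_inv_smul_mem]
  rfl

theorem smul_top_submodule (g : G2) : g • (⊤ : Submodule k M) = ⊤ := by
  ext x; simp [mem_smul_submodule]

theorem smul_inf_submodule (g : G2) (V W : Submodule k M) : g • (V ⊓ W) = g • V ⊓ g • W := by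
  ext x; simp [mem_smul_submodule]

theorem finrank_smul_submodule (g : G2) (V : Submodule k M) :
    Module.finrank k (g • V : Submodule k M) = Module.finrank k V :=
  (Submodule.equivMapOfInjective (DistribSMul.toLinearMap k M g) (MulAction.injective g)
    V).finrank_eq.symm

theorem smul_span (g : G2) (s : Set M) :
    g • Submodule.span k s = Submodule.span k (g • s) :=
  Submodule.map_span (DistribSMul.toLinearMap k M g) s

theorem smul_span_singleton (g : G2) (x : M) :
    g • Submodule.span k {x} = Submodule.span k {g • x} := by
  rw [smul_span, Set.smul_set_singleton]

theorem smul_span_pair (g : G2) (x y : M) :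
    g • Submodule.span k {x, y} = Submodule.span k {g • x, g • y} := by
  rw [smul_span, ← Set.image_smul, Set.image_pair]

end Pointwise

variable (g : G2)

theorem smul_conjSub (V : Submodule ℂ C7) : conjSub (g • V) = g • conjSub V := by
  ext x
  rw [mem_smul_submodule]
  change conjVec x ∈ g • V ↔ conjVec (g⁻¹ • x) ∈ V
  rw [mem_smul_submodule, smul_conjVec]

theorem smul_orthogonal (V : Submodule ℂ C7) : (g • V)ᗮ = g • Vᗮ := by
  ext x
  rw [mem_smul_submodule, Submodule.mem_orthogonal, Submodule.mem_orthogonal]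
  constructor
  · intro h v hv
    rw [← inner_smul_smul_complex g, smul_inv_smul]
    exact h _ (Submodule.smul_mem_pointwise_smul _ _ _ hv)
  · intro h v hv
    rw [← inner_smul_smul_complex g⁻¹]
    exact h _ (mem_smul_submodule.1 hv)

theorem smul_isOrtho {V W : Submodule ℂ C7} (h : V ⟂ W) : g • V ⟂ g • W := by
  rw [Submodule.isOrtho_iff_le, smul_orthogonal]
  exact Submodule.map_mono (Submodule.isOrtho_iff_le.1 h)

theorem smul_annih (V : Submodule ℂ C7) : annih (g • V) = g • annih V := by
  ext x
  rw [mem_smul_submodule]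
  constructor
  · intro h v hv
    rw [← smul_eq_zero_iff_eq g, smul_cross, smul_inv_smul]
    exact h _ (Submodule.smul_mem_pointwise_smul _ _ _ hv)
  · intro h v hv
    rw [← smul_eq_zero_iff_eq g⁻¹, smul_cross]
    exact h _ (mem_smul_submodule.1 hv)

theorem smul_crossSub (V W : Submodule ℂ C7) :
    crossSub (g • V) (g • W) = g • crossSub V W := by
  rw [crossSub, crossSub, smul_span]
  congr 1
  ext x
  rw [Set.mem_smul_set_iff_inv_smul_mem]
  constructor
  · rintro ⟨v, hv, w, hw, rfl⟩
    exact ⟨_, mem_smul_submodule.1 hv, _, mem_smul_submodule.1 hw, smul_cross _ _ _⟩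
  · rintro ⟨v, hv, w, hw, h⟩
    refine ⟨g • v, Submodule.smul_mem_pointwise_smul _ _ _ hv, g • w,
      Submodule.smul_mem_pointwise_smul _ _ _ hw, ?_⟩
    rw [← smul_cross, ← h, smul_inv_smul]

theorem smul_realPts (V : Submodule ℂ C7) : realPts (g • V) = g • realPts V := by
  ext x
  rw [mem_smul_submodule]
  change C7.mk x 0 ∈ g • V ↔ C7.mk (g⁻¹ • x) 0 ∈ V
  rw [mem_smul_submodule, smul_mk_G2, smul_zero]

theorem twistorProj1_smul (W : Submodule ℂ C7) : twistorProj1 (g • W) = g • twistorProj1 W := by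
  rw [twistorProj1, twistorProj1, smul_conjSub, ← Submodule.smul_sup', smul_orthogonal,
    smul_realPts]

theorem twistorProj2_smul (l : Submodule ℂ C7) : twistorProj2 (g • l) = g • twistorProj2 l := by
  rw [twistorProj2, twistorProj2, smul_conjSub, smul_crossSub, ← Submodule.smul_sup',
    ← Submodule.smul_sup', smul_realPts]

theorem twistorProj3_smul (p : Submodule ℂ C7 × Submodule ℂ C7) :
    twistorProj3 (g • p) = g • twistorProj3 p := by
  rw [twistorProj3, twistorProj3, ← twistorProj2_smul, smul_inf_submodule, ← smul_orthogonal]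
  rfl

theorem leg_smul {s : ℕ} (ψ : Legs s) (i : ℤ) : leg (g • ψ) i = g • leg ψ i := by
  unfold leg
  split
  · rfl
  · rw [Submodule.smul_bot']

theorem evenProj_smul {s : ℕ} (ψ : Legs s) : evenProj (g • ψ) = g • evenProj ψ := by
  simp only [evenProj, leg_smul, ← Submodule.smul_iSup', smul_realPts]

theorem smul_mem_G2Flags {s : ℕ} {d : ℕ → ℕ} {ψ : Legs s} (h : ψ ∈ G2Flags s d) :
    g • ψ ∈ G2Flags s d := by
  obtain ⟨⟨h1, h2, h3, h4⟩, h5⟩ := h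
  refine ⟨⟨fun i => ?_, fun i j hij => smul_isOrtho g (h2 i j hij), ?_, fun i => ?_⟩, ?_⟩
  · exact (finrank_smul_submodule g (ψ i)).trans (h1 i)
  · change ⨆ i, g • ψ i = ⊤
    rw [← Submodule.smul_iSup', h3, smul_top_submodule]
  · rw [leg_smul, leg_smul, smul_conjSub, h4]
  · intro i j v hv w hw
    rw [leg_smul, mem_smul_submodule] at *
    rw [smul_cross]
    exact h5 i j _ hv _ hw

/-! ### Smooth maps on subsets of smooth models -/

open scoped Topology

section Smooth

variable {A B C : Type} [SmoothModel A] [SmoothModel B] [SmoothModel C]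
  {E E' : Type*} [NormedAddCommGroup E] [NormedSpace ℝ E] [NormedAddCommGroup E']
  [NormedSpace ℝ E']

/-- The filter of relative neighbourhoods of `x` in `X`, in the topology induced by the model. -/
def near (X : Set A) (x : A) : Filter A := comap emb (𝓝 (emb x)) ⊓ 𝓟 X

/-- `f` is smooth on `X` near `x`, for a map into a normed space: near `x` it is the restriction of
a `C^∞` map of the ambient space. -/
def SmoothNear (X : Set A) (f : A → E) (x : A) : Prop :=
  ∃ F : Space A → E, (∀ᶠ p in 𝓝 (emb x), ContDiffAt ℝ ∞ F p) ∧
    ∀ᶠ y in near X x, F (emb y) = f y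

variable {X : Set A} {Y : Set B} {x : A}

theorem eventually_near {P : A → Prop} : (∀ᶠ y in near X x, P y) ↔
    ∃ O : Set (Space A), IsOpen O ∧ emb x ∈ O ∧ ∀ y ∈ restrictTo X O, P y := by
  rw [near, eventually_inf_principal, eventually_comap, eventually_nhds_iff]
  constructor
  · rintro ⟨O, h, hO, hx⟩
    exact ⟨O, hO, hx, fun y hy => h _ hy.2 _ rfl hy.1⟩
  · rintro ⟨O, hO, hx, h⟩
    exact ⟨O, fun p hp y hy hyX => h y ⟨hyX, hy ▸ hp⟩, hO, hx⟩

theorem eventually_mem_near : ∀ᶠ y in near X x, y ∈ X :=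
  eventually_inf_principal.2 (Eventually.of_forall fun _ h => h)

theorem tendsto_emb_near : Tendsto emb (near X x) (𝓝 (emb x)) :=
  tendsto_comap.mono_left inf_le_left

theorem pure_le_near (hx : x ∈ X) : pure x ≤ near X x :=
  le_inf (tendsto_iff_comap.1 (tendsto_pure_left.2 fun _ hs => mem_of_mem_nhds hs))
    (by simpa using hx)

theorem near_mono {X' : Set A} (h : X' ⊆ X) : near X' x ≤ near X x :=
  inf_le_inf_left _ (principal_mono.2 h)

theorem eventually_eventually_near {P : A → Prop} (h : ∀ᶠ y in near X x, P y) :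
    ∀ᶠ y in near X x, ∀ᶠ z in near X y, P z := by
  obtain ⟨O, hO, hx, hP⟩ := eventually_near.1 h
  exact eventually_near.2 ⟨O, hO, hx, fun y hy => eventually_near.2 ⟨O, hO, hy.2, hP⟩⟩

theorem smoothOn_iff {f : A → B} :
    SmoothOn X f ↔ ∀ x ∈ X, SmoothNear X (fun y => emb (f y)) x := by
  refine forall₂_congr fun x _ => ?_
  constructor
  · rintro ⟨O, hO, hx, F, hF, h⟩
    refine ⟨F, ?_, eventually_near.2 ⟨O, hO, hx, h⟩⟩
    filter_upwards [hO.mem_nhds hx] with p hp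
    exact hF.contDiffAt (hO.mem_nhds hp)
  · rintro ⟨F, hF, h⟩
    obtain ⟨O, hO, hx, h⟩ := eventually_near.1 h
    obtain ⟨U, hU, hUo, hxU⟩ := eventually_nhds_iff.1 hF
    exact ⟨O ∩ U, hO.inter hUo, ⟨hx, hxU⟩, F, fun p hp => (hU p hp.2).contDiffWithinAt,
      fun y hy => h y ⟨hy.1, hy.2.1⟩⟩

namespace SmoothNear

theorem mono {X' : Set A} {f : A → E} (hf : SmoothNear X f x) (h : X' ⊆ X) :
    SmoothNear X' f x :=
  let ⟨F, hF, hFf⟩ := hf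
  ⟨F, hF, hFf.filter_mono (near_mono h)⟩

theorem congr {f f' : A → E} (hf : SmoothNear X f x) (h : ∀ᶠ y in near X x, f y = f' y) :
    SmoothNear X f' x :=
  let ⟨F, hF, hFf⟩ := hf
  ⟨F, hF, by filter_upwards [hFf, h] with y h1 h2 using h1.trans h2⟩

theorem tendsto {f : A → E} (hf : SmoothNear X f x) (hx : x ∈ X) :
    Tendsto f (near X x) (𝓝 (f x)) := by
  obtain ⟨F, hF, hFf⟩ := hf
  have h1 : F (emb x) = f x := pure_le_near hx hFf
  rw [← h1]
  exact (hF.self_of_nhds.continuousAt.tendsto.comp tendsto_emb_near).congr' hFf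

theorem emb_self : SmoothNear X (fun y : A => emb y) x :=
  ⟨id, Eventually.of_forall fun _ => contDiffAt_id, Eventually.of_forall fun _ => rfl⟩

theorem const (c : E) : SmoothNear X (fun _ : A => c) x :=
  ⟨fun _ => c, Eventually.of_forall fun _ => contDiffAt_const, Eventually.of_forall fun _ => rfl⟩

/-- Composition with a map of normed spaces that is smooth near the value. -/
theorem comp_normed {f : A → E} (hf : SmoothNear X f x) (hx : x ∈ X) {G : E → E'}
    (hG : ∀ᶠ e in 𝓝 (f x), ContDiffAt ℝ ∞ G e) : SmoothNear X (fun y => G (f y)) x := by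
  obtain ⟨F, hF, hFf⟩ := hf
  have h1 : F (emb x) = f x := pure_le_near hx hFf
  rw [← h1] at hG
  refine ⟨G ∘ F, ?_, ?_⟩
  · filter_upwards [hF, hF.self_of_nhds.continuousAt.tendsto.eventually hG] with p h2 h3
    exact h3.comp p h2
  · filter_upwards [hFf] with y hy
    rw [Function.comp_apply, hy]

theorem comp_contDiff {f : A → E} (hf : SmoothNear X f x) {G : E → E'} (hG : ContDiff ℝ ∞ G) :
    SmoothNear X (fun y => G (f y)) x := by
  obtain ⟨F, hF, hFf⟩ := hf
  refine ⟨G ∘ F, ?_, ?_⟩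
  · filter_upwards [hF] with p h2
    exact hG.contDiffAt.comp p h2
  · filter_upwards [hFf] with y hy
    rw [Function.comp_apply, hy]

theorem prodMk {f : A → E} {f' : A → E'} (hf : SmoothNear X f x) (hf' : SmoothNear X f' x) :
    SmoothNear X (fun y => (f y, f' y)) x := by
  obtain ⟨F, hF, hFf⟩ := hf
  obtain ⟨F', hF', hFf'⟩ := hf'
  refine ⟨fun p => (F p, F' p), ?_, ?_⟩
  · filter_upwards [hF, hF'] with p h h' using h.prodMk h'
  · filter_upwards [hFf, hFf'] with y h h'
    rw [h, h']

theorem pi {ι : Type} [Fintype ι] {V : ι → Type*} [∀ i, NormedAddCommGroup (V i)]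
    [∀ i, NormedSpace ℝ (V i)] {f : A → ∀ i, V i} (hf : ∀ i, SmoothNear X (fun y => f y i) x) :
    SmoothNear X f x := by
  choose F hF hFf using hf
  refine ⟨fun p i => F i p, ?_, ?_⟩
  · filter_upwards [eventually_all.2 hF] with p hp
    exact contDiffAt_pi.2 hp
  · filter_upwards [eventually_all.2 hFf] with y hy
    exact funext hy

/-- Composition with a map of smooth models. -/
theorem comp {φ : A → B} (hφ : SmoothNear X (fun y => emb (φ y)) x) (hx : x ∈ X)
    (hXY : ∀ y ∈ X, φ y ∈ Y) {f : B → E} (hf : SmoothNear Y f (φ x)) :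
    SmoothNear X (fun y => f (φ y)) x := by
  obtain ⟨F, hF, hFf⟩ := hf
  refine congr (comp_normed hφ hx hF) ?_
  have ht : Tendsto φ (near X x) (near Y (φ x)) := by
    refine tendsto_inf.2 ⟨tendsto_comap_iff.2 (hφ.tendsto hx), tendsto_principal.2 ?_⟩
    filter_upwards [eventually_mem_near] with y hy using hXY y hy
  exact ht.eventually hFf

theorem eventually {f : A → E} (hf : SmoothNear X f x) :
    ∀ᶠ y in near X x, SmoothNear X f y := by
  obtain ⟨F, hF, hFf⟩ := hf
  filter_upwards [eventually_eventually_near hFf,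
    tendsto_emb_near.eventually (eventually_eventually_nhds.2 hF)] with y h1 h2
  exact ⟨F, h2, h1⟩

end SmoothNear

theorem _root_.SmoothOn.comp {φ : A → B} {f : B → C} (hf : SmoothOn Y f) (hφ : SmoothOn X φ)
    (h : ∀ x ∈ X, φ x ∈ Y) : SmoothOn X fun x => f (φ x) := by
  rw [smoothOn_iff] at *
  exact fun x hx => SmoothNear.comp (hφ x hx) hx h (hf _ (h x hx))

theorem _root_.SmoothOn.mono {X' : Set A} {f : A → B} (hf : SmoothOn X f) (h : X' ⊆ X) :
    SmoothOn X' f := by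
  rw [smoothOn_iff] at *
  exact fun x hx => (hf x (h hx)).mono h

theorem _root_.SmoothOn.congr {f f' : A → B} (hf : SmoothOn X f) (h : ∀ x ∈ X, f x = f' x) :
    SmoothOn X f' := by
  rw [smoothOn_iff] at *
  refine fun x hx => (hf x hx).congr ?_
  filter_upwards [eventually_mem_near] with y hy
  rw [h y hy]

theorem smoothOn_id : SmoothOn X fun x => x := smoothOn_iff.2 fun _ _ => SmoothNear.emb_self

theorem smoothOn_const (b : B) : SmoothOn X fun _ => b :=
  smoothOn_iff.2 fun _ _ => SmoothNear.const _

theorem _root_.SmoothOn.prodMk {f : A → B} {f' : A → C} (hf : SmoothOn X f) (hf' : SmoothOn X f') :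
    SmoothOn X fun x => (f x, f' x) := by
  rw [smoothOn_iff] at *
  exact fun x hx => (hf x hx).prodMk (hf' x hx)

theorem smoothOn_fst {Z : Set (B × C)} : SmoothOn Z Prod.fst :=
  smoothOn_iff.2 fun _ _ => SmoothNear.comp_contDiff (SmoothNear.emb_self (A := B × C))
    (G := Prod.fst) contDiff_fst

theorem smoothOn_snd {Z : Set (B × C)} : SmoothOn Z Prod.snd :=
  smoothOn_iff.2 fun _ _ => SmoothNear.comp_contDiff (SmoothNear.emb_self (A := B × C))
    (G := Prod.snd) contDiff_snd

theorem smoothOn_pi {ι : Type} [Fintype ι] {f : A → ι → B} (hf : ∀ i, SmoothOn X fun x => f x i) :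
    SmoothOn X f := by
  simp only [smoothOn_iff] at *
  exact fun x hx => SmoothNear.pi fun i => hf i x hx

theorem smoothOn_eval {ι : Type} [Fintype ι] {Z : Set (ι → B)} (i : ι) :
    SmoothOn Z fun f => f i :=
  smoothOn_iff.2 fun _ _ => SmoothNear.comp_contDiff (SmoothNear.emb_self (A := ι → B))
    (G := fun p => p i) (contDiff_apply ℝ (Space B) i)

/-! ### Smooth actions of `G₂` -/

/-- The action map `G₂ × A → A` is smooth. -/
def SmoothAct (A : Type) [SmoothModel A] [MulAction G2 A] : Prop :=
  SmoothOn (Set.univ : Set (G2 × A)) fun p => p.1 • p.2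

variable [MulAction G2 A] [MulAction G2 B] [MulAction G2 C]

omit [MulAction G2 A] in
theorem _root_.SmoothOn.smul (hB : SmoothAct B) {σ : A → G2} {f : A → B} (hσ : SmoothOn X σ)
    (hf : SmoothOn X f) : SmoothOn X fun x => σ x • f x :=
  SmoothOn.comp hB (hσ.prodMk hf) fun _ _ => Set.mem_univ _

theorem SmoothAct.prod (hA : SmoothAct A) (hB : SmoothAct B) : SmoothAct (A × B) :=
  (SmoothOn.smul hA smoothOn_fst
      (SmoothOn.comp (smoothOn_fst (Z := Set.univ)) smoothOn_snd fun _ _ => Set.mem_univ _)).prodMk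
    (SmoothOn.smul hB smoothOn_fst
      (SmoothOn.comp (smoothOn_snd (Z := Set.univ)) smoothOn_snd fun _ _ => Set.mem_univ _))

theorem SmoothAct.pi {ι : Type} [Fintype ι] (hA : SmoothAct A) : SmoothAct (ι → A) :=
  smoothOn_pi fun i => SmoothOn.smul hA smoothOn_fst
    (SmoothOn.comp (smoothOn_eval (Z := Set.univ) i) smoothOn_snd fun _ _ => Set.mem_univ _)

end Smooth

/-! ### Smoothness of the operations of `G₂` -/

/-- An element of `G₂` as a continuous linear map of `ℝ⁷`; this is its realization in the smooth
model. -/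
def toCLM (g : G2) : R7 →L[ℝ] R7 := LinearMap.toContinuousLinearMap (G2.toEnd g)

theorem toCLM_apply (g : G2) (x : R7) : toCLM g x = g • x := rfl

/-- The adjoint as a real-linear map. -/
def adjR : (R7 →L[ℝ] R7) →ₗ[ℝ] (R7 →L[ℝ] R7) where
  toFun T := ContinuousLinearMap.adjoint T
  map_add' := map_add _
  map_smul' r T := by simp

theorem contDiff_adjR : ContDiff ℝ ∞ adjR := (LinearMap.toContinuousLinearMap adjR).contDiff

theorem toCLM_inv (g : G2) : toCLM g⁻¹ = adjR (toCLM g) := by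
  change _ = ContinuousLinearMap.adjoint _
  rw [ContinuousLinearMap.eq_adjoint_iff]
  intro x y
  rw [toCLM_apply, toCLM_apply, ← inner_smul_smul g, smul_inv_smul]

theorem toCLM_mul (g h : G2) : toCLM (g * h) = toCLM g ∘L toCLM h := by
  ext1 x
  exact mul_smul g h x

theorem smoothOn_inv : SmoothOn (Set.univ : Set G2) fun g => g⁻¹ := by
  refine smoothOn_iff.2 fun g _ => ?_
  change SmoothNear _ (fun y : G2 => toCLM y⁻¹) g
  simp only [toCLM_inv]
  exact SmoothNear.emb_self.comp_contDiff contDiff_adjR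

/-- The complex-linear extension of an endomorphism of `ℝ⁷`, as a real-linear map. -/
def complexify : (R7 →L[ℝ] R7) →ₗ[ℝ] (C7 →L[ℂ] C7) where
  toFun T := LinearMap.toContinuousLinearMap
    { toFun := fun v => C7.mk (T v.rePart) (T v.imPart)
      map_add' := fun v w => by
        rw [mk_add, ← map_add, ← map_add]; rfl
      map_smul' := fun c v => by
        rw [RingHom.id_apply, smul_mk, ← map_smul, ← map_smul, ← map_smul, ← map_smul, ← map_sub,
          ← map_add, ← mk_re_im v, smul_mk]
        rfl }
  map_add' S T := by
    ext1 v
    exact (mk_add _ _ _ _).symm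
  map_smul' r T := by
    ext1 v
    change C7.mk (r • T v.rePart) (r • T v.imPart) = r • C7.mk (T v.rePart) (T v.imPart)
    ext i; apply Complex.ext <;> simp [C7.mk]

theorem contDiff_complexify : ContDiff ℝ ∞ complexify :=
  (LinearMap.toContinuousLinearMap complexify).contDiff

theorem starProjection_smul_real (g : G2) (V : Submodule ℝ R7) :
    (g • V).starProjection = toCLM g ∘L V.starProjection ∘L toCLM g⁻¹ := by
  ext1 x
  refine Submodule.eq_starProjection_of_mem_of_inner_eq_zero ?_ ?_
  · exact Submodule.smul_mem_pointwise_smul _ _ _ (Submodule.starProjection_apply_mem _ _)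
  · intro w hw
    change inner ℝ (x - g • V.starProjection (g⁻¹ • x)) w = 0
    rw [← inner_smul_smul g⁻¹, smul_sub, inv_smul_smul]
    exact Submodule.starProjection_inner_eq_zero _ _ (mem_smul_submodule.1 hw)

theorem starProjection_smul_complex (g : G2) (V : Submodule ℂ C7) :
    (g • V).starProjection
      = complexify (toCLM g) ∘L V.starProjection ∘L complexify (toCLM g⁻¹) := by
  ext1 x
  refine Submodule.eq_starProjection_of_mem_of_inner_eq_zero ?_ ?_
  · exact Submodule.smul_mem_pointwise_smul _ _ _ (Submodule.starProjection_apply_mem _ _)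
  · intro w hw
    change inner ℂ (x - g • V.starProjection (g⁻¹ • x)) w = 0
    rw [← inner_smul_smul_complex g⁻¹, smul_sub, inv_smul_smul]
    exact Submodule.starProjection_inner_eq_zero _ _ (mem_smul_submodule.1 hw)

theorem smoothAct_real : SmoothAct (Submodule ℝ R7) := by
  refine smoothOn_iff.2 fun p _ => ?_
  have : (fun y : G2 × Submodule ℝ R7 => (y.1 • y.2).starProjection) = fun y =>
      toCLM y.1 ∘L y.2.starProjection ∘L adjR (toCLM y.1) := by
    funext y
    rw [← toCLM_inv]
    exact starProjection_smul_real y.1 y.2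
  change SmoothNear _ (fun y : G2 × Submodule ℝ R7 => (y.1 • y.2).starProjection) p
  rw [this]
  exact SmoothNear.comp_contDiff (SmoothNear.emb_self (A := G2 × Submodule ℝ R7))
    (G := fun q : (R7 →L[ℝ] R7) × (R7 →L[ℝ] R7) => q.1 ∘L q.2 ∘L adjR q.1)
    (contDiff_fst.clm_comp (contDiff_snd.clm_comp (contDiff_adjR.comp contDiff_fst)))

theorem contDiff_comp_complex : ContDiff ℝ ∞
    fun q : (C7 →L[ℂ] C7) × (C7 →L[ℂ] C7) => q.1 ∘L q.2 :=
  ContDiff.restrict_scalars ℝ (𝕜' := ℂ) (contDiff_fst.clm_comp contDiff_snd)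

theorem smoothAct_complex : SmoothAct (Submodule ℂ C7) := by
  refine smoothOn_iff.2 fun p _ => ?_
  have : (fun y : G2 × Submodule ℂ C7 => (y.1 • y.2).starProjection) = fun y =>
      complexify (toCLM y.1) ∘L y.2.starProjection ∘L complexify (adjR (toCLM y.1)) := by
    funext y
    rw [← toCLM_inv]
    exact starProjection_smul_complex y.1 y.2
  change SmoothNear _ (fun y : G2 × Submodule ℂ C7 => (y.1 • y.2).starProjection) p
  rw [this]
  refine SmoothNear.comp_contDiff (SmoothNear.emb_self (A := G2 × Submodule ℂ C7))
    (G := fun q : (R7 →L[ℝ] R7) × (C7 →L[ℂ] C7) =>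
      complexify q.1 ∘L q.2 ∘L complexify (adjR q.1)) ?_
  exact contDiff_comp_complex.comp ((contDiff_complexify.comp contDiff_fst).prodMk
    (contDiff_comp_complex.comp (contDiff_snd.prodMk
      (contDiff_complexify.comp (contDiff_adjR.comp contDiff_fst)))))

/-! ### Local sections and equivariant bundles -/

section Bundles

variable {A A' C : Type} [SmoothModel A] [SmoothModel A'] [SmoothModel C] [MulAction G2 A]
  [MulAction G2 A'] [MulAction G2 C] {X : Set A} {X' : Set A'} {B : Set C} {x₀ : A} {b₀ : C}

/-- The orbit map of `x₀` has smooth local sections near every point of `X`. -/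
def HasLocalSections (X : Set A) (x₀ : A) : Prop :=
  ∀ x ∈ X, ∃ σ : A → G2, SmoothNear X (fun y => emb (σ y)) x ∧ ∀ᶠ y in near X x, σ y • x₀ = y

namespace HasLocalSections

theorem exists_open (h : HasLocalSections X x₀) {x : A} (hx : x ∈ X) :
    ∃ O : Set (Space A), IsOpen O ∧ emb x ∈ O ∧
      ∃ σ : A → G2, SmoothOn (restrictTo X O) σ ∧ ∀ y ∈ restrictTo X O, σ y • x₀ = y := by
  obtain ⟨σ, hσ, hy⟩ := h x hx
  obtain ⟨O, hO, hxO, hP⟩ := eventually_near.1 (hσ.eventually.and hy)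
  exact ⟨O, hO, hxO, σ, smoothOn_iff.2 fun y hy => (hP y hy).1.mono fun z hz => hz.1,
    fun y hy => (hP y hy).2⟩

theorem exists_smul_eq (h : HasLocalSections X x₀) {x : A} (hx : x ∈ X) : ∃ g : G2, g • x₀ = x := by
  obtain ⟨σ, -, hy⟩ := h x hx
  exact ⟨σ x, eventually_pure.1 (hy.filter_mono (pure_le_near hx))⟩

/-- Near every point an equivariant map is `y ↦ σ y • f x₀` for a smooth local section `σ`. -/
theorem smoothOn (h : HasLocalSections X x₀) (hA : SmoothAct A') {f : A → A'}
    (hf : ∀ g : G2, f (g • x₀) = g • f x₀) : SmoothOn X f := by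
  rw [smoothOn_iff]
  intro x hx
  obtain ⟨σ, hσ, hy⟩ := h x hx
  refine SmoothNear.congr (f := fun y => emb (σ y • f x₀)) ?_ ?_
  · exact SmoothNear.comp (φ := fun y => (σ y, f x₀)) (hσ.prodMk (SmoothNear.const (emb (f x₀)))) hx
      (fun _ _ => Set.mem_univ _) (smoothOn_iff.1 hA _ (Set.mem_univ _))
  · filter_upwards [hy] with y hy
    rw [← hf, hy]

theorem isHomogeneousSpace (h : HasLocalSections X x₀) (hA : SmoothAct A)
    (hX : ∀ g : G2, g • x₀ ∈ X) {H : Subgroup G2} (hH : MulAction.stabilizer G2 x₀ = H) :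
    IsHomogeneousSpace X H x₀ where
  orbit_eq := by
    ext x
    exact ⟨fun ⟨g, hg⟩ => hg ▸ hX g, fun hx => h.exists_smul_eq hx⟩
  stabilizer_eq := hH
  smooth := SmoothOn.smul hA smoothOn_id (smoothOn_const x₀)
  sections x hx := h.exists_open hx

/-- An equivariant smooth map onto a homogeneous space is a fibre bundle: a local section `σ` of the
base gives the trivialization `x ↦ (π x, σ(π x)⁻¹ • x)`, with the fibre over `b₀` as typical
fibre. -/
theorem isG2FibreBundle (h : HasLocalSections B b₀) (hA : SmoothAct A)
    {π : A → C} (hX : ∀ g : G2, ∀ x ∈ X, g • x ∈ X) (hπ : ∀ (g : G2) (x : A), π (g • x) = g • π x)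
    (hmaps : ∀ x ∈ X, π x ∈ B) (hsm : SmoothOn X π) (hx₀ : x₀ ∈ X) (hxb : π x₀ = b₀) :
    IsG2FibreBundle X B π where
  mapsTo := hmaps
  surjOn b hb := by
    obtain ⟨g, rfl⟩ := h.exists_smul_eq hb
    exact ⟨g • x₀, hX g _ hx₀, by rw [hπ, hxb]⟩
  smooth := hsm
  smul_mem := hX
  smooth_smul := SmoothOn.mono hA (Set.subset_univ _)
  equivariant g x _ := hπ g x
  locally_trivial := by
    refine ⟨X ∩ π ⁻¹' {b₀}, fun b hb => ?_⟩
    obtain ⟨O, hO, hbO, σ, hσ, hσb⟩ := h.exists_open hb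
    have hinv (x : A) (hx : x ∈ X ∩ π ⁻¹' restrictTo B O) : (σ (π x))⁻¹ • π x = b₀ := by
      rw [inv_smul_eq_iff, hσb _ hx.2]
    have hleft : Set.LeftInvOn (fun p : C × A => σ p.1 • p.2)
        (fun x => (π x, (σ (π x))⁻¹ • x)) (X ∩ π ⁻¹' restrictTo B O) :=
      fun x _ => smul_inv_smul _ _
    refine ⟨O, hO, hbO, fun x => (π x, (σ (π x))⁻¹ • x), ⟨⟨?_, hleft.injOn, ?_⟩, ?_,
      fun p => σ p.1 • p.2, hleft, ?_⟩, fun x _ => rfl⟩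
    · exact fun x hx => ⟨hx.2, hX _ _ hx.1, by
        rw [Set.mem_preimage, hπ, hinv x hx]; rfl⟩
    · rintro ⟨c, y⟩ ⟨hc, hy, hyb⟩
      have hc' : π (σ c • y) = c := by
        rw [hπ, show π y = b₀ from hyb, hσb c hc]
      refine ⟨σ c • y, ⟨hX _ _ hy, ?_⟩, ?_⟩
      · rw [Set.mem_preimage, hc']; exact hc
      · simp only [hc', inv_smul_smul]
    · have h1 : SmoothOn (X ∩ π ⁻¹' restrictTo B O) π := hsm.mono Set.inter_subset_left
      refine h1.prodMk (SmoothOn.smul hA ?_ smoothOn_id)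
      exact SmoothOn.comp smoothOn_inv (SmoothOn.comp hσ h1 fun x hx => hx.2)
        fun _ _ => Set.mem_univ _
    · exact SmoothOn.smul hA (SmoothOn.comp hσ smoothOn_fst fun p hp => hp.1) smoothOn_snd

/-- An injective smooth equivariant map `Φ` to a homogeneous space with smooth local sections is an
isomorphism of bundles as soon as it is compatible with the projections at one point: surjectivity
follows from transitivity, and the inverse is equivariant, hence smooth. -/
theorem isG2BundleIso (h : HasLocalSections B b₀) (hB : ∀ g : G2, g • b₀ ∈ B)
    (hA : SmoothAct A) (hA' : SmoothAct A') (hC : SmoothAct C) {x₀' : A'}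
    (h' : HasLocalSections X' x₀') (hX' : ∀ g : G2, ∀ x ∈ X', g • x ∈ X')
    (hX : ∀ g : G2, ∀ x ∈ X, g • x ∈ X) {π : A → C} {π' : A' → C} {Φ : A → A'}
    (hπ : ∀ (g : G2) (x : A), π (g • x) = g • π x)
    (hπ' : ∀ (g : G2) (x : A'), π' (g • x) = g • π' x)
    (hΦ : ∀ (g : G2) (x : A), Φ (g • x) = g • Φ x) (hmaps : ∀ x ∈ X, Φ x ∈ X')
    (hinj : Set.InjOn Φ X) (hsm : SmoothOn X Φ) (hx₀ : x₀ ∈ X) (hΦx₀ : Φ x₀ = x₀')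
    (hπx₀ : π x₀ = b₀) (hπx₀' : π' x₀' = b₀) : IsG2BundleIso X X' B π π' Φ := by
  have hsurj : ∀ y ∈ X', ∃ g : G2, g • x₀' = y := fun y hy => h'.exists_smul_eq hy
  have htrans : ∀ x ∈ X, ∃ g : G2, g • x₀ = x := by
    intro x hx
    obtain ⟨g, hg⟩ := hsurj _ (hmaps x hx)
    exact ⟨g, hinj (hX g _ hx₀) hx (by rw [hΦ, hΦx₀, hg])⟩
  have hcomm : ∀ x ∈ X, π' (Φ x) = π x := by
    intro x hx
    obtain ⟨g, rfl⟩ := htrans x hx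
    rw [hΦ, hπ', hπ, hΦx₀, hπx₀', hπx₀]
  have hmaps' : ∀ y ∈ X', π' y ∈ B := by
    intro y hy
    obtain ⟨g, rfl⟩ := hsurj y hy
    rw [hπ', hπx₀']
    exact hB g
  have hsm' : SmoothOn X' π' := h'.smoothOn hC fun g => hπ' g _
  have hx₀' : x₀' ∈ X' := hΦx₀ ▸ hmaps _ hx₀
  have hbij : Set.BijOn Φ X X' := by
    refine ⟨hmaps, hinj, fun y hy => ?_⟩
    obtain ⟨g, rfl⟩ := hsurj y hy
    exact ⟨g • x₀, hX g _ hx₀, by rw [hΦ, hΦx₀]⟩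
  have : Nonempty A := ⟨x₀⟩
  refine ⟨h.isG2FibreBundle hA hX hπ (fun x hx => hcomm x hx ▸ hmaps' _ (hmaps x hx)) ?_ hx₀
      hπx₀, h.isG2FibreBundle hA' hX' hπ' hmaps' hsm' hx₀' hπx₀',
      ⟨hbij, hsm, Function.invFunOn Φ X, hbij.injOn.leftInvOn_invFunOn, ?_⟩, hcomm,
      fun g x _ => hΦ g x⟩
  · exact (SmoothOn.comp hsm' hsm hmaps).congr hcomm
  · have hleft := hbij.injOn.leftInvOn_invFunOn
    refine h'.smoothOn hA fun g => ?_
    rw [← hΦx₀, ← hΦ, hleft (hX g _ hx₀), hleft hx₀]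

end HasLocalSections

end Bundles

/-! ### Smooth families of automorphisms from basic triples -/

/-- The standard basis `i, j, k, e, ie, je, ke` of `Im 𝕆`. -/
def stdVec (i : Fin 7) : R7 := EuclideanSpace.single i 1

theorem contDiff_rcross : ContDiff ℝ ∞ fun p : R7 × R7 => rcross p.1 p.2 := by
  rw [contDiff_euclidean]
  intro i
  simp only [rcross, crs_eq]
  fin_cases i <;> simp <;> fun_prop

theorem contDiff_rcross_comp {E : Type*} [NormedAddCommGroup E] [NormedSpace ℝ E] {f g : E → R7}
    (hf : ContDiff ℝ ∞ f) (hg : ContDiff ℝ ∞ g) : ContDiff ℝ ∞ fun x => rcross (f x) (g x) := by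
  have h := contDiff_rcross.comp (hf.prodMk hg)
  exact h

theorem contDiff_toCLM_tripleLin : ContDiff ℝ ∞ fun p : R7 × R7 × R7 =>
    LinearMap.toContinuousLinearMap (tripleLin p.1 p.2.1 p.2.2) := by
  have h1 : ContDiff ℝ ∞ fun p : R7 × R7 × R7 => p.1 := contDiff_fst
  have h2 : ContDiff ℝ ∞ fun p : R7 × R7 × R7 => p.2.1 := by fun_prop
  have h3 : ContDiff ℝ ∞ fun p : R7 × R7 × R7 => p.2.2 := by fun_prop
  have h12 := contDiff_rcross_comp h1 h2
  have h13 := contDiff_rcross_comp h1 h3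
  have h23 := contDiff_rcross_comp h2 h3
  have h123 := contDiff_rcross_comp h12 h3
  rw [contDiff_clm_apply_iff]
  intro x
  exact ((((((h1.const_smul (x 0)).add (h2.const_smul (x 1))).add (h12.const_smul (x 2))).add
    (h3.const_smul (x 3))).add (h13.const_smul (x 4))).add (h23.const_smul (x 5))).add
    (h123.const_smul (x 6))

namespace IsTriple

variable {a b c : R7} (h : IsTriple a b c)
include h

theorem toCLM_tripleG2 : toCLM (tripleG2 a b c) =
    LinearMap.toContinuousLinearMap (tripleLin a b c) := by
  ext1 x
  exact h.tripleG2_smul x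

theorem smul_stdVec_zero : tripleG2 a b c • stdVec 0 = a := by
  rw [h.tripleG2_smul, tripleLin_apply]; simp [stdVec]

theorem smul_stdVec_one : tripleG2 a b c • stdVec 1 = b := by
  rw [h.tripleG2_smul, tripleLin_apply]; simp [stdVec]

theorem smul_stdVec_three : tripleG2 a b c • stdVec 3 = c := by
  rw [h.tripleG2_smul, tripleLin_apply]; simp [stdVec]

end IsTriple

/-- The automorphism that carries the basic triple `a₀, b₀, c₀` to the basic triple `a, b, c`. -/
def moveTriple (a₀ b₀ c₀ a b c : R7) : G2 := tripleG2 a b c * (tripleG2 a₀ b₀ c₀)⁻¹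

section moveTriple

variable {a₀ b₀ c₀ a b c : R7} (h₀ : IsTriple a₀ b₀ c₀) (h : IsTriple a b c)
include h₀ h

theorem moveTriple_smul_fst : moveTriple a₀ b₀ c₀ a b c • a₀ = a := by
  have : (tripleG2 a₀ b₀ c₀)⁻¹ • a₀ = stdVec 0 := by rw [inv_smul_eq_iff, h₀.smul_stdVec_zero]
  rw [moveTriple, mul_smul, this, h.smul_stdVec_zero]

theorem moveTriple_smul_snd : moveTriple a₀ b₀ c₀ a b c • b₀ = b := by
  have : (tripleG2 a₀ b₀ c₀)⁻¹ • b₀ = stdVec 1 := by rw [inv_smul_eq_iff, h₀.smul_stdVec_one]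
  rw [moveTriple, mul_smul, this, h.smul_stdVec_one]

theorem moveTriple_smul_trd : moveTriple a₀ b₀ c₀ a b c • c₀ = c := by
  have : (tripleG2 a₀ b₀ c₀)⁻¹ • c₀ = stdVec 3 := by rw [inv_smul_eq_iff, h₀.smul_stdVec_three]
  rw [moveTriple, mul_smul, this, h.smul_stdVec_three]

end moveTriple

section Smooth

variable {A : Type} [SmoothModel A] {X : Set A} {x : A}

theorem smoothNear_moveTriple {a b c : A → R7} (ha : SmoothNear X a x) (hb : SmoothNear X b x)
    (hc : SmoothNear X c x) (h : ∀ᶠ y in near X x, IsTriple (a y) (b y) (c y)) (a₀ b₀ c₀ : R7) :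
    SmoothNear X (fun y => emb (moveTriple a₀ b₀ c₀ (a y) (b y) (c y))) x := by
  have h1 : SmoothNear X (fun y => emb (tripleG2 (a y) (b y) (c y))) x := by
    refine SmoothNear.congr ((ha.prodMk (hb.prodMk hc)).comp_contDiff contDiff_toCLM_tripleLin) ?_
    filter_upwards [h] with y hy using hy.toCLM_tripleG2.symm
  change SmoothNear X (fun y => toCLM _) x
  simp only [moveTriple, toCLM_mul]
  exact h1.comp_contDiff (G := fun T : R7 →L[ℝ] R7 => T ∘L toCLM (tripleG2 a₀ b₀ c₀)⁻¹)
    (contDiff_id.clm_comp contDiff_const)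

namespace SmoothNear

variable {E E' E'' : Type*} [NormedAddCommGroup E] [NormedSpace ℝ E] [NormedAddCommGroup E']
  [NormedSpace ℝ E'] [NormedAddCommGroup E''] [NormedSpace ℝ E'']

theorem comp_contDiff₂ {f : A → E} {f' : A → E'} (hf : SmoothNear X f x)
    (hf' : SmoothNear X f' x) {G : E → E' → E''} (hG : ContDiff ℝ ∞ fun p : E × E' => G p.1 p.2) :
    SmoothNear X (fun y => G (f y) (f' y)) x :=
  (hf.prodMk hf').comp_contDiff hG

theorem sub {f f' : A → E} (hf : SmoothNear X f x) (hf' : SmoothNear X f' x) :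
    SmoothNear X (fun y => f y - f' y) x :=
  hf.comp_contDiff₂ hf' (contDiff_fst.sub contDiff_snd)

/-- Normalization to length `r` is smooth where it makes sense. -/
theorem normalize {V : Type*} [NormedAddCommGroup V] [InnerProductSpace ℝ V] {f : A → V}
    (hf : SmoothNear X f x) (hx : x ∈ X) (h0 : f x ≠ 0) (r : ℝ) :
    SmoothNear X (fun y => (r * ‖f y‖⁻¹) • f y) x := by
  refine hf.comp_normed hx (G := fun v => (r * ‖v‖⁻¹) • v) ?_
  filter_upwards [isOpen_ne.mem_nhds h0] with v hv
  exact (contDiffAt_const.mul ((contDiffAt_norm ℝ hv).inv (norm_ne_zero_iff.2 hv))).smul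
    contDiffAt_id

theorem eventually_ne {f : A → E} (hf : SmoothNear X f x) (hx : x ∈ X) (h0 : f x ≠ 0) :
    ∀ᶠ y in near X x, f y ≠ 0 :=
  (hf.tendsto hx).eventually (isOpen_ne.mem_nhds h0)

end SmoothNear

end Smooth

/-! ### Null frames -/

/-- A null frame: two orthogonal complex vectors of squared length `2` with vanishing vector
product, spanning an isotropic plane.  The length is chosen so that the real and imaginary parts are
unit vectors; isotropy of `w` follows from the other conditions. -/
structure IsNullFrame (v w : C7) : Prop where
  norm_left : inner ℂ v v = (2 : ℂ)
  norm_right : inner ℂ w w = (2 : ℂ)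
  orth : inner ℂ v w = (0 : ℂ)
  null_left : bilin v v = 0
  null_mixed : bilin v w = 0
  cross_eq : cross v w = 0

/-- The real and imaginary parts of an isotropic vector of squared length `2` are orthonormal. -/
theorem orthonormal_of_null {v : C7} (h : inner ℂ v v = (2 : ℂ)) (h' : bilin v v = 0) :
    inner ℝ v.rePart v.rePart = (1 : ℝ) ∧ inner ℝ v.imPart v.imPart = (1 : ℝ) ∧
      inner ℝ v.rePart v.imPart = (0 : ℝ) := by
  rw [inner_eq_bilin, ← mk_re_im v, conjVec_mk, bilin_mk, Complex.ext_iff] at h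
  rw [← mk_re_im v, bilin_mk, Complex.ext_iff] at h'
  simp only [inner_neg_left, Complex.re_ofNat, Complex.zero_re, Complex.zero_im] at h h'
  have := real_inner_comm v.rePart v.imPart
  exact ⟨by linarith, by linarith, by linarith⟩

namespace IsNullFrame

variable {v w v₀ w₀ : C7}

theorem inner_parts (h : IsNullFrame v w) :
    inner ℝ v.rePart w.rePart = (0 : ℝ) ∧ inner ℝ v.imPart w.rePart = (0 : ℝ) ∧
      inner ℝ v.rePart w.imPart = (0 : ℝ) := by
  have h1 := h.orth
  have h2 := h.null_mixed
  rw [inner_eq_bilin, ← mk_re_im v, conjVec_mk, ← mk_re_im w, bilin_mk, Complex.ext_iff] at h1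
  rw [← mk_re_im v, ← mk_re_im w, bilin_mk, Complex.ext_iff] at h2
  simp only [inner_neg_left, Complex.zero_re, Complex.zero_im] at h1 h2
  exact ⟨by linarith, by linarith, by linarith⟩

theorem cross_parts (h : IsNullFrame v w) :
    rcross v.imPart w.rePart = -rcross v.rePart w.imPart := by
  have h1 := h.cross_eq
  rw [← mk_re_im v, ← mk_re_im w, cross_mk, ← mk_zero, mk_inj] at h1
  exact eq_neg_of_add_eq_zero_right h1.2

/-- The imaginary part of the second vector of a null frame is determined by the other parts. -/
theorem imPart_eq (h : IsNullFrame v w) :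
    w.imPart = rcross v.rePart (rcross v.imPart w.rePart) := by
  rw [h.cross_parts, rcross_neg_right, rcross_rcross_self, h.inner_parts.2.2,
    (orthonormal_of_null h.norm_left h.null_left).1]
  module

/-- The real part of the second vector is a unit vector: the vector product with a unit vector
preserves the length of the vectors orthogonal to it, so that `cross v w = 0` makes the real and
imaginary parts of `w` equally long. -/
theorem norm_rePart_right (h : IsNullFrame v w) : inner ℝ w.rePart w.rePart = (1 : ℝ) := by
  obtain ⟨h1, h2, h3⟩ := orthonormal_of_null h.norm_left h.null_left
  obtain ⟨h4, h5, h6⟩ := h.inner_parts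
  have h8 : inner ℝ w.imPart w.imPart = (inner ℝ w.rePart w.rePart : ℝ) := by
    have e1 : rcross v.imPart w.imPart = rcross v.rePart w.rePart := by
      have h1 := h.cross_eq
      rw [← mk_re_im v, ← mk_re_im w, cross_mk, ← mk_zero, mk_inj] at h1
      exact (sub_eq_zero.1 h1.1).symm
    have key (a c : R7) (ha : inner ℝ a a = (1 : ℝ)) (hac : inner ℝ a c = (0 : ℝ)) :
        inner ℝ (rcross a c) (rcross a c) = (inner ℝ c c : ℝ) := by
      rw [rcross_anti a c, inner_neg_left, inner_neg_right, neg_neg, inner_rcross,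
        rcross_anti c a, rcross_neg_right, rcross_rcross_self, ha, hac]
      simp
    rw [← key _ _ h1 h6, ← key _ _ h2 h5, h.cross_parts, inner_neg_left, inner_neg_right, neg_neg]
  have h7 := h.norm_right
  rw [inner_eq_bilin, ← mk_re_im w, conjVec_mk, bilin_mk, Complex.ext_iff] at h7
  simp only [inner_neg_left, Complex.re_ofNat] at h7
  linarith [h7.1]

theorem isTriple (h : IsNullFrame v w) : IsTriple v.rePart v.imPart w.rePart := by
  obtain ⟨h1, h2, h3⟩ := orthonormal_of_null h.norm_left h.null_left
  obtain ⟨h4, h5, h6⟩ := h.inner_parts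
  refine ⟨h1, h2, h.norm_rePart_right, h3, h4, h5, ?_⟩
  rw [inner_rcross, h.cross_parts, inner_neg_right, inner_rcross_left, neg_zero]

theorem moveTriple_smul_left (h₀ : IsNullFrame v₀ w₀) (h : IsNullFrame v w) :
    moveTriple v₀.rePart v₀.imPart w₀.rePart v.rePart v.imPart w.rePart • v₀ = v := by
  rw [← mk_re_im v₀, smul_mk_G2]
  simp only [mk_re_im]
  rw [moveTriple_smul_fst h₀.isTriple h.isTriple, moveTriple_smul_snd h₀.isTriple h.isTriple]
  rfl

theorem moveTriple_smul_right (h₀ : IsNullFrame v₀ w₀) (h : IsNullFrame v w) :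
    moveTriple v₀.rePart v₀.imPart w₀.rePart v.rePart v.imPart w.rePart • w₀ = w := by
  change C7.mk (_ • w₀.rePart) (_ • w₀.imPart) = w
  rw [h₀.imPart_eq, smul_rcross, smul_rcross, moveTriple_smul_fst h₀.isTriple h.isTriple,
    moveTriple_smul_snd h₀.isTriple h.isTriple, moveTriple_smul_trd h₀.isTriple h.isTriple,
    ← h.imPart_eq]
  rfl

/-- Isotropy follows from the other conditions: `v × (v × w) = (v, w) v - (v, v) w` vanishes, while
`v` and `w` are linearly independent. -/
theorem of_cross {v w : C7} (h1 : inner ℂ v v = (2 : ℂ)) (h2 : inner ℂ w w = (2 : ℂ))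
    (h3 : inner ℂ v w = (0 : ℂ)) (h4 : cross v w = 0) : IsNullFrame v w := by
  have h5 := cross_cross_self v w
  rw [h4, cross_zero_right] at h5
  have h6 : bilin v w = 0 := by
    have := congrArg (inner ℂ v) h5
    rw [inner_zero_right, inner_sub_right, inner_smul_right, inner_smul_right, h1, h3] at this
    simpa using this.symm
  have h7 : bilin v v = 0 := by
    have := congrArg (inner ℂ w) h5
    rw [inner_zero_right, inner_sub_right, inner_smul_right, inner_smul_right, h2, h6] at this
    simpa using this.symm
  exact ⟨h1, h2, h3, h7, h6, h4⟩

theorem left_ne_zero (h : IsNullFrame v w) : v ≠ 0 := by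
  rintro rfl; simpa using h.norm_left

theorem linearIndependent (h : IsNullFrame v w) : LinearIndependent ℂ ![v, w] := by
  rw [LinearIndependent.pair_iff]
  intro s t hst
  have h1 := congrArg (inner ℂ v) hst
  have h2 := congrArg (inner ℂ w) hst
  rw [inner_add_right, inner_smul_right, inner_smul_right, h.norm_left, h.orth] at h1
  rw [inner_add_right, inner_smul_right, inner_smul_right, h.norm_right,
    inner_eq_zero_symm.1 h.orth] at h2
  simpa using And.intro h1 h2

theorem finrank_span (h : IsNullFrame v w) :
    Module.finrank ℂ (Submodule.span ℂ {v, w}) = 2 := by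
  have := finrank_span_eq_card h.linearIndependent
  rwa [Matrix.range_cons_cons_empty, Fintype.card_fin] at this

theorem span_eq (h : IsNullFrame v w) {W : Submodule ℂ C7} (hv : v ∈ W) (hw : w ∈ W)
    (hW : Module.finrank ℂ W = 2) : Submodule.span ℂ {v, w} = W := by
  refine Submodule.eq_of_le_of_finrank_eq ?_ (h.finrank_span.trans hW.symm)
  rw [Submodule.span_le]
  rintro x (rfl | rfl) <;> assumption

end IsNullFrame

/-! ### Associative subspaces -/

/-- A subspace properly contained in another one has a nonzero orthogonal vector in it. -/
theorem exists_mem_orthogonal {k E : Type*} [RCLike k] [NormedAddCommGroup E]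
    [InnerProductSpace k E] [FiniteDimensional k E] {U V : Submodule k E} (hUV : U ≤ V)
    (h : Module.finrank k U < Module.finrank k V) : ∃ w ∈ V, w ≠ 0 ∧ w ∈ Uᗮ := by
  have hlt : U < V := lt_of_le_of_ne hUV fun e => by rw [e] at h; exact lt_irrefl _ h
  obtain ⟨w, hwV, hwU⟩ := SetLike.exists_of_lt hlt
  refine ⟨w - U.starProjection w, V.sub_mem hwV (hUV (Submodule.starProjection_apply_mem _ _)), ?_,
    Submodule.sub_starProjection_mem_orthogonal w⟩
  intro h0
  rw [sub_eq_zero] at h0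
  exact hwU (h0 ▸ Submodule.starProjection_apply_mem _ _)

theorem finrank_span_pair_le {k E : Type*} [Field k] [AddCommGroup E] [Module k E] (v w : E) :
    Module.finrank k (Submodule.span k {v, w}) ≤ 2 := by
  classical
  have := finrank_span_finset_le_card (R := k) ({v, w} : Finset E)
  rw [Finset.coe_pair] at this
  exact this.trans Finset.card_le_two

/-- The imaginary quaternions `Im ℍ ⊆ Im 𝕆`, the base point of the space of associative
subspaces. -/
def imH : Submodule ℝ R7 where
  carrier := {x | x 3 = 0 ∧ x 4 = 0 ∧ x 5 = 0 ∧ x 6 = 0}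
  add_mem' {x y} hx hy := by
    simp only [Set.mem_ofPred_eq] at *
    simp [hx, hy]
  zero_mem' := by simp
  smul_mem' c x hx := by
    simp only [Set.mem_ofPred_eq] at *
    simp [hx]

theorem mem_imH {x : R7} : x ∈ imH ↔ x 3 = 0 ∧ x 4 = 0 ∧ x 5 = 0 ∧ x 6 = 0 := Iff.rfl

theorem eq_of_mem_imH {x : R7} (hx : x ∈ imH) :
    x = x 0 • stdVec 0 + x 1 • stdVec 1 + x 2 • stdVec 2 := by
  obtain ⟨h3, h4, h5, h6⟩ := hx
  ext i
  fin_cases i <;> simp [stdVec, h3, h4, h5, h6]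

theorem finrank_imH : Module.finrank ℝ imH = 3 := by
  let e : imH ≃ₗ[ℝ] (Fin 3 → ℝ) :=
    { toFun := fun x => ![x.1 0, x.1 1, x.1 2]
      invFun := fun c => ⟨WithLp.toLp 2 ![c 0, c 1, c 2, 0, 0, 0, 0], by simp [mem_imH]⟩
      map_add' := fun x y => by ext i; fin_cases i <;> simp
      map_smul' := fun c x => by ext i; fin_cases i <;> simp
      left_inv := fun x => by
        obtain ⟨x, h3, h4, h5, h6⟩ := x
        ext i
        fin_cases i <;> simp [h3, h4, h5, h6]
      right_inv := fun c => by ext i; fin_cases i <;> simp }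
  rw [e.finrank_eq, Module.finrank_fin_fun]

theorem imH_mem_AssocGr : imH ∈ AssocGr := by
  refine ⟨finrank_imH, LinearMap.inl ℝ ℍ[ℝ] ℍ[ℝ], LinearMap.inl_injective, fun a b => ?_,
    fun x => ?_⟩
  · simp [octMul]
  · rw [mem_imH]
    constructor
    · rintro ⟨h3, h4, h5, h6⟩
      refine ⟨(imOct x).1, ?_⟩
      ext <;> simp [h3, h4, h5, h6]
    · rintro ⟨a, ha⟩
      have h2 : (imOct x).2 = 0 := by rw [← ha]; rfl
      exact ⟨congrArg (fun q => q.re) h2, congrArg (fun q => q.imI) h2,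
        congrArg (fun q => q.imJ) h2, congrArg (fun q => q.imK) h2⟩

theorem smul_mem_AssocGr (g : G2) {ξ : Submodule ℝ R7} (h : ξ ∈ AssocGr) : g • ξ ∈ AssocGr := by
  obtain ⟨h3, f, hf, hmul, hx⟩ := h
  refine ⟨(finrank_smul_submodule g ξ).trans h3, g.1.toLinearMap ∘ₗ f,
    g.1.injective.comp hf, fun a b => ?_, fun x => ?_⟩
  · simp only [LinearMap.comp_apply, LinearEquiv.coe_coe, hmul]
    exact g.2 _ _
  · rw [mem_smul_submodule, hx, imOct_smul]
    constructor
    · rintro ⟨a, ha⟩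
      exact ⟨a, by
        rw [LinearMap.comp_apply, ha]
        exact g.1.apply_symm_apply _⟩
    · rintro ⟨a, ha⟩
      exact ⟨a, by
        rw [← ha]
        exact (g.1.symm_apply_apply _).symm⟩

/-- An idempotent octonion is zero or one. -/
theorem eq_one_of_octMul_self {p : Oct ℝ} (h : octMul p p = p) (h0 : p ≠ 0) : p = (1, 0) := by
  rw [octMul_self] at h
  set N := (p.1.re ^ 2 + p.1.imI ^ 2 + p.1.imJ ^ 2 + p.1.imK ^ 2 + p.2.re ^ 2 + p.2.imI ^ 2
        + p.2.imJ ^ 2 + p.2.imK ^ 2 : ℝ) with hN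
  have h1 : (2 * p.1.re - 1) • p = N • ((1, 0) : Oct ℝ) := by
    rw [sub_smul, one_smul, sub_eq_iff_eq_add, ← sub_eq_iff_eq_add', h]
  by_cases hr : 2 * p.1.re - 1 = 0
  · rw [hr, zero_smul] at h1
    have h2 : N = 0 := by simpa using (congrArg (fun q : Oct ℝ => q.1.re) h1).symm
    have h3 : p.1.re ^ 2 ≤ N := by
      rw [hN]
      have := sq_nonneg p.1.imI
      have := sq_nonneg p.1.imJ
      have := sq_nonneg p.1.imK
      have := sq_nonneg p.2.re
      have := sq_nonneg p.2.imI
      have := sq_nonneg p.2.imJ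
      have := sq_nonneg p.2.imK
      linarith
    have h4 : p.1.re = 0 :=
      pow_eq_zero_iff two_ne_zero |>.1 (le_antisymm (h3.trans_eq h2) (sq_nonneg _))
    rw [h4] at hr
    norm_num at hr
  · obtain ⟨c, hc⟩ : ∃ c : ℝ, p = c • ((1, 0) : Oct ℝ) :=
      ⟨(2 * p.1.re - 1)⁻¹ * N, by rw [mul_smul, ← h1, smul_smul, inv_mul_cancel₀ hr, one_smul]⟩
    have hc1 : c * c = c := by
      have := congrArg (fun q : Oct ℝ => q.1.re) h1
      simp only [hN] at this
      rw [hc] at this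
      simp at this
      nlinarith
    have hc0 : c ≠ 0 := by
      rintro rfl
      exact h0 (by rw [hc, zero_smul])
    rw [hc, mul_left_cancel₀ hc0 (hc1.trans (mul_one c).symm), one_smul]

/-- An embedding of the quaternions is automatically unital, so the imaginary part of its image is
closed under the vector product. -/
theorem rcross_mem_of_mem_AssocGr {ξ : Submodule ℝ R7} (h : ξ ∈ AssocGr) {x y : R7} (hx : x ∈ ξ)
    (hy : y ∈ ξ) : rcross x y ∈ ξ := by
  obtain ⟨-, f, hf, hmul, hξ⟩ := h
  have h1 : f 1 = (1, 0) := by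
    refine eq_one_of_octMul_self ?_ ?_
    · rw [← hmul, one_mul]
    · rw [Ne, map_eq_zero_iff f hf]
      exact one_ne_zero
  obtain ⟨a, ha⟩ := (hξ x).1 hx
  obtain ⟨b, hb⟩ := (hξ y).1 hy
  refine (hξ _).2 ⟨a * b + dotp x y • 1, ?_⟩
  rw [map_add, map_smul, hmul, ha, hb, h1, octMul_imOct]
  change _ + imOct (crs x y) + _ = imOct (crs x y)
  module

/-- An automorphism that carries `i, j` into an associative subspace carries `Im ℍ` onto it. -/
theorem smul_imH_eq {g : G2} {ξ : Submodule ℝ R7} (h : ξ ∈ AssocGr) (h0 : g • stdVec 0 ∈ ξ)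
    (h1 : g • stdVec 1 ∈ ξ) : g • imH = ξ := by
  refine Submodule.eq_of_le_of_finrank_eq ?_ ?_
  · intro x hx
    rw [mem_smul_submodule] at hx
    have e2 : stdVec 2 = rcross (stdVec 0) (stdVec 1) := by
      ext i; fin_cases i <;> simp [rcross, crs_eq, stdVec]
    rw [← smul_inv_smul g x, eq_of_mem_imH hx, smul_add, smul_add, e2, smul_comm g, smul_comm g,
      smul_comm g, smul_rcross]
    exact ξ.add_mem (ξ.add_mem (ξ.smul_mem _ h0) (ξ.smul_mem _ h1))
      (ξ.smul_mem _ (rcross_mem_of_mem_AssocGr h h0 h1))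
  · rw [finrank_smul_submodule, finrank_imH, h.1]

theorem inner_unit_self {x : R7} (hx : x ≠ 0) :
    inner ℝ ((1 * ‖x‖⁻¹) • x) ((1 * ‖x‖⁻¹) • x) = (1 : ℝ) := by
  have : ‖x‖ ≠ 0 := norm_ne_zero_iff.2 hx
  rw [real_inner_smul_left, real_inner_smul_right, real_inner_self_eq_norm_sq]
  field_simp

theorem smoothNear_starProjection_real {A : Type} [SmoothModel A] {X : Set A} {x : A}
    {f : A → Submodule ℝ R7} (hf : SmoothNear X (fun y => emb (f y)) x) (w : R7) :
    SmoothNear X (fun y => (f y).starProjection w) x :=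
  hf.comp_contDiff (G := fun T : R7 →L[ℝ] R7 => T w) (contDiff_id.clm_apply contDiff_const)

theorem smoothNear_starProjection_complex {A : Type} [SmoothModel A] {X : Set A} {x : A}
    {f : A → Submodule ℂ C7} (hf : SmoothNear X (fun y => emb (f y)) x) (w : C7) :
    SmoothNear X (fun y => (f y).starProjection w) x := by
  have h : ContDiff ℂ ∞ fun T : C7 →L[ℂ] C7 => T w := contDiff_id.clm_apply contDiff_const
  exact hf.comp_contDiff (G := fun T : C7 →L[ℂ] C7 => T w) (h.restrict_scalars ℝ)

/-- One step of the Gram–Schmidt process: removes from `w` its component along the unit vector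
`u`. -/
def removeComp (u w : R7) : R7 := w - (inner ℝ u w : ℝ) • u

theorem contDiff_removeComp : ContDiff ℝ ∞ fun p : R7 × R7 => removeComp p.1 p.2 :=
  contDiff_snd.sub ((contDiff_fst.inner ℝ contDiff_snd).smul contDiff_fst)

theorem inner_removeComp {u w : R7} (hu : inner ℝ u u = (1 : ℝ)) :
    inner ℝ u (removeComp u w) = (0 : ℝ) := by
  rw [removeComp, inner_sub_right, real_inner_smul_right, hu, mul_one, sub_self]

theorem inner_removeComp_of_orthogonal {u w z : R7} (h1 : inner ℝ z u = (0 : ℝ))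
    (h2 : inner ℝ z w = (0 : ℝ)) : inner ℝ z (removeComp u w) = (0 : ℝ) := by
  rw [removeComp, inner_sub_right, real_inner_smul_right, h1, h2, mul_zero, sub_zero]

theorem removeComp_of_orthogonal {u w : R7} (h : inner ℝ u w = (0 : ℝ)) : removeComp u w = w := by
  rw [removeComp, h, zero_smul, sub_zero]

theorem isTriple_std : IsTriple (stdVec 0) (stdVec 1) (stdVec 3) := by
  constructor <;> simp [inner_eq_dotp, dotp_eq, stdVec, rcross, crs_eq]

/-- Near an associative `ξ`, a basic triple is obtained by projecting two vectors to the subspace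
and one to its orthogonal complement. -/
theorem hasLocalSections_AssocGr : HasLocalSections AssocGr imH := by
  intro ξ hξ
  obtain ⟨e₁, he₁, h₁, -⟩ : ∃ w ∈ ξ, w ≠ 0 ∧ w ∈ (⊥ : Submodule ℝ R7)ᗮ :=
    exists_mem_orthogonal bot_le (by rw [hξ.1, finrank_bot]; norm_num)
  obtain ⟨e₂, he₂, h₂, h₁₂⟩ : ∃ w ∈ ξ, w ≠ 0 ∧ w ∈ (Submodule.span ℝ {e₁})ᗮ :=
    exists_mem_orthogonal ((Submodule.span_singleton_le_iff_mem _ _).2 he₁)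
      (by rw [hξ.1, finrank_span_singleton h₁]; norm_num)
  obtain ⟨e₃, -, h₃, he₃⟩ : ∃ w ∈ (⊤ : Submodule ℝ R7), w ≠ 0 ∧ w ∈ ξᗮ :=
    exists_mem_orthogonal le_top (by rw [hξ.1, finrank_top, finrank_euclideanSpace_fin]; norm_num)
  rw [Submodule.mem_orthogonal_singleton_iff_inner_right] at h₁₂
  let f₁ : Submodule ℝ R7 → R7 := fun η => (1 * ‖η.starProjection e₁‖⁻¹) • η.starProjection e₁
  let r₂ : Submodule ℝ R7 → R7 := fun η => removeComp (f₁ η) (η.starProjection e₂)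
  let f₂ : Submodule ℝ R7 → R7 := fun η => (1 * ‖r₂ η‖⁻¹) • r₂ η
  let r₃ : Submodule ℝ R7 → R7 := fun η => e₃ - η.starProjection e₃
  let f₃ : Submodule ℝ R7 → R7 := fun η => (1 * ‖r₃ η‖⁻¹) • r₃ η
  have p₁ : ξ.starProjection e₁ = e₁ := Submodule.starProjection_eq_self_iff.2 he₁
  have p₂ : ξ.starProjection e₂ = e₂ := Submodule.starProjection_eq_self_iff.2 he₂
  have p₃ : ξ.starProjection e₃ = 0 := by
    rw [Submodule.starProjection_apply_eq_zero_iff]; exact he₃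
  have s₁ : SmoothNear AssocGr (fun η : Submodule ℝ R7 => η.starProjection e₁) ξ :=
    smoothNear_starProjection_real SmoothNear.emb_self e₁
  have n₁ : ξ.starProjection e₁ ≠ 0 := by rwa [p₁]
  have t₁ : SmoothNear AssocGr f₁ ξ := s₁.normalize hξ n₁ 1
  have s₂ : SmoothNear AssocGr r₂ ξ :=
    t₁.comp_contDiff₂ (smoothNear_starProjection_real SmoothNear.emb_self e₂) contDiff_removeComp
  have n₂ : r₂ ξ ≠ 0 := by
    simp only [r₂, f₁, p₁, p₂]
    rwa [removeComp_of_orthogonal (by rw [real_inner_smul_left, h₁₂, mul_zero])]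
  have t₂ : SmoothNear AssocGr f₂ ξ := s₂.normalize hξ n₂ 1
  have s₃ : SmoothNear AssocGr r₃ ξ :=
    (SmoothNear.const e₃).sub (smoothNear_starProjection_real SmoothNear.emb_self e₃)
  have n₃ : r₃ ξ ≠ 0 := by simpa only [r₃, p₃, sub_zero]
  have t₃ : SmoothNear AssocGr f₃ ξ := s₃.normalize hξ n₃ 1
  have key : ∀ᶠ η in near AssocGr ξ, η ∈ AssocGr ∧ f₁ η ∈ η ∧ f₂ η ∈ η ∧
      IsTriple (f₁ η) (f₂ η) (f₃ η) := by
    filter_upwards [eventually_mem_near, s₁.eventually_ne hξ n₁, s₂.eventually_ne hξ n₂,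
      s₃.eventually_ne hξ n₃] with η hη m₁ m₂ m₃
    have k₁ : f₁ η ∈ η := η.smul_mem _ (Submodule.starProjection_apply_mem _ _)
    have k₂ : f₂ η ∈ η := η.smul_mem _ (η.sub_mem (Submodule.starProjection_apply_mem _ _)
      (η.smul_mem _ k₁))
    have k₃ : f₃ η ∈ ηᗮ := Submodule.smul_mem _ _ (Submodule.sub_starProjection_mem_orthogonal _)
    have i₁ : inner ℝ (f₁ η) (f₁ η) = (1 : ℝ) := inner_unit_self m₁
    refine ⟨hη, k₁, k₂, i₁, inner_unit_self m₂, inner_unit_self m₃, ?_, k₃ _ k₁, k₃ _ k₂,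
      k₃ _ (rcross_mem_of_mem_AssocGr hη k₁ k₂)⟩
    rw [real_inner_smul_right, inner_removeComp i₁, mul_zero]
  refine ⟨fun η => moveTriple (stdVec 0) (stdVec 1) (stdVec 3) (f₁ η) (f₂ η) (f₃ η),
    smoothNear_moveTriple t₁ t₂ t₃ (key.mono fun η h => h.2.2.2) _ _ _, ?_⟩
  filter_upwards [key] with η ⟨h0, k₁, k₂, ht⟩
  refine smul_imH_eq h0 ?_ ?_
  · rwa [moveTriple_smul_fst isTriple_std ht]
  · rwa [moveTriple_smul_snd isTriple_std ht]

/-! ### The weight basis and local sections of the twistor spaces -/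

/-- A basis of `ℂ⁷` of weight vectors for the maximal torus of pairs `(q₁, q₂) = (e^{iθ}, e^{iφ})`:
the weights are `0`, `±2θ`, `±(φ - θ)`, `±(φ + θ)`. -/
def weightVec : Fin 7 → C7 :=
  ![C7.mk (stdVec 0) 0,
    C7.mk (stdVec 1) (-stdVec 2), C7.mk (stdVec 1) (stdVec 2),
    C7.mk (stdVec 3) (-stdVec 4), C7.mk (stdVec 3) (stdVec 4),
    C7.mk (stdVec 5) (-stdVec 6), C7.mk (stdVec 5) (stdVec 6)]

/-- The base point of `G₂/U(2)₊`. -/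
def base1 : Submodule ℂ C7 := Submodule.span ℂ {weightVec 3, weightVec 5}

/-- The base point of `Q⁵`. -/
def base2 : Submodule ℂ C7 := Submodule.span ℂ {weightVec 1}

/-- The base point of `G₂/(U(1) × U(1))`. -/
def base3 : Submodule ℂ C7 × Submodule ℂ C7 :=
  (Submodule.span ℂ {weightVec 5}, Submodule.span ℂ {weightVec 5, weightVec 1})

theorem isNullFrame_three_five : IsNullFrame (weightVec 3) (weightVec 5) := by
  refine IsNullFrame.of_cross ?_ ?_ ?_ ?_ <;>
    simp only [weightVec, inner_eq_bilin, Matrix.cons_val, conjVec_mk, bilin_mk, cross_mk,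
      ← mk_zero, mk_inj, Complex.ext_iff, inner_eq_dotp, dotp_eq]
  · simp [stdVec]; norm_num
  · simp [stdVec]; norm_num
  · simp [stdVec]
  · constructor <;> ext i <;> fin_cases i <;> simp [stdVec, rcross, crs_eq]

theorem isNullFrame_five_one : IsNullFrame (weightVec 5) (weightVec 1) := by
  refine IsNullFrame.of_cross ?_ ?_ ?_ ?_ <;>
    simp only [weightVec, inner_eq_bilin, Matrix.cons_val, conjVec_mk, bilin_mk, cross_mk,
      ← mk_zero, mk_inj, Complex.ext_iff, inner_eq_dotp, dotp_eq]
  · simp [stdVec]; norm_num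
  · simp [stdVec]; norm_num
  · simp [stdVec]
  · constructor <;> ext i <;> fin_cases i <;> simp [stdVec, rcross, crs_eq]

theorem smul_mem_T1 (g : G2) {W : Submodule ℂ C7} (h : W ∈ T1) : g • W ∈ T1 := by
  obtain ⟨h1, h2, h3⟩ := h
  refine ⟨(finrank_smul_submodule g W).trans h1, fun v hv w hw => ?_, fun v hv w hw => ?_⟩
  · rw [mem_smul_submodule] at hv hw
    rw [← bilin_smul_smul g⁻¹, h2 _ hv _ hw]
  · rw [mem_smul_submodule] at hv hw
    rw [← smul_eq_zero_iff_eq g⁻¹, smul_cross, h3 _ hv _ hw]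

theorem smul_mem_Q5 (g : G2) {l : Submodule ℂ C7} (h : l ∈ Q5) : g • l ∈ Q5 := by
  obtain ⟨h1, h2⟩ := h
  refine ⟨(finrank_smul_submodule g l).trans h1, fun v hv w hw => ?_⟩
  rw [mem_smul_submodule] at hv hw
  rw [← bilin_smul_smul g⁻¹, h2 _ hv _ hw]

theorem smul_mem_T3 (g : G2) {p : Submodule ℂ C7 × Submodule ℂ C7} (h : p ∈ T3) :
    g • p ∈ T3 := by
  obtain ⟨h1, h2, h3, h4⟩ := h
  refine ⟨(finrank_smul_submodule g p.1).trans h1, (finrank_smul_submodule g p.2).trans h2,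
    Submodule.map_mono h3, ?_⟩
  change g • p.2 ≤ annih (g • p.1)
  rw [smul_annih]
  exact Submodule.map_mono h4

theorem base1_mem : base1 ∈ T1 := by
  have h := isNullFrame_three_five
  have h6 : bilin (weightVec 5) (weightVec 5) = 0 := by
    simp [weightVec, bilin_mk, Complex.ext_iff, inner_eq_dotp, dotp_eq, stdVec]
  refine ⟨h.finrank_span, fun v hv w hw => ?_, fun v hv w hw => ?_⟩ <;>
  · obtain ⟨a, b, rfl⟩ := Submodule.mem_span_pair.1 hv
    obtain ⟨c, d, rfl⟩ := Submodule.mem_span_pair.1 hw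
    simp only [bilin_add_left, bilin_add_right, bilin_smul_left, bilin_smul_right, h.null_left,
      h.null_mixed, h6, bilin_comm (weightVec 5) (weightVec 3), cross_add_left, cross_add_right,
      cross_smul_left, cross_smul_right, cross_self, h.cross_eq,
      cross_anti (weightVec 5) (weightVec 3)]
    simp

theorem base3_mem : base3 ∈ T3 := by
  have h := isNullFrame_five_one
  refine ⟨finrank_span_singleton h.left_ne_zero, h.finrank_span,
    Submodule.span_mono (by simp), ?_⟩
  intro v hv w hw
  obtain ⟨a, b, rfl⟩ := Submodule.mem_span_pair.1 hv
  obtain ⟨c, rfl⟩ := Submodule.mem_span_singleton.1 hw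
  rw [cross_smul_right, cross_add_left, cross_smul_left, cross_smul_left, cross_self,
    cross_anti, h.cross_eq]
  simp

/-- Rescaling of a nonzero complex vector to squared length `2`. -/
def rescale (v : C7) : C7 := (√2 * ‖v‖⁻¹) • v

theorem inner_rescale {v : C7} (hv : v ≠ 0) : inner ℂ (rescale v) (rescale v) = (2 : ℂ) := by
  have hn : ‖v‖ ≠ 0 := norm_ne_zero_iff.2 hv
  have h : ‖rescale v‖ = √2 := by
    rw [rescale, norm_smul, Real.norm_of_nonneg (by positivity)]
    field_simp
  rw [inner_self_eq_norm_sq_to_K, h]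
  norm_cast
  rw [Real.sq_sqrt (by norm_num)]
  norm_num

theorem rescale_mem {V : Submodule ℂ C7} {v : C7} (hv : v ∈ V) : rescale v ∈ V :=
  V.smul_of_tower_mem _ hv

theorem SmoothNear.rescale {A : Type} [SmoothModel A] {X : Set A} {x : A} {f : A → C7}
    (hf : SmoothNear X f x) (hx : x ∈ X) (h0 : f x ≠ 0) :
    SmoothNear X (fun y => rescale (f y)) x := by
  let : InnerProductSpace ℝ C7 := InnerProductSpace.rclikeToReal ℂ C7
  exact hf.normalize hx h0 √2

theorem contDiff_rePart : ContDiff ℝ ∞ C7.rePart := by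
  rw [contDiff_euclidean]
  exact fun i => Complex.reCLM.contDiff.comp
    ((EuclideanSpace.proj i : C7 →L[ℂ] ℂ).restrictScalars ℝ).contDiff

theorem contDiff_imPart : ContDiff ℝ ∞ C7.imPart := by
  rw [contDiff_euclidean]
  exact fun i => Complex.imCLM.contDiff.comp
    ((EuclideanSpace.proj i : C7 →L[ℂ] ℂ).restrictScalars ℝ).contDiff

/-- A local section for the null frames is a local section for everything they determine. -/
theorem exists_section_of_nullFrame {A : Type} [SmoothModel A] {X : Set A} {x : A}
    {f₁ f₂ : A → C7} (t₁ : SmoothNear X f₁ x) (t₂ : SmoothNear X f₂ x)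
    (h : ∀ᶠ y in near X x, IsNullFrame (f₁ y) (f₂ y)) {v w : C7} (h₀ : IsNullFrame v w) :
    ∃ σ : A → G2, SmoothNear X (fun y => emb (σ y)) x ∧
      ∀ᶠ y in near X x, σ y • v = f₁ y ∧ σ y • w = f₂ y := by
  refine ⟨fun y => moveTriple v.rePart v.imPart w.rePart (f₁ y).rePart (f₁ y).imPart
    (f₂ y).rePart, smoothNear_moveTriple (t₁.comp_contDiff contDiff_rePart)
    (t₁.comp_contDiff contDiff_imPart) (t₂.comp_contDiff contDiff_rePart)
    (h.mono fun y hy => hy.isTriple) _ _ _, ?_⟩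
  filter_upwards [h] with y hy
  exact ⟨h₀.moveTriple_smul_left hy, h₀.moveTriple_smul_right hy⟩

/-- Near `W`, a null frame of the plane is obtained by projecting two vectors to it and applying the
Gram–Schmidt process. -/
theorem hasLocalSections_T1 : HasLocalSections T1 base1 := by
  intro W hW
  obtain ⟨w₁, hw₁, h₁, -⟩ : ∃ w ∈ W, w ≠ 0 ∧ w ∈ (⊥ : Submodule ℂ C7)ᗮ :=
    exists_mem_orthogonal bot_le (by rw [hW.1, finrank_bot]; norm_num)
  obtain ⟨w₂, hw₂, h₂, h₁₂⟩ : ∃ w ∈ W, w ≠ 0 ∧ w ∈ (Submodule.span ℂ {w₁})ᗮ :=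
    exists_mem_orthogonal ((Submodule.span_singleton_le_iff_mem _ _).2 hw₁)
      (by rw [hW.1, finrank_span_singleton h₁]; norm_num)
  rw [Submodule.mem_orthogonal_singleton_iff_inner_right] at h₁₂
  let f₁ : Submodule ℂ C7 → C7 := fun V => rescale (V.starProjection w₁)
  -- the factor `2` is the squared length of `f₁ V`
  let r₂ : Submodule ℂ C7 → C7 := fun V =>
    (2 : ℂ) • V.starProjection w₂ - (inner ℂ (f₁ V) (V.starProjection w₂) : ℂ) • f₁ V
  let f₂ : Submodule ℂ C7 → C7 := fun V => rescale (r₂ V)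
  have p₁ : W.starProjection w₁ = w₁ := Submodule.starProjection_eq_self_iff.2 hw₁
  have p₂ : W.starProjection w₂ = w₂ := Submodule.starProjection_eq_self_iff.2 hw₂
  have s₁ : SmoothNear T1 (fun V : Submodule ℂ C7 => V.starProjection w₁) W :=
    smoothNear_starProjection_complex SmoothNear.emb_self w₁
  have n₁ : W.starProjection w₁ ≠ 0 := by rwa [p₁]
  have t₁ : SmoothNear T1 f₁ W := s₁.rescale hW n₁
  have s₂ : SmoothNear T1 r₂ W := by
    refine t₁.comp_contDiff₂ (smoothNear_starProjection_complex SmoothNear.emb_self w₂)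
      (G := fun u w => (2 : ℂ) • w - (inner ℂ u w : ℂ) • u) ?_
    exact (contDiff_snd.const_smul _).sub ((contDiff_fst.inner ℂ contDiff_snd).smul contDiff_fst)
  have n₂ : r₂ W ≠ 0 := by
    have : inner ℂ (f₁ W) w₂ = (0 : ℂ) := by
      simp only [f₁, p₁, rescale]
      rw [← Complex.coe_smul, inner_smul_left, h₁₂, mul_zero]
    simp only [r₂, p₂, this, zero_smul, sub_zero]
    exact smul_ne_zero two_ne_zero h₂
  have t₂ : SmoothNear T1 f₂ W := s₂.rescale hW n₂
  have key : ∀ᶠ V in near T1 W, V ∈ T1 ∧ f₁ V ∈ V ∧ f₂ V ∈ V ∧ IsNullFrame (f₁ V) (f₂ V) := by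
    filter_upwards [eventually_mem_near, s₁.eventually_ne hW n₁, s₂.eventually_ne hW n₂]
      with V hV m₁ m₂
    have k₁ : f₁ V ∈ V := rescale_mem (Submodule.starProjection_apply_mem _ _)
    have k₂ : f₂ V ∈ V := rescale_mem (V.sub_mem
      (V.smul_mem _ (Submodule.starProjection_apply_mem _ _)) (V.smul_mem _ k₁))
    have i₁ := inner_rescale m₁
    refine ⟨hV, k₁, k₂, IsNullFrame.of_cross i₁ (inner_rescale m₂) ?_ (hV.2.2 _ k₁ _ k₂)⟩
    change inner ℂ (f₁ V) (f₁ V) = (2 : ℂ) at i₁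
    simp only [f₂, r₂, rescale]
    rw [← Complex.coe_smul, inner_smul_right, inner_sub_right, inner_smul_right,
      inner_smul_right, i₁]
    ring
  obtain ⟨σ, hσ, hy⟩ := exists_section_of_nullFrame t₁ t₂ (key.mono fun V h => h.2.2.2)
    isNullFrame_three_five
  refine ⟨σ, hσ, ?_⟩
  filter_upwards [key, hy] with V ⟨hV, k₁, k₂, hn⟩ ⟨e₁, e₂⟩
  rw [base1, smul_span_pair, e₁, e₂, hn.span_eq k₁ k₂ hV.1]

/-- Near `(ℓ, D)`, a null frame adapted to `ℓ ⊂ D` is obtained by projecting one vector to `ℓ` and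
another one to `D ⊖ ℓ`. -/
theorem hasLocalSections_T3 : HasLocalSections T3 base3 := by
  intro p hp
  obtain ⟨w₁, hw₁, h₁, -⟩ : ∃ w ∈ p.1, w ≠ 0 ∧ w ∈ (⊥ : Submodule ℂ C7)ᗮ :=
    exists_mem_orthogonal bot_le (by rw [hp.1, finrank_bot]; norm_num)
  obtain ⟨w₂, hw₂, h₂, h₁₂⟩ : ∃ w ∈ p.2, w ≠ 0 ∧ w ∈ p.1ᗮ :=
    exists_mem_orthogonal hp.2.2.1 (by rw [hp.1, hp.2.1]; norm_num)
  let P := Submodule ℂ C7 × Submodule ℂ C7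
  let r₂ : P → C7 := fun q => q.2.starProjection w₂ - q.1.starProjection w₂
  let f₁ : P → C7 := fun q => rescale (q.1.starProjection w₁)
  let f₂ : P → C7 := fun q => rescale (r₂ q)
  have p₁ : p.1.starProjection w₁ = w₁ := Submodule.starProjection_eq_self_iff.2 hw₁
  have p₂ : p.2.starProjection w₂ = w₂ := Submodule.starProjection_eq_self_iff.2 hw₂
  have p₃ : p.1.starProjection w₂ = 0 := by
    rw [Submodule.starProjection_apply_eq_zero_iff]; exact h₁₂
  have e₁ : SmoothNear T3 (fun q : P => emb q.1) p := smoothOn_iff.1 smoothOn_fst p hp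
  have e₂ : SmoothNear T3 (fun q : P => emb q.2) p := smoothOn_iff.1 smoothOn_snd p hp
  have s₁ : SmoothNear T3 (fun q : P => q.1.starProjection w₁) p :=
    smoothNear_starProjection_complex e₁ w₁
  have n₁ : p.1.starProjection w₁ ≠ 0 := by rwa [p₁]
  have s₂ : SmoothNear T3 r₂ p :=
    (smoothNear_starProjection_complex e₂ w₂).sub (smoothNear_starProjection_complex e₁ w₂)
  have n₂ : r₂ p ≠ 0 := by simpa only [r₂, p₂, p₃, sub_zero]
  have t₁ : SmoothNear T3 f₁ p := s₁.rescale hp n₁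
  have t₂ : SmoothNear T3 f₂ p := s₂.rescale hp n₂
  have key : ∀ᶠ q in near T3 p, q ∈ T3 ∧ f₁ q ∈ q.1 ∧ f₂ q ∈ q.2 ∧
      IsNullFrame (f₁ q) (f₂ q) := by
    filter_upwards [eventually_mem_near, s₁.eventually_ne hp n₁, s₂.eventually_ne hp n₂]
      with q hq m₁ m₂
    have k₁ : f₁ q ∈ q.1 := rescale_mem (Submodule.starProjection_apply_mem _ _)
    have k₂ : f₂ q ∈ q.2 := rescale_mem (q.2.sub_mem (Submodule.starProjection_apply_mem _ _)
      (hq.2.2.1 (Submodule.starProjection_apply_mem _ _)))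
    have k₃ : f₂ q ∈ q.1ᗮ := by
      refine rescale_mem ?_
      have : r₂ q = (w₂ - q.1.starProjection w₂) - (w₂ - q.2.starProjection w₂) := by
        simp only [r₂]; abel
      rw [this]
      exact Submodule.sub_mem _ (Submodule.sub_starProjection_mem_orthogonal _)
        (Submodule.orthogonal_le hq.2.2.1 (Submodule.sub_starProjection_mem_orthogonal _))
    refine ⟨hq, k₁, k₂, IsNullFrame.of_cross (inner_rescale m₁) (inner_rescale m₂) (k₃ _ k₁) ?_⟩
    rw [cross_anti, hq.2.2.2 k₂ _ k₁, neg_zero]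
  obtain ⟨σ, hσ, hy⟩ := exists_section_of_nullFrame t₁ t₂ (key.mono fun V h => h.2.2.2)
    isNullFrame_five_one
  refine ⟨σ, hσ, ?_⟩
  filter_upwards [key, hy] with q ⟨hq, k₁, k₂, hn⟩ ⟨e₁, e₂⟩
  ext1
  · change σ q • Submodule.span ℂ {weightVec 5} = q.1
    rw [smul_span_singleton, e₁]
    refine Submodule.eq_of_le_of_finrank_eq ?_ ?_
    · rwa [Submodule.span_singleton_le_iff_mem]
    · rw [finrank_span_singleton hn.left_ne_zero, hq.1]
  · change σ q • Submodule.span ℂ {weightVec 5, weightVec 1} = q.2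
    rw [smul_span_pair, e₁, e₂, hn.span_eq (hq.2.2.1 k₁) k₂ hq.2.1]

/-- Near an isotropic line, a spanning vector `a + b √-1` varies smoothly; a fixed vector, made
orthogonal to `a`, `b` and `a × b`, completes `a, b` to a basic triple. -/
theorem hasLocalSections_Q5 : HasLocalSections Q5 base2 := by
  intro l hl
  obtain ⟨w₁, hw₁, h₁, -⟩ : ∃ w ∈ l, w ≠ 0 ∧ w ∈ (⊥ : Submodule ℂ C7)ᗮ :=
    exists_mem_orthogonal bot_le (by rw [hl.1, finrank_bot]; norm_num)
  let f : Submodule ℂ C7 → C7 := fun V => rescale (V.starProjection w₁)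
  have p₁ : l.starProjection w₁ = w₁ := Submodule.starProjection_eq_self_iff.2 hw₁
  have s₁ : SmoothNear Q5 (fun V : Submodule ℂ C7 => V.starProjection w₁) l :=
    smoothNear_starProjection_complex SmoothNear.emb_self w₁
  have n₁ : l.starProjection w₁ ≠ 0 := by rwa [p₁]
  have t₁ : SmoothNear Q5 f l := s₁.rescale hl n₁
  have ta := t₁.comp_contDiff contDiff_rePart
  have tb := t₁.comp_contDiff contDiff_imPart
  have tab := ta.comp_contDiff₂ tb (G := rcross) contDiff_rcross
  let U : Submodule ℝ R7 := Submodule.span ℝ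
    (Finset.image ![(f l).rePart, (f l).imPart, rcross (f l).rePart (f l).imPart] Finset.univ)
  obtain ⟨c, -, hc, hcU⟩ : ∃ w ∈ (⊤ : Submodule ℝ R7), w ≠ 0 ∧ w ∈ Uᗮ := by
    refine exists_mem_orthogonal le_top ?_
    rw [finrank_top, finrank_euclideanSpace_fin]
    exact ((finrank_span_finset_le_card _).trans Finset.card_image_le).trans_lt (by simp)
  have hmem (i : Fin 3) :
      ![(f l).rePart, (f l).imPart, rcross (f l).rePart (f l).imPart] i ∈ U :=
    Submodule.subset_span (Finset.mem_coe.2 (Finset.mem_image_of_mem _ (Finset.mem_univ i)))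
  let r : Submodule ℂ C7 → R7 := fun V => removeComp (f V).rePart (removeComp (f V).imPart
    (removeComp (rcross (f V).rePart (f V).imPart) c))
  have hr : SmoothNear Q5 r l := ta.comp_contDiff₂ (tb.comp_contDiff₂
    (tab.comp_contDiff₂ (SmoothNear.const c) contDiff_removeComp) contDiff_removeComp)
    contDiff_removeComp
  have hr0 : r l ≠ 0 := by
    have e2 : removeComp (rcross (f l).rePart (f l).imPart) c = c :=
      removeComp_of_orthogonal (hcU _ (hmem 2))
    have e1 : removeComp (f l).imPart c = c := removeComp_of_orthogonal (hcU _ (hmem 1))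
    have e0 : removeComp (f l).rePart c = c := removeComp_of_orthogonal (hcU _ (hmem 0))
    simp only [r, e2, e1, e0]
    exact hc
  have tc := hr.normalize hl hr0 1
  have key : ∀ᶠ V in near Q5 l, V ∈ Q5 ∧ f V ∈ V ∧ f V ≠ 0 ∧
      IsTriple (f V).rePart (f V).imPart ((1 * ‖r V‖⁻¹) • r V) := by
    filter_upwards [eventually_mem_near, s₁.eventually_ne hl n₁, hr.eventually_ne hl hr0]
      with V hV m₁ m₂
    have k₁ : f V ∈ V := rescale_mem (Submodule.starProjection_apply_mem _ _)
    have i₁ : inner ℂ (f V) (f V) = (2 : ℂ) := inner_rescale m₁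
    obtain ⟨aa, bb, ab⟩ := orthonormal_of_null i₁ (hV.2 _ k₁ _ k₁)
    have ba := (real_inner_comm (f V).imPart (f V).rePart).symm.trans ab
    have abab : inner ℝ (rcross (f V).rePart (f V).imPart) (rcross (f V).rePart (f V).imPart)
        = (1 : ℝ) := by
      rw [inner_rcross, rcross_anti (f V).rePart (f V).imPart, rcross_neg_right,
        rcross_rcross_self, ba, bb, inner_neg_right, inner_sub_right, real_inner_smul_right,
        real_inner_smul_right, aa, ab]
      norm_num
    have aba := (real_inner_comm _ _).trans (inner_rcross_left (f V).rePart (f V).imPart)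
    have abb := (real_inner_comm _ _).trans (inner_rcross_right (f V).rePart (f V).imPart)
    refine ⟨hV, k₁, ?_, aa, bb, inner_unit_self m₂, ab, ?_, ?_, ?_⟩
    · intro h0
      rw [h0, inner_zero_left] at i₁
      norm_num at i₁
    · rw [real_inner_smul_right, inner_removeComp aa, mul_zero]
    · rw [real_inner_smul_right, inner_removeComp_of_orthogonal ba (inner_removeComp bb),
        mul_zero]
    · rw [real_inner_smul_right, inner_removeComp_of_orthogonal aba
        (inner_removeComp_of_orthogonal abb (inner_removeComp abab)), mul_zero]
  have h₀ : IsTriple (stdVec 1) (-stdVec 2) (stdVec 3) := by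
    constructor <;> simp [inner_eq_dotp, dotp_eq, stdVec, rcross, crs_eq]
  refine ⟨fun V => moveTriple (stdVec 1) (-stdVec 2) (stdVec 3) (f V).rePart (f V).imPart
    ((1 * ‖r V‖⁻¹) • r V), smoothNear_moveTriple ta tb tc (key.mono fun V h => h.2.2.2) _ _ _, ?_⟩
  filter_upwards [key] with V ⟨hV, k₁, k₂, hn⟩
  have e : moveTriple (stdVec 1) (-stdVec 2) (stdVec 3) (f V).rePart (f V).imPart
      ((1 * ‖r V‖⁻¹) • r V) • weightVec 1 = f V := by
    change C7.mk (_ • stdVec 1) (_ • -stdVec 2) = f V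
    rw [moveTriple_smul_fst h₀ hn, moveTriple_smul_snd h₀ hn]
    rfl
  rw [base2, smul_span_singleton, e]
  refine Submodule.eq_of_le_of_finrank_eq ?_ ?_
  · rwa [Submodule.span_singleton_le_iff_mem]
  · rw [finrank_span_singleton k₂, hV.1]

/-! ### Weight decompositions and the base flags -/

/-- The infinitesimal generator, divided by `√-1`, of the one-parameter group
`t ↦ (e^{iθt}, e^{iφt})` of the maximal torus, acting on `ℂ⁷`. -/
def weightOp (θ φ : ℤ) : C7 →ₗ[ℂ] C7 where
  toFun v := WithLp.toLp 2 ![0, 2 * θ * Complex.I * v 2, -(2 * θ * Complex.I * v 1),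
    (φ - θ) * Complex.I * v 4, -((φ - θ) * Complex.I * v 3),
    (φ + θ) * Complex.I * v 6, -((φ + θ) * Complex.I * v 5)]
  map_add' v w := by ext i; fin_cases i <;> simp <;> ring
  map_smul' c v := by ext i; fin_cases i <;> simp <;> ring

theorem weightOp_apply (θ φ : ℤ) (v : C7) : weightOp θ φ v =
    WithLp.toLp 2 ![0, 2 * θ * Complex.I * v 2, -(2 * θ * Complex.I * v 1),
    (φ - θ) * Complex.I * v 4, -((φ - θ) * Complex.I * v 3),
    (φ + θ) * Complex.I * v 6, -((φ + θ) * Complex.I * v 5)] := rfl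

/-- The weights of the vectors `weightVec`. -/
def weight (θ φ : ℤ) : Fin 7 → ℤ := ![0, 2 * θ, -(2 * θ), φ - θ, θ - φ, φ + θ, -φ - θ]

theorem weightOp_weightVec (θ φ : ℤ) (p : Fin 7) :
    weightOp θ φ (weightVec p) = (weight θ φ p : ℂ) • weightVec p := by
  rw [weightOp_apply]
  ext i
  fin_cases p <;> fin_cases i <;>
    simp [weightVec, weight, C7.mk, stdVec, Complex.ext_iff] <;> ring

/-- The torus acts by automorphisms, so its generators are derivations of the vector product. -/
theorem weightOp_cross (θ φ : ℤ) (v w : C7) : weightOp θ φ (cross v w) =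
    cross (weightOp θ φ v) w + cross v (weightOp θ φ w) := by
  simp only [weightOp_apply]
  change _ = WithLp.toLp 2 (crs _ _) + WithLp.toLp 2 (crs _ _)
  have h (i : Fin 7) : (cross v w) i = crs v w i := rfl
  simp only [h, crs_eq]
  ext i
  fin_cases i <;> simp <;> ring

theorem inner_weightOp (θ φ : ℤ) (v w : C7) :
    (inner ℂ (weightOp θ φ v) w : ℂ) = inner ℂ v (weightOp θ φ w) := by
  rw [weightOp_apply, weightOp_apply, PiLp.inner_apply, PiLp.inner_apply]
  simp [Fin.sum_univ_succ, map_ofNat (starRingEnd ℂ) 2]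
  ring

theorem conjVec_weightOp (θ φ : ℤ) (v : C7) :
    conjVec (weightOp θ φ v) = -weightOp θ φ (conjVec v) := by
  rw [weightOp_apply, weightOp_apply]
  ext i
  fin_cases i <;> simp [conjVec, map_ofNat (starRingEnd ℂ) 2]

theorem weightVec_ne_zero (p : Fin 7) : weightVec p ≠ 0 := by
  intro h
  have h2 := congrArg C7.rePart h
  have h3 (i : Fin 7) : stdVec i ≠ 0 := by
    intro h
    simpa [stdVec] using congrArg (fun x : R7 => x i) h
  fin_cases p
  exacts [h3 0 h2, h3 1 h2, h3 1 h2, h3 3 h2, h3 3 h2, h3 5 h2, h3 5 h2]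

theorem linearIndependent_weightVec : LinearIndependent ℂ weightVec := by
  -- the weights for `(θ, φ) = (1, 5)` are distinct
  refine Module.End.eigenvectors_linearIndependent' (weightOp 1 5)
    (fun p => (weight 1 5 p : ℂ)) ?_ weightVec fun p => ?_
  · refine Int.cast_injective.comp ?_
    decide
  · exact ⟨Module.End.mem_eigenspace_iff.2 (weightOp_weightVec 1 5 p), weightVec_ne_zero p⟩

theorem span_weightVec : Submodule.span ℂ (Set.range weightVec) = ⊤ :=
  linearIndependent_weightVec.span_eq_top_of_card_eq_finrank' (by simp)

/-- The span of the basis vectors of weight `i`. -/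
def weightSpace (θ φ i : ℤ) : Submodule ℂ C7 :=
  Submodule.span ℂ (weightVec '' {p | weight θ φ p = i})

theorem weightVec_mem_weightSpace (θ φ : ℤ) (p : Fin 7) :
    weightVec p ∈ weightSpace θ φ (weight θ φ p) :=
  Submodule.subset_span ⟨p, rfl, rfl⟩

/-- The weight spaces are the eigenspaces of `weightOp`, since the weight vectors form a basis. -/
theorem mem_weightSpace {θ φ i : ℤ} {u : C7} :
    u ∈ weightSpace θ φ i ↔ weightOp θ φ u = (i : ℂ) • u := by
  constructor
  · intro h
    refine Module.End.mem_eigenspace_iff.1 ((Submodule.span_le.2 ?_ : weightSpace θ φ i ≤ _) h)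
    rintro _ ⟨p, hp, rfl⟩
    refine Module.End.mem_eigenspace_iff.2 ?_
    rw [weightOp_weightVec, show weight θ φ p = i from hp]
  · intro h
    obtain ⟨c, rfl⟩ := (Submodule.mem_span_range_iff_exists_fun ℂ).1
      (span_weightVec ▸ Submodule.mem_top : u ∈ Submodule.span ℂ (Set.range weightVec))
    have h2 : ∑ p, (c p * (weight θ φ p - i)) • weightVec p = 0 := by
      rw [map_sum, Finset.smul_sum, ← sub_eq_zero, ← Finset.sum_sub_distrib] at h
      rw [← h]
      refine Finset.sum_congr rfl fun p _ => ?_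
      rw [map_smul, weightOp_weightVec]
      module
    refine Submodule.sum_mem _ fun p _ => ?_
    rcases mul_eq_zero.1 (Fintype.linearIndependent_iff.1 linearIndependent_weightVec _ h2 p)
      with h3 | h3
    · rw [h3, zero_smul]; exact Submodule.zero_mem _
    · rw [sub_eq_zero, Int.cast_inj] at h3
      exact Submodule.smul_mem _ _ (h3 ▸ weightVec_mem_weightSpace θ φ p)

/-- The flag of weight spaces. -/
def weightFlag (s : ℕ) (θ φ : ℤ) : Legs s := fun i => weightSpace θ φ i

theorem leg_weightFlag {s : ℕ} {θ φ : ℤ} (hs : ∀ p, weight θ φ p ∈ Set.Icc (-(s : ℤ)) s) (i : ℤ) :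
    leg (weightFlag s θ φ) i = weightSpace θ φ i := by
  unfold leg
  split_ifs with h
  · rfl
  · have : {p | weight θ φ p = i} = ∅ := by
      ext p
      simp only [Set.mem_ofPred_eq, Set.mem_empty_iff_false, iff_false]
      rintro rfl
      exact h (hs p)
    rw [weightSpace, this, Set.image_empty, Submodule.span_empty]

theorem finrank_weightSpace (θ φ i : ℤ) : Module.finrank ℂ (weightSpace θ φ i) =
    Fintype.card {p // weight θ φ p = i} := by
  rw [weightSpace, Set.image_eq_range]
  exact finrank_span_eq_card
    (linearIndependent_weightVec.comp (fun p : {p // weight θ φ p = i} => p.1)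
      Subtype.val_injective)

/-- The weight spaces of a one-parameter subgroup are orthogonal because `weightOp` is self-adjoint,
multiply correctly because it is a derivation, and are exchanged by conjugation because it
anticommutes with it. -/
theorem weightFlag_mem {s : ℕ} {d : ℕ → ℕ} {θ φ : ℤ}
    (hs : ∀ p, weight θ φ p ∈ Set.Icc (-(s : ℤ)) s)
    (hd : ∀ i ∈ Set.Icc (-(s : ℤ)) s, Fintype.card {p // weight θ φ p = i} = d i.natAbs) :
    weightFlag s θ φ ∈ G2Flags s d := by
  refine ⟨⟨fun i => ?_, fun i j hij => ?_, ?_, fun i => ?_⟩, fun i j v hv w hw => ?_⟩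
  · exact (finrank_weightSpace θ φ i).trans (hd i i.2)
  · rw [Submodule.isOrtho_iff_inner_eq]
    intro v hv w hw
    have h := inner_weightOp θ φ v w
    rw [mem_weightSpace.1 hv, mem_weightSpace.1 hw, inner_smul_left, inner_smul_right,
      map_intCast, ← sub_eq_zero, ← sub_mul, mul_eq_zero, sub_eq_zero, Int.cast_inj] at h
    exact h.resolve_left fun e => hij (Subtype.ext e)
  · rw [eq_top_iff, ← span_weightVec, Submodule.span_le]
    rintro _ ⟨p, rfl⟩
    exact Submodule.mem_iSup_of_mem ⟨_, hs p⟩ (weightVec_mem_weightSpace θ φ p)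
  · rw [leg_weightFlag hs, leg_weightFlag hs]
    ext u
    change _ ↔ conjVec u ∈ weightSpace θ φ i
    have key : weightOp θ φ (conjVec u) = -conjVec (weightOp θ φ u) := by
      rw [conjVec_weightOp, neg_neg]
    rw [mem_weightSpace, mem_weightSpace, key]
    constructor
    · intro h
      rw [h, conjVec_smul, map_intCast]
      push_cast
      module
    · intro h
      rw [neg_eq_iff_eq_neg] at h
      rw [← conjVec_conjVec (weightOp θ φ u), h, ← neg_smul, conjVec_smul, conjVec_conjVec,
        map_neg, map_intCast]
      push_cast
      rfl
  · rw [leg_weightFlag hs, mem_weightSpace] at *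
    rw [weightOp_cross, hv, hw, cross_smul_left, cross_smul_right]
    push_cast
    module

theorem weightFlag_mem_Flags1 : weightFlag 1 0 1 ∈ Flags1 := by
  refine weightFlag_mem (by decide) fun i hi => ?_
  obtain ⟨h1, h2⟩ := hi
  push_cast at h1 h2
  interval_cases i <;> rfl

theorem weightFlag_mem_Flags2 : weightFlag 2 1 0 ∈ Flags2 := by
  refine weightFlag_mem (by decide) fun i hi => ?_
  obtain ⟨h1, h2⟩ := hi
  push_cast at h1 h2
  interval_cases i <;> rfl

theorem weightFlag_mem_Flags3 : weightFlag 3 1 2 ∈ Flags3 := by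
  refine weightFlag_mem (by decide) fun i hi => ?_
  obtain ⟨h1, h2⟩ := hi
  push_cast at h1 h2
  interval_cases i <;> rfl

theorem leg_weightFlag_one : leg (weightFlag 1 0 1) 1 = base1 := by
  rw [leg_weightFlag (by decide), weightSpace, base1, ← Set.image_pair]
  congr 2
  ext p; revert p; decide

theorem leg_weightFlag_two : leg (weightFlag 2 1 0) 2 = base2 := by
  rw [leg_weightFlag (by decide), weightSpace, base2, ← Set.image_singleton]
  congr 2
  ext p; revert p; decide

theorem legs_weightFlag_three :
    (leg (weightFlag 3 1 2) 3, leg (weightFlag 3 1 2) 2 ⊔ leg (weightFlag 3 1 2) 3) = base3 := by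
  rw [leg_weightFlag (by decide), leg_weightFlag (by decide)]
  have h3 : {p | weight 1 2 p = 3} = {5} := by ext p; revert p; decide
  have h2 : {p | weight 1 2 p = 2} = {1} := by ext p; revert p; decide
  rw [weightSpace, weightSpace, h2, h3, Set.image_singleton, Set.image_singleton, sup_comm,
    ← Submodule.span_union]
  rfl

/-! ### The base points lie over the imaginary quaternions -/

/-- The complexification of `Im ℍ`. -/
def imHC : Submodule ℂ C7 where
  carrier := {x | x 3 = 0 ∧ x 4 = 0 ∧ x 5 = 0 ∧ x 6 = 0}
  add_mem' {x y} hx hy := by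
    simp only [Set.mem_ofPred_eq] at *
    simp [hx, hy]
  zero_mem' := by simp
  smul_mem' c x hx := by
    simp only [Set.mem_ofPred_eq] at *
    simp [hx]

theorem mem_imHC {x : C7} : x ∈ imHC ↔ x 3 = 0 ∧ x 4 = 0 ∧ x 5 = 0 ∧ x 6 = 0 := Iff.rfl

theorem realPts_imHC : realPts imHC = imH := by
  ext x
  change C7.mk x 0 ∈ imHC ↔ _
  simp [mem_imHC, mem_imH, C7.mk, Complex.ext_iff]

theorem eq_of_mem_imHC {x : C7} (hx : x ∈ imHC) : x = x 0 • weightVec 0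
    + ((x 1 + Complex.I * x 2) / 2) • weightVec 1
    + ((x 1 - Complex.I * x 2) / 2) • weightVec 2 := by
  obtain ⟨h3, h4, h5, h6⟩ := hx
  ext i
  fin_cases i <;> simp [weightVec, C7.mk, stdVec, h3, h4, h5, h6, Complex.ext_iff]
  all_goals ring_nf; simp

theorem weightVec_mem_imHC {p : Fin 7} (hp : p = 0 ∨ p = 1 ∨ p = 2) : weightVec p ∈ imHC := by
  rcases hp with rfl | rfl | rfl <;> simp [mem_imHC, weightVec, C7.mk, stdVec, Complex.ext_iff]

theorem imHC_le {V : Submodule ℂ C7} (h : ∀ p : Fin 7, p = 0 ∨ p = 1 ∨ p = 2 → weightVec p ∈ V) :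
    imHC ≤ V := by
  intro x hx
  rw [eq_of_mem_imHC hx]
  exact V.add_mem (V.add_mem (V.smul_mem _ (h 0 (by simp))) (V.smul_mem _ (h 1 (by simp))))
    (V.smul_mem _ (h 2 (by simp)))

theorem evenProj_weightFlag {s : ℕ} {θ φ : ℤ} (hs : ∀ p, weight θ φ p ∈ Set.Icc (-(s : ℤ)) s)
    (heven : ∀ p, 2 ∣ weight θ φ p ↔ p = 0 ∨ p = 1 ∨ p = 2) :
    evenProj (weightFlag s θ φ) = imH := by
  rw [evenProj, ← realPts_imHC]
  congr 1
  simp only [leg_weightFlag hs]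
  refine le_antisymm (iSup_le fun i => Submodule.span_le.2 ?_) (imHC_le fun p hp => ?_)
  · rintro _ ⟨p, hp, rfl⟩
    exact weightVec_mem_imHC ((heven p).1 ⟨i, hp⟩)
  · obtain ⟨i, hi⟩ := (heven p).2 hp
    exact Submodule.mem_iSup_of_mem i (hi ▸ weightVec_mem_weightSpace θ φ p)

theorem twistorProj1_base1 : twistorProj1 base1 = imH := by
  rw [twistorProj1, ← realPts_imHC]
  congr 1
  have h3 : weightVec 3 ∈ base1 := Submodule.subset_span (by simp)
  have h5 : weightVec 5 ∈ base1 := Submodule.subset_span (by simp)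
  have h4 : weightVec 4 ∈ conjSub base1 := by
    change conjVec (C7.mk (stdVec 3) (stdVec 4)) ∈ base1
    rwa [conjVec_mk]
  have h6 : weightVec 6 ∈ conjSub base1 := by
    change conjVec (C7.mk (stdVec 5) (stdVec 6)) ∈ base1
    rwa [conjVec_mk]
  have hb : ∀ u ∈ base1, u 0 = 0 ∧ u 1 = 0 ∧ u 2 = 0 := by
    intro u hu
    obtain ⟨a, b, rfl⟩ := Submodule.mem_span_pair.1 hu
    simp [weightVec, C7.mk, stdVec, Complex.ext_iff]
  refine le_antisymm (fun x hx => ?_) (Submodule.le_orthogonal_iff_le_orthogonal.1 ?_)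
  · rw [Submodule.mem_orthogonal] at hx
    have e3 := hx _ (Submodule.mem_sup_left h3)
    have e4 := hx _ (Submodule.mem_sup_right h4)
    have e5 := hx _ (Submodule.mem_sup_left h5)
    have e6 := hx _ (Submodule.mem_sup_right h6)
    simp only [PiLp.inner_apply, Fin.sum_univ_seven] at e3 e4 e5 e6
    simp [weightVec, C7.mk, stdVec, Complex.ext_iff] at e3 e4 e5 e6
    simp only [mem_imHC, Complex.ext_iff, Complex.zero_re, Complex.zero_im]
    refine ⟨⟨?_, ?_⟩, ⟨?_, ?_⟩, ⟨?_, ?_⟩, ⟨?_, ?_⟩⟩ <;> linarith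
  · refine sup_le (fun u hu => ?_) fun u hu => ?_
    · obtain ⟨h0, h1, h2⟩ := hb u hu
      rw [Submodule.mem_orthogonal]
      rintro x ⟨x3, x4, x5, x6⟩
      rw [PiLp.inner_apply, Fin.sum_univ_seven, h0, h1, h2, x3, x4, x5, x6]
      simp
    · obtain ⟨h0, h1, h2⟩ := hb _ hu
      simp only [conjVec, map_eq_zero] at h0 h1 h2
      rw [Submodule.mem_orthogonal]
      rintro x ⟨x3, x4, x5, x6⟩
      rw [PiLp.inner_apply, Fin.sum_univ_seven, h0, h1, h2, x3, x4, x5, x6]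
      simp

theorem twistorProj2_base2 : twistorProj2 base2 = imH := by
  rw [twistorProj2, ← realPts_imHC]
  congr 1
  have h1 : weightVec 1 ∈ base2 := Submodule.mem_span_singleton_self _
  have h2 : weightVec 2 ∈ conjSub base2 := by
    change conjVec (C7.mk (stdVec 1) (stdVec 2)) ∈ base2
    rwa [conjVec_mk]
  have hle : base2 ≤ imHC :=
    (Submodule.span_singleton_le_iff_mem _ _).2 (weightVec_mem_imHC (by simp))
  have hle' : conjSub base2 ≤ imHC := by
    intro x hx
    have := hle hx
    simpa [mem_imHC, conjVec] using this
  refine le_antisymm (sup_le (sup_le hle hle') (Submodule.span_le.2 ?_)) (imHC_le ?_)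
  · rintro _ ⟨v, hv, w, hw, rfl⟩
    obtain ⟨v3, v4, v5, v6⟩ := hle hv
    obtain ⟨w3, w4, w5, w6⟩ := hle' hw
    change WithLp.toLp 2 (crs v w) ∈ imHC
    simp [mem_imHC, crs_eq, v3, v4, v5, v6, w3, w4, w5, w6]
  · rintro p (rfl | rfl | rfl)
    · have e : cross (weightVec 1) (weightVec 2) = (2 * Complex.I) • weightVec 0 := by
        simp only [weightVec, Matrix.cons_val, cross_mk, smul_mk, mk_inj]
        constructor <;> ext i <;> fin_cases i <;> simp [stdVec, rcross, crs_eq]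
        norm_num
      have e2 : cross (weightVec 1) (weightVec 2) ∈ crossSub base2 (conjSub base2) :=
        Submodule.subset_span ⟨_, h1, _, h2, rfl⟩
      rw [e] at e2
      exact Submodule.mem_sup_right ((Submodule.smul_mem_iff _ (by simp)).1 e2)
    · exact Submodule.mem_sup_left (Submodule.mem_sup_left h1)
    · exact Submodule.mem_sup_left (Submodule.mem_sup_right h2)

theorem base3_orthogonal : base3.2 ⊓ base3.1ᗮ = base2 := by
  have h := isNullFrame_five_one
  refine le_antisymm ?_ ?_
  · rintro u ⟨hu, hu'⟩
    obtain ⟨a, b, rfl⟩ := Submodule.mem_span_pair.1 hu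
    have h1 := hu' _ (Submodule.mem_span_singleton_self _)
    rw [inner_add_right, inner_smul_right, inner_smul_right, h.norm_left, h.orth] at h1
    have ha : a = 0 := by simpa using h1
    rw [ha, zero_smul, zero_add]
    exact Submodule.smul_mem _ _ (Submodule.mem_span_singleton_self _)
  · rw [base2, Submodule.span_singleton_le_iff_mem]
    exact ⟨Submodule.subset_span (by simp),
      Submodule.mem_orthogonal_singleton_iff_inner_right.2 h.orth⟩

theorem twistorProj3_base3 : twistorProj3 base3 = imH := by
  rw [twistorProj3, base3_orthogonal, twistorProj2_base2]

/-! ### Flags are determined by their legs of positive index -/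

section Flags

variable {s : ℕ} {d : ℕ → ℕ}

theorem leg_of_mem (ψ : Legs s) {i : ℤ} (hi : i ∈ Set.Icc (-(s : ℤ)) s) : leg ψ i = ψ ⟨i, hi⟩ :=
  dif_pos hi

theorem leg_of_notMem (ψ : Legs s) {i : ℤ} (hi : i ∉ Set.Icc (-(s : ℤ)) s) : leg ψ i = ⊥ :=
  dif_neg hi

theorem isOrtho_leg {ψ : Legs s} (h : ψ ∈ RealFlags s d) {i j : ℤ} (hij : i ≠ j) :
    leg ψ i ⟂ leg ψ j := by
  by_cases hi : i ∈ Set.Icc (-(s : ℤ)) s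
  · by_cases hj : j ∈ Set.Icc (-(s : ℤ)) s
    · rw [leg_of_mem ψ hi, leg_of_mem ψ hj]
      exact h.2.1 _ _ fun e => hij (congrArg Subtype.val e)
    · rw [leg_of_notMem ψ hj]
      exact Submodule.isOrtho_bot_right
  · rw [leg_of_notMem ψ hi]
    exact Submodule.isOrtho_bot_left

theorem finrank_leg {ψ : Legs s} (h : ψ ∈ RealFlags s d) {i : ℤ}
    (hi : i ∈ Set.Icc (-(s : ℤ)) s) : Module.finrank ℂ (leg ψ i) = d i.natAbs := by
  rw [leg_of_mem ψ hi]
  exact h.1 _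

theorem isotropic_leg {ψ : Legs s} (h : ψ ∈ RealFlags s d) {i : ℤ} (hi : i ≠ 0) :
    IsIsotropic (leg ψ i) := by
  intro v hv w hw
  have h1 : conjVec v ∈ leg ψ (-i) := by
    rw [h.2.2.2 i]
    change conjVec (conjVec v) ∈ leg ψ i
    rwa [conjVec_conjVec]
  rw [← conjVec_conjVec v, ← inner_eq_bilin]
  exact Submodule.isOrtho_iff_inner_eq.1 (isOrtho_leg h (by omega)) _ h1 _ hw

theorem cross_leg_eq_zero {ψ : Legs s} (h : ψ ∈ G2Flags s d) {i j : ℤ} (hij : (s : ℤ) < i + j)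
    {v w : C7} (hv : v ∈ leg ψ i) (hw : w ∈ leg ψ j) : cross v w = 0 := by
  have h1 := h.2 i j v hv w hw
  rw [leg_of_notMem ψ fun h2 => not_lt.2 h2.2 hij] at h1
  exact h1

/-- If `V` is orthogonal to `U` and they span everything, then `V = Uᗮ`. -/
theorem eq_orthogonal_of_sup_eq_top {V U : Submodule ℂ C7} (h : V ⟂ U) (h' : V ⊔ U = ⊤) :
    V = Uᗮ := by
  refine le_antisymm (Submodule.isOrtho_iff_le.1 h) fun x hx => ?_
  obtain ⟨v, hv, u, hu, rfl⟩ := Submodule.mem_sup.1 (h' ▸ Submodule.mem_top : x ∈ V ⊔ U)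
  have h1 : u ∈ Uᗮ := by
    have := Uᗮ.sub_mem hx (Submodule.isOrtho_iff_le.1 h hv)
    rwa [add_sub_cancel_left] at this
  have h2 : u ∈ U ⊓ Uᗮ := ⟨hu, h1⟩
  rw [Submodule.inf_orthogonal_eq_bot, Submodule.mem_bot] at h2
  rwa [h2, add_zero]

theorem leg_zero_eq {ψ : Legs s} (h : ψ ∈ RealFlags s d) :
    leg ψ 0 = (⨆ (i : ℤ) (_ : i ≠ 0), leg ψ i)ᗮ := by
  refine eq_orthogonal_of_sup_eq_top ?_ ?_
  · simp only [Submodule.isOrtho_iSup_right]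
    exact fun i hi => isOrtho_leg h (Ne.symm hi)
  · rw [eq_top_iff, ← h.2.2.1]
    refine iSup_le fun i => ?_
    rw [← leg_of_mem ψ i.2]
    by_cases hi : i.1 = 0
    · rw [hi]; exact le_sup_left
    · exact le_sup_of_le_right (le_iSup₂_of_le i.1 hi le_rfl)

/-- The legs of negative index are the conjugates of those of positive index, and `ψ₀` is the
orthogonal complement of all the others. -/
theorem flag_ext {ψ ψ' : Legs s} (h : ψ ∈ RealFlags s d) (h' : ψ' ∈ RealFlags s d)
    (heq : ∀ i : ℤ, 0 < i → i ≤ s → leg ψ i = leg ψ' i) : ψ = ψ' := by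
  have hpos : ∀ i : ℤ, 0 < i → leg ψ i = leg ψ' i := by
    intro i hi
    by_cases his : i ≤ s
    · exact heq i hi his
    · rw [leg_of_notMem ψ fun h => his h.2, leg_of_notMem ψ' fun h => his h.2]
  have hne : ∀ i : ℤ, i ≠ 0 → leg ψ i = leg ψ' i := by
    intro i hi
    rcases lt_or_gt_of_ne hi with hi | hi
    · rw [← neg_neg i, h.2.2.2, h'.2.2.2, hpos (-i) (by omega)]
    · exact hpos i hi
  have hall : ∀ i : ℤ, leg ψ i = leg ψ' i := by
    intro i
    by_cases hi : i = 0
    · rw [hi, leg_zero_eq h, leg_zero_eq h']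
      congr 1
      exact iSup_congr fun i => iSup_congr fun hi => hne i hi
    · exact hne i hi
  funext i
  rw [← leg_of_mem ψ i.2, ← leg_of_mem ψ' i.2, hall]

theorem smoothOn_leg {X : Set (Legs s)} {i : ℤ} (hi : i ∈ Set.Icc (-(s : ℤ)) s) :
    SmoothOn X fun ψ => leg ψ i :=
  (smoothOn_eval (⟨i, hi⟩ : Set.Icc (-(s : ℤ)) (s : ℤ))).congr fun ψ _ => (leg_of_mem ψ hi).symm

end Flags

/-! ### The maps from flags to the twistor spaces -/

theorem leg_one_mem_T1 {ψ : Legs 1} (h : ψ ∈ Flags1) : leg ψ 1 ∈ T1 :=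
  ⟨finrank_leg h.1 (by decide), isotropic_leg h.1 (by decide),
    fun _ hv _ hw => cross_leg_eq_zero h (by decide) hv hw⟩

theorem injOn_leg_one : Set.InjOn (fun ψ : Legs 1 => leg ψ 1) Flags1 := by
  intro ψ h ψ' h' heq
  refine flag_ext h.1 h'.1 fun i hi his => ?_
  obtain rfl : i = 1 := by push_cast at his; omega
  exact heq

theorem leg_two_mem_Q5 {ψ : Legs 2} (h : ψ ∈ Flags2) : leg ψ 2 ∈ Q5 :=
  ⟨finrank_leg h.1 (by decide), isotropic_leg h.1 (by decide)⟩

/-- The annihilator of an isotropic line `ℓ` is three-dimensional and contains `ℓ`, so its part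
orthogonal to `ℓ` is two-dimensional.  By transitivity, only the base point has to be
considered. -/
theorem finrank_annih_inf_le {l : Submodule ℂ C7} (hl : l ∈ Q5) :
    Module.finrank ℂ (annih l ⊓ lᗮ : Submodule ℂ C7) ≤ 2 := by
  obtain ⟨g, rfl⟩ := hasLocalSections_Q5.exists_smul_eq hl
  rw [smul_annih, smul_orthogonal, ← smul_inf_submodule, finrank_smul_submodule]
  refine le_trans (Submodule.finrank_mono ?_) (finrank_span_pair_le (weightVec 4) (weightVec 5))
  rintro x ⟨hx, hx'⟩
  have h1 : (WithLp.toLp 2 (crs x (weightVec 1)) : C7) = 0 :=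
    hx _ (Submodule.mem_span_singleton_self _)
  have h2 := hx' _ (Submodule.mem_span_singleton_self _)
  have h3 (i : Fin 7) : crs x (weightVec 1) i = 0 := congrArg (fun v : C7 => v i) h1
  have e0 := h3 0
  have e1 := h3 1
  have e2 := h3 2
  have e3 := h3 3
  have e5 := h3 5
  rw [PiLp.inner_apply, Fin.sum_univ_seven] at h2
  simp only [crs_eq] at e0 e1 e2 e3 e5
  simp [weightVec, C7.mk, stdVec, Complex.ext_iff] at e0 e1 e2 e3 e5 h2
  refine Submodule.mem_span_pair.2 ⟨x 3, x 5, ?_⟩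
  ext i
  simp only [weightVec]
  fin_cases i <;> simp [C7.mk, stdVec, Complex.ext_iff] <;> constructor <;> linarith

theorem leg_le_annih_inf_orthogonal {s : ℕ} {d : ℕ → ℕ} {ψ : Legs s}
    (h : ψ ∈ G2Flags s d) {i : ℤ} (hi : 0 < i) (his : i < s) :
    leg ψ i ≤ annih (leg ψ s) ⊓ (leg ψ s)ᗮ :=
  le_inf (fun _ hv _ hw => cross_leg_eq_zero h (by omega) hv hw)
    (Submodule.isOrtho_iff_le.1 (isOrtho_leg h.1 (by omega)))

/-- The line `ψ₂` determines `ψ₁`, the orthogonal complement of `ψ₂` in its annihilator. -/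
theorem injOn_leg_two : Set.InjOn (fun ψ : Legs 2 => leg ψ 2) Flags2 := by
  have key : ∀ ψ : Legs 2, ψ ∈ Flags2 → leg ψ 1 = annih (leg ψ 2) ⊓ (leg ψ 2)ᗮ := by
    intro ψ h
    refine Submodule.eq_of_le_of_finrank_le
      (leg_le_annih_inf_orthogonal h (by decide) (by decide)) ?_
    rw [finrank_leg h.1 (i := 1) (by decide)]
    exact finrank_annih_inf_le (leg_two_mem_Q5 h)
  intro ψ h ψ' h' heq
  simp only at heq
  refine flag_ext h.1 h'.1 fun i hi his => ?_
  push_cast at his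
  obtain rfl | rfl : i = 1 ∨ i = 2 := by omega
  · rw [key ψ h, key ψ' h', heq]
  · exact heq

theorem finrank_sup_of_isOrtho {U V : Submodule ℂ C7} (h : U ⟂ V) :
    Module.finrank ℂ (U ⊔ V : Submodule ℂ C7) = Module.finrank ℂ U + Module.finrank ℂ V := by
  have := Submodule.finrank_sup_add_finrank_inf_eq U V
  rwa [h.disjoint.eq_bot, finrank_bot, add_zero] at this

theorem legs_mem_T3 {ψ : Legs 3} (h : ψ ∈ Flags3) : (leg ψ 3, leg ψ 2 ⊔ leg ψ 3) ∈ T3 := by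
  refine ⟨finrank_leg h.1 (by decide), ?_, le_sup_right, sup_le ?_ ?_⟩
  · rw [finrank_sup_of_isOrtho (isOrtho_leg h.1 (by decide)), finrank_leg h.1 (by decide),
      finrank_leg h.1 (by decide)]
  · exact fun _ hv _ hw => cross_leg_eq_zero h (by decide) hv hw
  · exact fun _ hv _ hw => cross_leg_eq_zero h (by decide) hv hw

/-- Recovers a summand of an orthogonal sum. -/
theorem sup_inf_orthogonal_of_isOrtho {U V : Submodule ℂ C7} (h : U ⟂ V) : (U ⊔ V) ⊓ Vᗮ = U := by
  rw [sup_inf_assoc_of_le _ (Submodule.isOrtho_iff_le.1 h), Submodule.inf_orthogonal_eq_bot,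
    sup_bot_eq]

/-- `ψ₃` and `ψ₂ ⊕ ψ₃` determine `ψ₂` and then `ψ₁`, the orthogonal complement of `ψ₂ ⊕ ψ₃` in the
annihilator of `ψ₃`. -/
theorem injOn_legs_three :
    Set.InjOn (fun ψ : Legs 3 => (leg ψ 3, leg ψ 2 ⊔ leg ψ 3)) Flags3 := by
  have key : ∀ ψ : Legs 3, ψ ∈ Flags3 →
      leg ψ 1 = (annih (leg ψ 3) ⊓ (leg ψ 3)ᗮ) ⊓ (leg ψ 2)ᗮ := by
    intro ψ h
    have h12 : leg ψ 1 ⟂ leg ψ 2 := isOrtho_leg h.1 (by decide)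
    have : leg ψ 1 ⊔ leg ψ 2 = annih (leg ψ 3) ⊓ (leg ψ 3)ᗮ := by
      refine Submodule.eq_of_le_of_finrank_le (sup_le
        (leg_le_annih_inf_orthogonal h (by decide) (by decide))
        (leg_le_annih_inf_orthogonal h (by decide) (by decide))) ?_
      rw [finrank_sup_of_isOrtho h12, finrank_leg h.1 (by decide), finrank_leg h.1 (by decide)]
      exact finrank_annih_inf_le ⟨finrank_leg h.1 (by decide), isotropic_leg h.1 (by decide)⟩
    rw [← this, sup_inf_orthogonal_of_isOrtho h12]
  intro ψ h ψ' h' heq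
  obtain ⟨h3, h23⟩ := Prod.mk.inj heq
  have h2 : leg ψ 2 = leg ψ' 2 := by
    rw [← sup_inf_orthogonal_of_isOrtho (isOrtho_leg h.1 (by decide : (2 : ℤ) ≠ 3)),
      ← sup_inf_orthogonal_of_isOrtho (isOrtho_leg h'.1 (by decide : (2 : ℤ) ≠ 3)), h23, h3]
  refine flag_ext h.1 h'.1 fun i hi his => ?_
  push_cast at his
  obtain rfl | rfl | rfl : i = 1 ∨ i = 2 ∨ i = 3 := by omega
  · rw [key ψ h, key ψ' h', h2, h3]
  · exact h2
  · exact h3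

theorem starProjection_sup_of_isOrtho {U V : Submodule ℂ C7} (h : U ⟂ V) :
    (U ⊔ V).starProjection = U.starProjection + V.starProjection := by
  ext1 x
  refine Submodule.eq_starProjection_of_mem_of_inner_eq_zero ?_ ?_
  · exact Submodule.add_mem_sup (Submodule.starProjection_apply_mem _ _)
      (Submodule.starProjection_apply_mem _ _)
  · intro w hw
    obtain ⟨u, hu, v, hv, rfl⟩ := Submodule.mem_sup.1 hw
    have h1 := Submodule.starProjection_inner_eq_zero (K := U) x u hu
    have h2 := Submodule.starProjection_inner_eq_zero (K := V) x v hv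
    have h3 := Submodule.isOrtho_iff_inner_eq.1 h _ (Submodule.starProjection_apply_mem U x) _ hv
    have h4 := Submodule.isOrtho_iff_inner_eq.1 h.symm _
      (Submodule.starProjection_apply_mem V x) _ hu
    rw [inner_sub_left] at h1 h2
    simp only [add_apply, inner_sub_left, inner_add_left, inner_add_right, h3, h4]
    linear_combination h1 + h2

theorem smoothOn_legs_three :
    SmoothOn Flags3 fun ψ : Legs 3 => (leg ψ 3, leg ψ 2 ⊔ leg ψ 3) := by
  have s2 : SmoothOn Flags3 fun ψ : Legs 3 => leg ψ 2 := smoothOn_leg (by decide)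
  have s3 : SmoothOn Flags3 fun ψ : Legs 3 => leg ψ 3 := smoothOn_leg (by decide)
  refine s3.prodMk (smoothOn_iff.2 fun ψ hψ => ?_)
  refine SmoothNear.congr (f := fun ψ : Legs 3 => (emb (leg ψ 2) + emb (leg ψ 3) :
    Space (Submodule ℂ C7))) ?_ ?_
  · exact (smoothOn_iff.1 s2 ψ hψ).comp_contDiff₂ (smoothOn_iff.1 s3 ψ hψ)
      (contDiff_fst.add contDiff_snd)
  · filter_upwards [eventually_mem_near] with χ hχ
    exact (starProjection_sup_of_isOrtho (isOrtho_leg hχ.1 (by decide))).symm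

/-! ### Automorphisms of the quaternions are inner -/

/-- The quaternion `i`. -/
def qI : ℍ[ℝ] := ⟨0, 1, 0, 0⟩

@[simp] theorem qI_re : qI.re = 0 := rfl
@[simp] theorem qI_imI : qI.imI = 1 := rfl
@[simp] theorem qI_imJ : qI.imJ = 0 := rfl
@[simp] theorem qI_imK : qI.imK = 0 := rfl

/-- The quaternion `j`. -/
def qJ : ℍ[ℝ] := ⟨0, 0, 1, 0⟩

@[simp] theorem qJ_re : qJ.re = 0 := rfl
@[simp] theorem qJ_imI : qJ.imI = 0 := rfl
@[simp] theorem qJ_imJ : qJ.imJ = 1 := rfl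
@[simp] theorem qJ_imK : qJ.imK = 0 := rfl

/-- The quaternion `k`. -/
def qK : ℍ[ℝ] := ⟨0, 0, 0, 1⟩

@[simp] theorem qK_re : qK.re = 0 := rfl
@[simp] theorem qK_imI : qK.imI = 0 := rfl
@[simp] theorem qK_imJ : qK.imJ = 0 := rfl
@[simp] theorem qK_imK : qK.imK = 1 := rfl


theorem linearMap_quaternion_apply (f : ℍ[ℝ] →ₗ[ℝ] ℍ[ℝ]) (a : ℍ[ℝ]) :
    f a = a.re • f 1 + a.imI • f qI + a.imJ • f qJ
      + a.imK • f qK := by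
  conv_lhs => rw [show a = a.re • 1 + a.imI • qI + a.imJ • qJ + a.imK • qK by ext <;> simp]
  simp only [map_add, map_smul]

/-- The average `∑ f(b) c b̄` over the standard basis of the quaternions. -/
def intertwiner (f : ℍ[ℝ] →ₗ[ℝ] ℍ[ℝ]) (c : ℍ[ℝ]) : ℍ[ℝ] :=
  f 1 * c - f qI * c * qI - f qJ * c * qJ
    - f qK * c * qK

theorem mul_intertwiner {f : ℍ[ℝ] →ₗ[ℝ] ℍ[ℝ]} (hf : ∀ a b, f (a * b) = f a * f b) (c x : ℍ[ℝ]) :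
    f x * intertwiner f c = intertwiner f c * x := by
  have h1 := linearMap_quaternion_apply f (x * 1)
  have h2 := linearMap_quaternion_apply f (x * qI)
  have h3 := linearMap_quaternion_apply f (x * qJ)
  have h4 := linearMap_quaternion_apply f (x * qK)
  rw [intertwiner, mul_sub, mul_sub, mul_sub, ← mul_assoc, ← mul_assoc, ← mul_assoc, ← mul_assoc,
    ← mul_assoc, ← mul_assoc, ← mul_assoc, ← hf, ← hf, ← hf, ← hf, h1, h2, h3, h4]
  generalize f 1 = F0
  generalize f qI = F1
  generalize f qJ = F2
  generalize f qK = F3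
  ext <;> simp <;> ring

/-- If all intertwiners vanished, then so would `∑ intertwiner f (b) b̄ = 4 f 1`, where `b` runs
over the standard basis. -/
theorem exists_intertwiner_ne_zero {f : ℍ[ℝ] →ₗ[ℝ] ℍ[ℝ]} (hf : f 1 = 1) :
    ∃ c, intertwiner f c ≠ 0 := by
  by_contra! h
  have key : intertwiner f 1 - intertwiner f qI * qI
      - intertwiner f qJ * qJ - intertwiner f qK * qK
      = (4 : ℝ) • f 1 := by
    simp only [intertwiner]
    generalize f 1 = F0
    generalize f qI = F1
    generalize f qJ = F2
    generalize f qK = F3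
    ext <;> simp <;> ring
  rw [h, h, h, h, hf] at key
  simpa using congrArg (fun q => q.re) key

/-- The Skolem–Noether theorem for the quaternions, with a unit quaternion. -/
theorem exists_unitary_conj {f : ℍ[ℝ] →ₗ[ℝ] ℍ[ℝ]} (hf : ∀ a b, f (a * b) = f a * f b)
    (h1 : f 1 = 1) : ∃ q : unitary ℍ[ℝ], ∀ x, f x = q.1 * x * star q.1 := by
  obtain ⟨c, hc⟩ := exists_intertwiner_ne_zero h1
  set q := intertwiner f c with hq
  have hn : ‖q‖ ≠ 0 := norm_ne_zero_iff.2 hc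
  have e1 : (‖q‖⁻¹ • q) * star (‖q‖⁻¹ • q) = 1 := by
    rw [Quaternion.self_mul_star, Quaternion.normSq_eq_norm_mul_self, norm_smul, norm_inv,
      norm_norm, inv_mul_cancel₀ hn]
    simp
  have e2 : star (‖q‖⁻¹ • q) * (‖q‖⁻¹ • q) = 1 := by
    rw [Quaternion.star_mul_self, Quaternion.normSq_eq_norm_mul_self, norm_smul, norm_inv,
      norm_norm, inv_mul_cancel₀ hn]
    simp
  refine ⟨⟨‖q‖⁻¹ • q, e2, e1⟩, fun x => ?_⟩
  have e3 : f x * (‖q‖⁻¹ • q) = (‖q‖⁻¹ • q) * x := by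
    rw [mul_smul_comm, mul_intertwiner hf, smul_mul_assoc]
  change f x = (‖q‖⁻¹ • q) * x * star (‖q‖⁻¹ • q)
  rw [← e3, mul_assoc, e1, mul_one]

/-! ### The stabilizers of the base points -/

theorem mem_imH_iff_snd {x : R7} : x ∈ imH ↔ (imOct x).2 = 0 := by
  rw [mem_imH]
  constructor
  · rintro ⟨h3, h4, h5, h6⟩
    ext <;> simp [h3, h4, h5, h6]
  · intro h
    exact ⟨congrArg (fun q => q.re) h, congrArg (fun q => q.imI) h, congrArg (fun q => q.imJ) h,
      congrArg (fun q => q.imK) h⟩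

theorem imOct_stdVec_zero : imOct (stdVec 0) = ((qI, 0) : Oct ℝ) := by
  ext <;> simp [stdVec]

theorem imOct_stdVec_one : imOct (stdVec 1) = ((qJ, 0) : Oct ℝ) := by
  ext <;> simp [stdVec]

theorem imOct_stdVec_two : imOct (stdVec 2) = ((qK, 0) : Oct ℝ) := by
  ext <;> simp [stdVec]

theorem imOct_stdVec_three : imOct (stdVec 3) = ((0, 1) : Oct ℝ) := by
  ext <;> simp [stdVec]

theorem imOct_stdVec_four : imOct (stdVec 4) = ((0, qI) : Oct ℝ) := by
  ext <;> simp [stdVec]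

theorem imOct_stdVec_five : imOct (stdVec 5) = ((0, qJ) : Oct ℝ) := by
  ext <;> simp [stdVec]

theorem imOct_stdVec_six : imOct (stdVec 6) = ((0, qK) : Oct ℝ) := by
  ext <;> simp [stdVec]

theorem imOct_neg (x : R7) : imOct (-x : R7) = -imOct x := by
  ext <;> simp

/-- An automorphism of the octonions that preserves `Im ℍ` acts on `ℍ` by an inner automorphism
`a ↦ q₁ a q̄₁` and sends `e` to a multiple `b₀ e`, hence `b e` to `b₀ (q₁ b q̄₁) e`. -/
theorem mem_SO4_of_smul_imH {g : G2} (hg : g • imH = imH) : g ∈ SO4 := by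
  have hsnd : ∀ a : ℍ[ℝ], (g.1 (a, 0)).2 = 0 := by
    intro a
    have e : ((a, 0) : Oct ℝ) = a.re • (1, 0) + imOct (WithLp.toLp 2 (imCoord (a, 0)) : R7) :=
      eq_re_add_im (a, 0)
    have hm : (WithLp.toLp 2 (imCoord ((a, 0) : Oct ℝ)) : R7) ∈ imH := by
      simp [mem_imH, imCoord]
    have hm' := Submodule.smul_mem_pointwise_smul _ g _ hm
    rw [hg, mem_imH_iff_snd, imOct_smul] at hm'
    rw [e, map_add, map_smul, G2.map_one, Prod.snd_add, hm']
    simp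
  let f : ℍ[ℝ] →ₗ[ℝ] ℍ[ℝ] := LinearMap.fst ℝ _ _ ∘ₗ g.1.toLinearMap ∘ₗ LinearMap.inl ℝ _ _
  have hf (a : ℍ[ℝ]) : g.1 (a, 0) = (f a, 0) := Prod.ext rfl (hsnd a)
  have hmul : ∀ a b, f (a * b) = f a * f b := by
    intro a b
    have h := g.2 (a, 0) (b, 0)
    have e (a b : ℍ[ℝ]) : octMul (a, 0) (b, 0) = (a * b, 0) := by simp [octMul]
    rw [e, hf, hf, hf, e] at h
    exact congrArg Prod.fst h
  have h1 : f 1 = 1 := congrArg Prod.fst ((hf 1).symm.trans (G2.map_one g))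
  obtain ⟨q₁, hq₁⟩ := exists_unitary_conj hmul h1
  obtain ⟨b₀, hb₀⟩ : ∃ b₀, g.1 (0, 1) = (0, b₀) := by
    refine ⟨(g.1 (0, 1)).2, Prod.ext ?_ rfl⟩
    have hperp (y : R7) (hy : y ∈ imH) : inner ℝ y (g • stdVec 3) = (0 : ℝ) := by
      rw [← hg, mem_smul_submodule] at hy
      obtain ⟨h3, -⟩ := hy
      rw [← inner_smul_smul g⁻¹, inv_smul_smul]
      rw [stdVec, EuclideanSpace.inner_single_right]
      simp [h3]
    have p0 := hperp (stdVec 0) (by simp [mem_imH, stdVec])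
    have p1 := hperp (stdVec 1) (by simp [mem_imH, stdVec])
    have p2 := hperp (stdVec 2) (by simp [mem_imH, stdVec])
    simp only [stdVec, EuclideanSpace.inner_single_left, map_one, one_mul] at p0 p1 p2
    rw [← imOct_stdVec_three, ← imOct_smul]
    ext
    · rfl
    · exact p0
    · exact p1
    · exact p2
  have hb1 : star b₀ * b₀ = 1 := by
    have h := g.2 (0, 1) (0, 1)
    have e (b : ℍ[ℝ]) : octMul (0, b) (0, b) = (-(star b * b), 0) := by simp [octMul]
    rw [e, hb₀, e, star_one, one_mul, hf, map_neg, h1] at h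
    exact (neg_injective (congrArg Prod.fst h)).symm
  have hb2 : b₀ * star b₀ = 1 := by
    rw [Quaternion.self_mul_star, ← Quaternion.star_mul_self, hb1]
  refine ⟨q₁, Subgroup.mem_top _, ⟨b₀, hb1, hb2⟩ * q₁, Subgroup.mem_top _, fun a b => ?_⟩
  have e : ((a, b) : Oct ℝ) = (a, 0) + octMul (b, 0) (0, 1) := by simp [octMul]
  rw [e, map_add, g.2, hf, hf, hb₀, hq₁, hq₁]
  simp [octMul, mul_assoc]

theorem stabilizer_imH : MulAction.stabilizer G2 imH = SO4 := by
  ext g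
  refine ⟨fun h => mem_SO4_of_smul_imH h, ?_⟩
  rintro ⟨q₁, -, q₂, -, hg⟩
  refine smul_imH_eq imH_mem_AssocGr ?_ ?_
  · rw [mem_imH_iff_snd, imOct_smul, imOct_stdVec_zero, hg]
    simp
  · rw [mem_imH_iff_snd, imOct_smul, imOct_stdVec_one, hg]
    simp

/-- The quaternions that commute with `i` are those of the form `x + y i`. -/
theorem mem_circleQ_iff {q : unitary ℍ[ℝ]} :
    q ∈ circleQ ↔ q.1 * qI = qI * q.1 := by
  change q.1.imJ = 0 ∧ q.1.imK = 0 ↔ _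
  constructor
  · rintro ⟨h1, h2⟩
    ext <;> simp [h1, h2]
  · intro h
    have h1 := congrArg (fun q => q.imJ) h
    have h2 := congrArg (fun q => q.imK) h
    simp at h1 h2
    constructor <;> linarith

/-- If a map `b ↦ q b p̄` carries `i b` to `i` times the image of a single `b ≠ 0`, then `q`
commutes with `i`. -/
theorem mem_circleQ_of_conj {q p : unitary ℍ[ℝ]} {b : ℍ[ℝ]} (hb : b ≠ 0)
    (h : q.1 * (qI * b) * star p.1 = qI * (q.1 * b * star p.1)) :
    q ∈ circleQ := by
  rw [mem_circleQ_iff]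
  have hp : star p.1 ≠ 0 := by
    intro h0
    have := p.2.1
    rw [h0, zero_mul] at this
    exact zero_ne_one this
  simp only [← mul_assoc] at h
  exact mul_right_cancel₀ hb (mul_right_cancel₀ hp h)

/-- The base plane `W₀` consists of the vectors `b e - (i b) e √-1`: it is the graph of left
multiplication by `-i` on the coefficients of `e`.  Such a description is preserved by
`b ↦ q₂ b q̄₁` exactly when `q₂` commutes with `i`. -/
theorem mem_base1_iff {u : C7} : u ∈ base1 ↔ (imOct u.rePart).1 = 0 ∧ (imOct u.imPart).1 = 0 ∧
    (imOct u.imPart).2 = -(qI * (imOct u.rePart).2) := by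
  constructor
  · intro hu
    obtain ⟨a, b, rfl⟩ := Submodule.mem_span_pair.1 hu
    refine ⟨?_, ?_, ?_⟩ <;> ext <;> simp [weightVec, C7.mk, stdVec, C7.rePart, C7.imPart]
  · rintro ⟨h1, h2, h3⟩
    have a0 := congrArg (fun q => q.imI) h1
    have a1 := congrArg (fun q => q.imJ) h1
    have a2 := congrArg (fun q => q.imK) h1
    have b0 := congrArg (fun q => q.imI) h2
    have b1 := congrArg (fun q => q.imJ) h2
    have b2 := congrArg (fun q => q.imK) h2
    have c0 := congrArg (fun q => q.re) h3
    have c1 := congrArg (fun q => q.imI) h3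
    have c2 := congrArg (fun q => q.imJ) h3
    have c3 := congrArg (fun q => q.imK) h3
    simp [C7.rePart, C7.imPart] at a0 a1 a2 b0 b1 b2 c0 c1 c2 c3
    refine Submodule.mem_span_pair.2 ⟨u 3, u 5, ?_⟩
    ext i
    fin_cases i <;> simp [weightVec, C7.mk, stdVec, Complex.ext_iff, a0, a1, a2, b0, b1, b2, c0,
      c1, c2, c3]

theorem stabilizer_base1 : MulAction.stabilizer G2 base1 = U2plus := by
  ext g
  rw [MulAction.mem_stabilizer_iff]
  constructor
  · intro h
    have h1 : g • imH = imH := by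
      rw [← twistorProj1_base1, ← twistorProj1_smul, h]
    obtain ⟨q₁, hq₁, q₂, -, hg⟩ := mem_SO4_of_smul_imH h1
    refine ⟨q₁, hq₁, q₂, ?_, hg⟩
    have h3 : weightVec 3 ∈ base1 := Submodule.subset_span (by simp)
    have h4 := Submodule.smul_mem_pointwise_smul _ g _ h3
    rw [h] at h4
    obtain ⟨-, -, h5⟩ := mem_base1_iff.1 h4
    change (imOct (g • -stdVec 4 : R7)).2 = -(_ * (imOct (g • stdVec 3 : R7)).2) at h5
    rw [smul_neg, imOct_neg, Prod.snd_neg, neg_inj, imOct_smul, imOct_smul, imOct_stdVec_three,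
      imOct_stdVec_four, hg, hg] at h5
    refine mem_circleQ_of_conj (p := q₁) (b := 1) one_ne_zero ?_
    rwa [mul_one]
  · rintro ⟨q₁, hq₁, q₂, hq₂, hg⟩
    refine Submodule.eq_of_le_of_finrank_eq ?_ (finrank_smul_submodule g base1)
    rintro _ ⟨u, hu, rfl⟩
    change g • u ∈ base1
    obtain ⟨h1, h2, h3⟩ := mem_base1_iff.1 hu
    rw [mem_base1_iff]
    change (imOct (g • u.rePart : R7)).1 = 0 ∧ (imOct (g • u.imPart : R7)).1 = 0 ∧
      (imOct (g • u.imPart : R7)).2 = -(_ * (imOct (g • u.rePart : R7)).2)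
    rw [imOct_smul, imOct_smul, ← Prod.mk.eta (p := imOct u.rePart.ofLp),
      ← Prod.mk.eta (p := imOct u.imPart.ofLp), hg, hg, h1, h2, h3]
    refine ⟨by simp, by simp, ?_⟩
    rw [mem_circleQ_iff] at hq₂
    simp only [mul_neg, neg_mul, ← mul_assoc, hq₂]

theorem mem_span_weightVec_five_iff {u : C7} : u ∈ Submodule.span ℂ {weightVec 5} ↔
    (imOct u.rePart).1 = 0 ∧ (imOct u.imPart).1 = 0 ∧ (imOct u.rePart).2.re = 0 ∧
    (imOct u.rePart).2.imI = 0 ∧ (imOct u.imPart).2 = -(qI * (imOct u.rePart).2) := by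
  constructor
  · intro hu
    obtain ⟨a, rfl⟩ := Submodule.mem_span_singleton.1 hu
    refine ⟨?_, ?_, ?_, ?_, ?_⟩
    · ext <;> simp [weightVec, C7.mk, stdVec, C7.rePart]
    · ext <;> simp [weightVec, C7.mk, stdVec, C7.imPart]
    · simp [weightVec, C7.mk, stdVec, C7.rePart]
    · simp [weightVec, C7.mk, stdVec, C7.rePart]
    · ext <;> simp [weightVec, C7.mk, stdVec, C7.rePart, C7.imPart]
  · rintro ⟨h1, h2, h3, h4, h5⟩
    obtain ⟨a, b, rfl⟩ := Submodule.mem_span_pair.1 (mem_base1_iff.2 ⟨h1, h2, h5⟩)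
    have e1 : a.re = 0 := by simpa [weightVec, C7.mk, stdVec, C7.rePart] using h3
    have e2 : a.im = 0 := by simpa [weightVec, C7.mk, stdVec, C7.rePart] using h4
    have e : a = 0 := Complex.ext e1 e2
    rw [e, zero_smul, zero_add]
    exact Submodule.smul_mem _ _ (Submodule.mem_span_singleton_self _)

theorem mem_base2_iff {u : C7} : u ∈ base2 ↔
    (imOct u.rePart).2 = 0 ∧ (imOct u.imPart).2 = 0 ∧ (imOct u.rePart).1.imI = 0 ∧
    (imOct u.imPart).1 = -(qI * (imOct u.rePart).1) := by
  constructor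
  · intro hu
    obtain ⟨a, rfl⟩ := Submodule.mem_span_singleton.1 hu
    refine ⟨?_, ?_, ?_, ?_⟩
    · ext <;> simp [weightVec, C7.mk, stdVec, C7.rePart]
    · ext <;> simp [weightVec, C7.mk, stdVec, C7.imPart]
    · simp [weightVec, C7.mk, stdVec, C7.rePart]
    · ext <;> simp [weightVec, C7.mk, stdVec, C7.rePart, C7.imPart]
  · rintro ⟨h1, h2, h3, h4⟩
    obtain ⟨a3, a4, a5, a6⟩ := mem_imH_iff_snd.2 h1
    obtain ⟨b3, b4, b5, b6⟩ := mem_imH_iff_snd.2 h2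
    have c0 := congrArg (fun q => q.imI) h4
    have c1 := congrArg (fun q => q.imJ) h4
    have c2 := congrArg (fun q => q.imK) h4
    simp [C7.rePart, C7.imPart] at a3 a4 a5 a6 b3 b4 b5 b6 c0 c1 c2 h3
    refine Submodule.mem_span_singleton.2 ⟨u 1, ?_⟩
    ext i
    fin_cases i <;> simp [weightVec, C7.mk, stdVec, Complex.ext_iff, a3, a4, a5, a6, b3, b4, b5,
      b6, c0, c1, c2, h3]

theorem stabilizer_base3 : MulAction.stabilizer G2 base3 = torusU1U1 := by
  ext g
  rw [MulAction.mem_stabilizer_iff]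
  have ek : qK = qI * qJ := by ext <;> simp
  have ej : qJ ≠ 0 := fun h => by
    simpa using congrArg (fun q => q.imJ) h
  constructor
  · intro h
    have h1 : g • imH = imH := by
      rw [← twistorProj3_base3, ← twistorProj3_smul, h]
    obtain ⟨q₁, -, q₂, -, hg⟩ := mem_SO4_of_smul_imH h1
    have hl : g • base3.1 = base3.1 := congrArg Prod.fst h
    have hD : g • base3.2 = base3.2 := congrArg Prod.snd h
    have h2 : g • base2 = base2 := by
      rw [← base3_orthogonal, smul_inf_submodule, ← smul_orthogonal, hl, hD]
    refine ⟨q₁, ?_, q₂, ?_, hg⟩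
    · have h4 := Submodule.smul_mem_pointwise_smul _ g _
        (Submodule.mem_span_singleton_self (R := ℂ) (weightVec 1))
      change _ ∈ g • base2 at h4
      rw [h2] at h4
      obtain ⟨-, -, -, h5⟩ := mem_base2_iff.1 h4
      change (imOct (g • -stdVec 2 : R7)).1 = -(_ * (imOct (g • stdVec 1 : R7)).1) at h5
      rw [smul_neg, imOct_neg, Prod.fst_neg, neg_inj, imOct_smul, imOct_smul, imOct_stdVec_one,
        imOct_stdVec_two, hg, hg, ek] at h5
      exact mem_circleQ_of_conj ej h5
    · have h4 := Submodule.smul_mem_pointwise_smul _ g _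
        (Submodule.mem_span_singleton_self (R := ℂ) (weightVec 5))
      change _ ∈ g • base3.1 at h4
      rw [hl] at h4
      obtain ⟨-, -, -, -, h5⟩ := mem_span_weightVec_five_iff.1 h4
      change (imOct (g • -stdVec 6 : R7)).2 = -(_ * (imOct (g • stdVec 5 : R7)).2) at h5
      rw [smul_neg, imOct_neg, Prod.snd_neg, neg_inj, imOct_smul, imOct_smul, imOct_stdVec_five,
        imOct_stdVec_six, hg, hg, ek] at h5
      exact mem_circleQ_of_conj ej h5
  · rintro ⟨q₁, hq₁, q₂, hq₂, hg⟩
    have c1 := mem_circleQ_iff.1 hq₁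
    have c2 := mem_circleQ_iff.1 hq₂
    obtain ⟨z1, z2⟩ := hq₁
    obtain ⟨z3, z4⟩ := hq₂
    have k5 : g • weightVec 5 ∈ Submodule.span ℂ {weightVec 5} := by
      rw [mem_span_weightVec_five_iff]
      change (imOct (g • stdVec 5 : R7)).1 = 0 ∧ (imOct (g • -stdVec 6 : R7)).1 = 0 ∧
        (imOct (g • stdVec 5 : R7)).2.re = 0 ∧ (imOct (g • stdVec 5 : R7)).2.imI = 0 ∧
        (imOct (g • -stdVec 6 : R7)).2 = -(_ * (imOct (g • stdVec 5 : R7)).2)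
      rw [smul_neg, imOct_neg, imOct_smul, imOct_smul, imOct_stdVec_five, imOct_stdVec_six, hg,
        hg, ek]
      refine ⟨by simp, by simp, by simp [z1, z2, z3, z4], by simp [z1, z2, z3, z4], ?_⟩
      simp only [Prod.snd_neg, ← mul_assoc, c2]
    have k1 : g • weightVec 1 ∈ base2 := by
      rw [mem_base2_iff]
      change (imOct (g • stdVec 1 : R7)).2 = 0 ∧ (imOct (g • -stdVec 2 : R7)).2 = 0 ∧
        (imOct (g • stdVec 1 : R7)).1.imI = 0 ∧
        (imOct (g • -stdVec 2 : R7)).1 = -(_ * (imOct (g • stdVec 1 : R7)).1)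
      rw [smul_neg, imOct_neg, imOct_smul, imOct_smul, imOct_stdVec_one, imOct_stdVec_two, hg,
        hg, ek]
      refine ⟨by simp, by simp, by simp [z1, z2], ?_⟩
      simp only [Prod.fst_neg, ← mul_assoc, c1]
    ext1
    · refine Submodule.eq_of_le_of_finrank_eq ?_ (finrank_smul_submodule g base3.1)
      change g • Submodule.span ℂ {weightVec 5} ≤ Submodule.span ℂ {weightVec 5}
      rwa [smul_span_singleton, Submodule.span_singleton_le_iff_mem]
    · refine Submodule.eq_of_le_of_finrank_eq ?_ (finrank_smul_submodule g base3.2)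
      change g • Submodule.span ℂ {weightVec 5, weightVec 1} ≤ base3.2
      rw [smul_span_pair, Submodule.span_le]
      rintro _ (rfl | rfl)
      · exact base3_mem.2.2.1 k5
      · exact (base3_orthogonal ▸ inf_le_left : base2 ≤ base3.2) k1

end OctCross

end

open OctCross in
theorem mainTheorem7 :
    (∃ (ξ₀ : Submodule ℝ R7) (W₀ : Submodule ℂ C7) (p₀ : Submodule ℂ C7 × Submodule ℂ C7),
      IsHomogeneousSpace AssocGr SO4 ξ₀ ∧
      IsHomogeneousSpace T1 U2plus W₀ ∧ twistorProj1 W₀ = ξ₀ ∧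
      IsHomogeneousSpace T3 torusU1U1 p₀ ∧ twistorProj3 p₀ = ξ₀) ∧
    IsG2BundleIso Flags1 T1 AssocGr evenProj twistorProj1 (fun ψ => leg ψ 1) ∧
    IsG2BundleIso Flags2 Q5 AssocGr evenProj twistorProj2 (fun ψ => leg ψ 2) ∧
    IsG2BundleIso Flags3 T3 AssocGr evenProj twistorProj3
      (fun ψ => (leg ψ 3, leg ψ 2 ⊔ leg ψ 3)) := by
  have hB : ∀ g : G2, g • imH ∈ AssocGr := fun g => smul_mem_AssocGr g imH_mem_AssocGr
  have hS := smoothAct_complex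
  refine ⟨⟨imH, base1, base3,
    hasLocalSections_AssocGr.isHomogeneousSpace smoothAct_real hB stabilizer_imH,
    hasLocalSections_T1.isHomogeneousSpace hS (fun g => smul_mem_T1 g base1_mem) stabilizer_base1,
    twistorProj1_base1,
    hasLocalSections_T3.isHomogeneousSpace (hS.prod hS) (fun g => smul_mem_T3 g base3_mem)
      stabilizer_base3, twistorProj3_base3⟩, ?_, ?_, ?_⟩
  · exact hasLocalSections_AssocGr.isG2BundleIso hB hS.pi hS smoothAct_real hasLocalSections_T1
      (fun g _ => smul_mem_T1 g) (fun g _ => smul_mem_G2Flags g)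
      (fun g ψ => evenProj_smul g ψ) twistorProj1_smul
      (fun g ψ => leg_smul g ψ 1) (fun _ => leg_one_mem_T1) injOn_leg_one
      (smoothOn_leg (by decide)) weightFlag_mem_Flags1 leg_weightFlag_one
      (evenProj_weightFlag (by decide) (by decide)) twistorProj1_base1
  · exact hasLocalSections_AssocGr.isG2BundleIso hB hS.pi hS smoothAct_real hasLocalSections_Q5
      (fun g _ => smul_mem_Q5 g) (fun g _ => smul_mem_G2Flags g)
      (fun g ψ => evenProj_smul g ψ) twistorProj2_smul
      (fun g ψ => leg_smul g ψ 2) (fun _ => leg_two_mem_Q5) injOn_leg_two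
      (smoothOn_leg (by decide)) weightFlag_mem_Flags2 leg_weightFlag_two
      (evenProj_weightFlag (by decide) (by decide)) twistorProj2_base2
  · refine hasLocalSections_AssocGr.isG2BundleIso hB hS.pi (hS.prod hS) smoothAct_real
      hasLocalSections_T3 (fun g _ => smul_mem_T3 g) (fun g _ => smul_mem_G2Flags g)
      (fun g ψ => evenProj_smul g ψ) twistorProj3_smul (fun g ψ => ?_) (fun _ => legs_mem_T3)
      injOn_legs_three smoothOn_legs_three weightFlag_mem_Flags3 legs_weightFlag_three
      (evenProj_weightFlag (by decide) (by decide)) twistorProj3_base3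
    rw [leg_smul, leg_smul, ← Submodule.smul_sup']
    rfl
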